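/- Let $P$ be a polygonal billiard table: a compact region of the plane bounded by a simple closed polygonal curve with finitely many edges, distinct edges carrying distinct labels from a finite alphabet $\mathcal A$. A billiard trajectory is nonsingular if it never meets a vertex. The bounce spectrum ${\sf B}(P)\subset\mathcal A^{\mathbb Z}$ is the set of all bi-infinite sequences of labels of the edges hit successively by nonsingular trajectories (any hit may be given any index). The forward bounce spectrum ${\sf B}_+(P)\subset\mathcal A^{\mathbb N}$ is the set of sequences of labels hit by nonsingular forward trajectories, an edge containing the base point not being counted as the first hit. The bounce language $\mathcal L$ is the set of finite subwords of elements of ${\sf B}(P)$. Closures are taken in the product topologies, $\mathcal A$ being discrete. Let $A,B$ be edges. A sequence $E=(\dots,E_{-2},E_{-1},E_1,E_2,\dots)$ of edges, together with a finite word $w$ to be inserted between $E_{-1}$ and $E_1$, is called a *grazing sequence for $\{A,B\}$ with insertion $w$* if * the bi-infinite sequence $\dots E_{-2}E_{-1}\,w\,E_1E_2\dots$ lies in $\overline{{\sf B}(P)}$; * $\{E_{-1},E_1\}\cap\{A,B\}=\emptyset$; * for $(F,G)=(A,B)$ or for $(F,G)=(B,A)$, both $(F,E_{-1},E_{-2},\dots)$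 and $(G,E_1,E_2,\dots)$ lie in $\overline{{\sf B}_+(P)}$. **Statement.** Let $A$ and $B$ be adjacent edges of $P$ whose interior angle is not $\pi$. Then the interior angle between $A$ and $B$ is $3\pi/2$ if and only if there exist sequences $E^1,E^2,E^3$ that are grazing sequences for $\{A,B\}$ with insertions $\varnothing$, $A$, $B$ respectively, such that for every $n\in\mathbb N$ the six words \begin{align*} &E^1_{-n}\cdots E^1_{-2}E^1_{-1}\;E^1_1E^1_2\cdots E^1_n,\\ &E^1_{n}\cdots E^1_{2}E^1_{1}\;B\;E^2_{-1}E^2_{-2}\cdots E^2_{-n},\\ &E^2_{-n}\cdots E^2_{-2}E^2_{-1}\;A\;E^2_1E^2_2\cdots E^2_n,\\ &E^2_{n}\cdots E^2_{2}E^2_{1}\;E^3_{-1}E^3_{-2}\cdots E^3_{-n},\\ &E^3_{-n}\cdots E^3_{-2}E^3_{-1}\;B\;E^3_1E^3_2\cdots E^3_n,\\ &E^3_{n}\cdots E^3_{2}E^3_{1}\;A\;E^1_{-1}E^1_{-2}\cdots E^1_{-n} \end{align*} belong to $\mathcal L$. -/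

import Mathlib

open scoped Real

noncomputable section

/-- A polygonal billiard table with `n` edges: a compact region `region` of the plane `ℂ`, with
connected interior, bounded by a simple closed polygonal curve. Edge `i` is the segment from
vertex `i` to the cyclically next vertex `finRotate n i`. The edges are labelled by the alphabet
`Fin n`, distinct edges by distinct labels. -/
structure PolygonalTable (n : ℕ) extends Polygon ℂ n where
  three_le : 3 ≤ n
  vertices_injective : Function.Injective vertices
  edge_inter_next : ∀ i : Fin n,
    toPolygon.edgeSet ℝ i ∩ toPolygon.edgeSet ℝ (finRotate n i) = {vertices (finRotate n i)}
  edge_disjoint : ∀ i j : Fin n, i ≠ j → j ≠ finRotate n i → i ≠ finRotate n j →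
    Disjoint (toPolygon.edgeSet ℝ i) (toPolygon.edgeSet ℝ j)
  region : Set ℂ
  region_compact : IsCompact region
  region_connected : IsConnected (interior region)
  region_regular : closure (interior region) = region
  frontier_region : frontier region = toPolygon.boundary ℝ

namespace PolygonalTable

variable {n : ℕ}

/-- The closed edge with label `i`. -/
def edge (P : PolygonalTable n) (i : Fin n) : Set ℂ := P.toPolygon.edgeSet ℝ i

/-- The edge with label `i`, without its two endpoints. -/
def openEdge (P : PolygonalTable n) (i : Fin n) : Set ℂ :=
  openSegment ℝ (P.vertices i) (P.vertices (finRotate n i))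

/-- Two edges are adjacent if one follows the other along the boundary. -/
def Adjacent (P : PolygonalTable n) (A B : Fin n) : Prop :=
  B = finRotate n A ∨ A = finRotate n B

/-- Near a common endpoint `p`, the edge `A` leaves `p` in the unit direction `d`, the edge `B`
leaves `p` in the direction obtained from `d` by a counterclockwise turn through `φ`, and the
open sector swept out by that turn lies in the interior of the table. -/
def IsCorner (P : PolygonalTable n) (A B : Fin n) (φ : ℝ) : Prop :=
  ∃ (p d : ℂ) (r : ℝ), ‖d‖ = 1 ∧ 0 < r ∧ ∀ s ∈ Set.Ioc 0 r,
    p + s * d ∈ P.edge A ∧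
    p + s * (Complex.exp (φ * Complex.I) * d) ∈ P.edge B ∧
    ∀ t ∈ Set.Ioo 0 φ, p + s * (Complex.exp (t * Complex.I) * d) ∈ interior P.region

/-- The edges `A` and `B` share an endpoint, and the interior angle of the table there is `φ`. -/
def HasInteriorAngle (P : PolygonalTable n) (A B : Fin n) (φ : ℝ) : Prop :=
  φ ∈ Set.Ioo 0 (2 * π) ∧ (P.IsCorner A B φ ∨ P.IsCorner B A φ)

/-- A billiard ball can move along the segment from `x` to `y`, without meeting the boundary
strictly between them. -/
def FreeFlight (P : PolygonalTable n) (x y : ℂ) : Prop :=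
  x ≠ y ∧ openSegment ℝ x y ⊆ interior P.region

/-- Optical reflection: the ball that comes from `x` hits edge `i` at the point `y`, which is not a
vertex, and leaves towards `z`; the outgoing direction is the mirror image of the incoming one in
the line through the edge. -/
def Bounce (P : PolygonalTable n) (i : Fin n) (x y z : ℂ) : Prop :=
  y ∈ P.openEdge i ∧
  SameRay ℝ (z - y)
    ((Submodule.span ℝ {P.vertices (finRotate n i) - P.vertices i}).reflection (y - x))

/-- The bounce spectrum: all sequences `e` of labels of the edges that are hit successively by a
nonsingular billiard trajectory; `x i` is the point at which edge `e i` is hit. Any hit may carry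
the index `0`, since any point of a trajectory may be its base point. -/
def bounceSpectrum (P : PolygonalTable n) : Set (ℤ → Fin n) :=
  {e | ∃ x : ℤ → ℂ, ∀ i : ℤ,
    P.FreeFlight (x i) (x (i + 1)) ∧ P.Bounce (e i) (x (i - 1)) (x i) (x (i + 1))}

/-- The forward bounce spectrum: `x 0` is the base point of a nonsingular forward trajectory,
anywhere in the table except at a vertex, and `x (k + 1)` is the point of its hit number `k`, on
the edge `e k`. A base point on the boundary does not count as a hit. -/
def forwardBounceSpectrum (P : PolygonalTable n) : Set (ℕ → Fin n) :=
  {e | ∃ x : ℕ → ℂ, x 0 ∈ P.region ∧ x 0 ∉ Set.range P.vertices ∧ ∀ k : ℕ,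
    P.FreeFlight (x k) (x (k + 1)) ∧ P.Bounce (e k) (x k) (x (k + 1)) (x (k + 2))}

/-- The bounce language: all finite subwords of sequences in the bounce spectrum. -/
def bounceLanguage (P : PolygonalTable n) : Set (List (Fin n)) :=
  {w | ∃ e ∈ P.bounceSpectrum, ∃ k : ℤ, ∀ (i : ℕ) (hi : i < w.length), w[i] = e (k + i)}

end PolygonalTable

section Words

variable {α : Type*}

/-- The one-sided sequence `E 1, E 2, E 3, …`. -/
def tailSeq (E : ℤ → α) : ℕ → α := fun k => E (k + 1)

/-- The one-sided sequence `E (-1), E (-2), E (-3), …`. -/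
def headSeq (E : ℤ → α) : ℕ → α := fun k => E (-(k + 1))

/-- The sequence `a, f 0, f 1, …`. -/
def prefixed (a : α) (f : ℕ → α) : ℕ → α
  | 0 => a
  | k + 1 => f k

/-- The word `f (N - 1) … f 1 f 0 w g 0 g 1 … g (N - 1)`. -/
def centralWord (f : ℕ → α) (w : List α) (g : ℕ → α) (N : ℕ) : List α :=
  ((List.range N).map f).reverse ++ w ++ (List.range N).map g

/-- The bi-infinite sequence `… f 1 f 0 w g 0 g 1 …`, in which `w` starts at index `0`. -/
def centralSeq (f : ℕ → α) (w : List α) (g : ℕ → α) : ℤ → α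
  | Int.negSucc k => f k
  | Int.ofNat k => if h : k < w.length then w[k] else g (k - w.length)

end Words

namespace PolygonalTable

variable {n : ℕ}

/-- The sequence `… E (-2) E (-1) E 1 E 2 …` (the value `E 0` plays no role), with the word `w`
inserted in its middle, is a bounce sequence of an ideal trajectory, and this trajectory is grazed
in the middle by `F` on the backward side and by `G` on the forward side. Closures are taken in
the product topology, for the discrete topology on the alphabet. -/
def GrazesAt (P : PolygonalTable n) (F G : Fin n) (E : ℤ → Fin n) (w : List (Fin n)) : Prop :=
  centralSeq (headSeq E) w (tailSeq E) ∈ closure P.bounceSpectrum ∧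
  Disjoint ({E (-1), E 1} : Set (Fin n)) {F, G} ∧
  prefixed F (headSeq E) ∈ closure P.forwardBounceSpectrum ∧
  prefixed G (tailSeq E) ∈ closure P.forwardBounceSpectrum

/-- `E`, with middle insertion `w`, is a grazing sequence for the unordered pair `{A, B}`. -/
def IsGrazingSequence (P : PolygonalTable n) (A B : Fin n) (E : ℤ → Fin n)
    (w : List (Fin n)) : Prop :=
  P.GrazesAt A B E w ∨ P.GrazesAt B A E w

end PolygonalTable

end

/-! ### Connected sets and frontiers -/

namespace PolygonalTable

/-! Let `f` and `g` be the unit directions in which `A` and `B` leave their common vertex `v`.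

From the angle to the words. At an angle 3π/2 the table is, near `v`, the complement of a closed
quadrant. For all but countably many slopes, the rays from `v` in the directions (c, -s), (-c, -s),
(-c, s), in coordinates along `f` and `g`, never meet a vertex again; let α, β, γ be their codes.
The first and third directions are opposite, so a line passing `v` on the side of the table reads α
backwards and then γ. The first two are related by a bounce on `A`, the last two by a bounce on `B`.
Since long initial codes are stable under small parallel shifts (`IsForward.exists_stable`), and
generic shifts avoid vertices, all these words occur in the language. The pairs (α, γ), (β, α), (γ,
β) are the required sequences, and the six words reduce to three words, each used twice
(`exists_sequences`).

From the words to the angle. Two trajectories with a long common code have almost the same initial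
direction, because their unfoldings are long and stay at bounded distance
(`exists_direction_bound`). Composing the changes of direction in the middle of the six words
therefore shows that the square of the product of the reflections in `A` and `B` is the identity, so
the edges are parallel or perpendicular (`dot_or_cross_eq_zero`). Parallel edges are excluded by the
hypothesis on the angle π, and the angle is π/2 or 3π/2.

Suppose it is π/2 (`Corner.false_of_convex`). The second and third words give trajectories out of
`B` and out of `A` that share arbitrarily long codes and whose backward continuations first hit a
third edge. The latter keeps their starting points away from `v` and their directions away from the
directions of the sides. In the limit there are parallel trajectories, starting on `A` and on `B` at
a positive distance, with the same infinite code. The ray from `v` parallel to them runs strictly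
between, inside a strip of constant width that is reflected as a whole forever. This is impossible
(`no_strip`): by a pigeonhole argument the ray returns close to an earlier position with an almost
equal direction; traced backwards, the earlier piece stays in the strip around the later one and
hits the same edges, until the vertex `v` itself would have to be an inner point of an edge.

Free flights are obtained from one topological principle: an open cell whose frontier meets no edges
other than some that stay outside the cell contains no boundary point, since the boundary is a
single closed curve (`halfplanes_subset_interior`). -/

theorem inter_frontier_nonempty {X : Type*} [TopologicalSpace X] {s t : Set X}
    (hs : IsPreconnected s) (h₁ : (s ∩ t).Nonempty) (h₂ : (s ∩ tᶜ).Nonempty) :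
    (s ∩ frontier t).Nonempty := by
  by_contra hc
  rw [Set.not_nonempty_iff_eq_empty] at hc
  have hno : ∀ x ∈ s, x ∉ frontier t := fun x hx hf => (hc ▸ ⟨hx, hf⟩ : x ∈ (∅ : Set X))
  have hcov : s ⊆ interior t ∪ interior tᶜ := by
    intro x hx
    have := hno x hx
    rw [frontier, Set.mem_sdiff, not_and_not_right] at this
    by_cases hcl : x ∈ closure t
    · exact Or.inl (this hcl)
    · right; rwa [interior_compl]
  obtain ⟨a, ha, hat⟩ := h₁
  obtain ⟨b, hb, hbt⟩ := h₂
  obtain ⟨z, -, hz, hz'⟩ := hs _ _ isOpen_interior isOpen_interior hcov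
    ⟨a, ha, (hcov ha).resolve_right fun h => interior_subset h hat⟩
    ⟨b, hb, (hcov hb).resolve_left fun h => hbt (interior_subset h)⟩
  exact interior_subset hz' (interior_subset hz)

/-! ### Plane vectors -/

/-- The determinant of two plane vectors. -/
def cross (a b : ℂ) : ℝ := a.re * b.im - a.im * b.re

/-- The scalar product of two plane vectors. -/
def dot (a b : ℂ) : ℝ := a.re * b.re + a.im * b.im

theorem cross_add_right (a b c : ℂ) : cross a (b + c) = cross a b + cross a c := by
  simp only [cross, Complex.add_re, Complex.add_im]; ring

theorem cross_sub_right (a b c : ℂ) : cross a (b - c) = cross a b - cross a c := by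
  simp only [cross, Complex.sub_re, Complex.sub_im]; ring

theorem cross_add_left (a b c : ℂ) : cross (a + b) c = cross a c + cross b c := by
  simp only [cross, Complex.add_re, Complex.add_im]; ring

theorem cross_smul_right (a : ℂ) (t : ℝ) (b : ℂ) : cross a (t • b) = t * cross a b := by
  simp only [cross, Complex.smul_re, Complex.smul_im, smul_eq_mul]; ring

theorem cross_smul_left (t : ℝ) (a b : ℂ) : cross (t • a) b = t * cross a b := by
  simp only [cross, Complex.smul_re, Complex.smul_im, smul_eq_mul]; ring

theorem cross_neg_right (a b : ℂ) : cross a (-b) = -cross a b := by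
  simp only [cross, Complex.neg_re, Complex.neg_im]; ring

theorem cross_neg_left (a b : ℂ) : cross (-a) b = -cross a b := by
  simp only [cross, Complex.neg_re, Complex.neg_im]; ring

theorem cross_self (a : ℂ) : cross a a = 0 := by simp only [cross]; ring

theorem cross_swap (a b : ℂ) : cross a b = -cross b a := by simp only [cross]; ring

theorem cross_zero_right (a : ℂ) : cross a 0 = 0 := by simp [cross]

theorem dot_add_right (a b c : ℂ) : dot a (b + c) = dot a b + dot a c := by
  simp only [dot, Complex.add_re, Complex.add_im]; ring

theorem dot_sub_right (a b c : ℂ) : dot a (b - c) = dot a b - dot a c := by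
  simp only [dot, Complex.sub_re, Complex.sub_im]; ring

theorem dot_sub_left (a b c : ℂ) : dot (a - b) c = dot a c - dot b c := by
  simp only [dot, Complex.sub_re, Complex.sub_im]; ring

theorem dot_smul_right (a : ℂ) (t : ℝ) (b : ℂ) : dot a (t • b) = t * dot a b := by
  simp only [dot, Complex.smul_re, Complex.smul_im, smul_eq_mul]; ring

theorem dot_smul_left (t : ℝ) (a b : ℂ) : dot (t • a) b = t * dot a b := by
  simp only [dot, Complex.smul_re, Complex.smul_im, smul_eq_mul]; ring

theorem dot_neg_right (a b : ℂ) : dot a (-b) = -dot a b := by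
  simp only [dot, Complex.neg_re, Complex.neg_im]; ring

theorem dot_neg_left (a b : ℂ) : dot (-a) b = -dot a b := by
  simp only [dot, Complex.neg_re, Complex.neg_im]; ring

theorem dot_comm (a b : ℂ) : dot a b = dot b a := by simp only [dot]; ring

theorem dot_self (a : ℂ) : dot a a = ‖a‖ ^ 2 := by
  rw [← Complex.normSq_eq_norm_sq, Complex.normSq_apply, dot]

theorem dot_sq_add_cross_sq (a b : ℂ) : dot a b ^ 2 + cross a b ^ 2 = ‖a‖ ^ 2 * ‖b‖ ^ 2 := by
  rw [← dot_self, ← dot_self]; simp only [dot, cross]; ring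

theorem abs_dot_le (a b : ℂ) : |dot a b| ≤ ‖a‖ * ‖b‖ := by
  apply abs_le_of_sq_le_sq _ (by positivity)
  nlinarith [dot_sq_add_cross_sq a b, sq_nonneg (cross a b)]

theorem inner_eq_dot (a b : ℂ) : inner ℝ a b = dot a b := by
  rw [Complex.inner, dot]; simp; ring

theorem continuous_cross : Continuous fun z : ℂ × ℂ => cross z.1 z.2 := by
  unfold cross; fun_prop

theorem continuous_dot : Continuous fun z : ℂ × ℂ => dot z.1 z.2 := by
  unfold dot; fun_prop

@[fun_prop]
theorem continuous_cross_fun {X : Type*} [TopologicalSpace X] {f g : X → ℂ} (hf : Continuous f)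
    (hg : Continuous g) : Continuous fun x => cross (f x) (g x) :=
  continuous_cross.comp (hf.prodMk hg)

@[fun_prop]
theorem continuous_dot_fun {X : Type*} [TopologicalSpace X] {f g : X → ℂ} (hf : Continuous f)
    (hg : Continuous g) : Continuous fun x => dot (f x) (g x) :=
  continuous_dot.comp (hf.prodMk hg)

theorem exists_smul_of_cross_eq_zero {a b : ℂ} (ha : a ≠ 0) (h : cross a b = 0) :
    ∃ t : ℝ, b = t • a := by
  refine ⟨dot a b / ‖a‖ ^ 2, ?_⟩
  have hn : ‖a‖ ^ 2 ≠ 0 := by positivity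
  rw [← dot_self] at hn ⊢
  simp only [cross] at h
  apply Complex.ext <;> simp only [Complex.smul_re, Complex.smul_im, smul_eq_mul] <;>
    field_simp <;> simp only [dot]
  · linear_combination (-a.im) * h
  · linear_combination (a.re) * h

theorem ext_of_dot_cross {a b c : ℂ} (ha : a ≠ 0) (h : dot a b = dot a c)
    (h' : cross a b = cross a c) : b = c := by
  have hn : ‖a‖ ^ 2 ≠ 0 := by positivity
  rw [← dot_self] at hn
  simp only [dot, cross] at h h' hn
  apply Complex.ext <;> apply mul_left_cancel₀ hn
  · linear_combination a.re * h - a.im * h'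
  · linear_combination a.im * h + a.re * h'

/-- The direction from `x` to `y`. -/
noncomputable def dir (x y : ℂ) : ℂ := ‖y - x‖⁻¹ • (y - x)

theorem norm_dir {x y : ℂ} (h : x ≠ y) : ‖dir x y‖ = 1 := by
  have : ‖y - x‖ ≠ 0 := norm_ne_zero_iff.2 (sub_ne_zero.2 h.symm)
  rw [dir, norm_smul, norm_inv, norm_norm, inv_mul_cancel₀ this]

theorem norm_smul_dir (x y : ℂ) : ‖y - x‖ • dir x y = y - x := by
  by_cases h : y - x = 0
  · simp [h]
  · rw [dir, smul_smul, mul_inv_cancel₀ (norm_ne_zero_iff.2 h), one_smul]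

theorem dir_swap (x y : ℂ) : dir y x = -dir x y := by
  rw [dir, dir, ← smul_neg, neg_sub, norm_sub_rev]

theorem dir_add_smul {x u : ℂ} (hu : ‖u‖ = 1) {t : ℝ} (ht : 0 < t) : dir x (x + t • u) = u := by
  rw [dir, add_sub_cancel_left, norm_smul, hu, smul_smul, Real.norm_of_nonneg ht.le, mul_one,
    inv_mul_cancel₀ ht.ne', one_smul]

/-! ### Reflections -/

theorem reflection_span_apply (w z : ℂ) :
    (Submodule.span ℝ {w}).reflection z = (2 * (dot w z / ‖w‖ ^ 2)) • w - z := by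
  rw [Submodule.reflection_singleton_apply, inner_eq_dot, two_nsmul, ← add_smul, two_mul]
  norm_cast

theorem dot_reflection {w : ℂ} (hw : w ≠ 0) (z : ℂ) :
    dot w ((Submodule.span ℝ {w}).reflection z) = dot w z := by
  have : ‖w‖ ^ 2 ≠ 0 := by positivity
  rw [reflection_span_apply, dot_sub_right, dot_smul_right, dot_self]
  field_simp; ring

theorem cross_reflection (w z : ℂ) :
    cross w ((Submodule.span ℝ {w}).reflection z) = -cross w z := by
  rw [reflection_span_apply, cross_sub_right, cross_smul_right, cross_self]; ring

theorem dot_reflection_reflection (w a b : ℂ) :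
    dot ((Submodule.span ℝ {w}).reflection a) ((Submodule.span ℝ {w}).reflection b) = dot a b := by
  rw [← inner_eq_dot, ← inner_eq_dot, LinearIsometryEquiv.inner_map_map]

variable {n : ℕ}

/-! ### Edges -/

theorem next_ne (P : PolygonalTable n) (i : Fin n) : finRotate n i ≠ i := by
  have h := P.three_le
  have : i ∈ (finRotate n).support := by
    rw [support_finRotate_of_le (by omega)]; exact Finset.mem_univ _
  exact Equiv.Perm.mem_support.1 this

/-- The cyclic successor is one single cycle; this is how connectedness of the boundary curve
enters. -/
theorem forall_of_next (P : PolygonalTable n) {p : Fin n → Prop} {i₀ : Fin n} (h₀ : p i₀)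
    (h : ∀ i, p i → p (finRotate n i)) (i : Fin n) : p i := by
  have h3 := P.three_le
  obtain ⟨k, hk⟩ := (isCycle_finRotate_of_le (by omega : 2 ≤ n)).exists_pow_eq
    (P.next_ne i₀) (P.next_ne i)
  rw [← hk]
  clear hk
  induction k with
  | zero => simpa using h₀
  | succ k ih => rw [pow_succ']; exact h _ ih

variable (P : PolygonalTable n)

/-- The vector of the edge `i`. -/
def edgeVec (i : Fin n) : ℂ := P.vertices (finRotate n i) - P.vertices i

theorem edgeVec_ne_zero (i : Fin n) : P.edgeVec i ≠ 0 :=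
  sub_ne_zero.2 fun h => P.next_ne i (P.vertices_injective h)

theorem mem_openEdge {i : Fin n} {y : ℂ} :
    y ∈ P.openEdge i ↔ ∃ t : ℝ, 0 < t ∧ t < 1 ∧ y = P.vertices i + t • P.edgeVec i := by
  rw [openEdge, openSegment_eq_image']
  simp only [Set.mem_image, Set.mem_Ioo, edgeVec]
  exact ⟨fun ⟨t, h, e⟩ => ⟨t, h.1, h.2, e.symm⟩, fun ⟨t, h, h', e⟩ => ⟨t, ⟨h, h'⟩, e.symm⟩⟩

theorem edge_eq_segment (i : Fin n) :
    P.edge i = segment ℝ (P.vertices i) (P.vertices (finRotate n i)) := by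
  rw [edge, Polygon.edgeSet, affineSegment_eq_segment]

theorem mem_edge {i : Fin n} {y : ℂ} :
    y ∈ P.edge i ↔ ∃ t : ℝ, 0 ≤ t ∧ t ≤ 1 ∧ y = P.vertices i + t • P.edgeVec i := by
  rw [edge_eq_segment, segment_eq_image']
  simp only [Set.mem_image, Set.mem_Icc, edgeVec]
  exact ⟨fun ⟨t, h, e⟩ => ⟨t, h.1, h.2, e.symm⟩, fun ⟨t, h, h', e⟩ => ⟨t, ⟨h, h'⟩, e.symm⟩⟩

theorem openEdge_subset_edge (i : Fin n) : P.openEdge i ⊆ P.edge i := by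
  rw [edge_eq_segment]; exact openSegment_subset_segment _ _ _

theorem isCompact_edge (i : Fin n) : IsCompact (P.edge i) := by
  rw [edge_eq_segment, ← convexHull_pair]
  exact (Set.toFinite _).isCompact_convexHull ℝ

theorem convex_edge (i : Fin n) : Convex ℝ (P.edge i) := by
  rw [edge_eq_segment]; exact convex_segment _ _

theorem vertex_mem_edge (i : Fin n) : P.vertices i ∈ P.edge i := by
  rw [edge_eq_segment]; exact left_mem_segment _ _ _

theorem next_vertex_mem_edge (i : Fin n) : P.vertices (finRotate n i) ∈ P.edge i := by
  rw [edge_eq_segment]; exact right_mem_segment _ _ _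

theorem mem_edge_cases {i : Fin n} {y : ℂ} (h : y ∈ P.edge i) :
    y = P.vertices i ∨ y = P.vertices (finRotate n i) ∨ y ∈ P.openEdge i := by
  obtain ⟨t, h0, h1, rfl⟩ := P.mem_edge.1 h
  rcases h0.eq_or_lt with rfl | h0
  · simp
  rcases h1.eq_or_lt with rfl | h1
  · simp [edgeVec]
  · exact Or.inr (Or.inr (P.mem_openEdge.2 ⟨t, h0, h1, rfl⟩))

theorem edge_inter_edge_next (i : Fin n) :
    P.edge i ∩ P.edge (finRotate n i) = {P.vertices (finRotate n i)} := P.edge_inter_next i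

theorem vertex_notMem_openEdge_self (i : Fin n) : P.vertices i ∉ P.openEdge i := by
  intro h
  obtain ⟨t, h0, h1, e⟩ := P.mem_openEdge.1 h
  have : t • P.edgeVec i = 0 := by simpa using e
  exact (smul_ne_zero h0.ne' (P.edgeVec_ne_zero i)) this

theorem next_vertex_notMem_openEdge (i : Fin n) : P.vertices (finRotate n i) ∉ P.openEdge i := by
  intro h
  obtain ⟨t, h0, h1, e⟩ := P.mem_openEdge.1 h
  have : (1 - t) • P.edgeVec i = 0 := by
    rw [sub_smul, one_smul, sub_eq_zero]
    rw [← sub_eq_iff_eq_add'] at e; exact e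
  exact (smul_ne_zero (sub_ne_zero.2 h1.ne') (P.edgeVec_ne_zero i)) this


theorem eq_or_eq_of_vertex_mem_edge {k j : Fin n} (h : P.vertices k ∈ P.edge j) :
    k = j ∨ k = finRotate n j := by
  by_contra! hc
  obtain ⟨h1, h2⟩ := hc
  by_cases h3 : j = finRotate n k
  · have : P.vertices k ∈ P.edge k ∩ P.edge (finRotate n k) := ⟨P.vertex_mem_edge k, h3 ▸ h⟩
    rw [edge_inter_edge_next] at this
    exact P.next_ne k (P.vertices_injective this).symm
  · exact Set.disjoint_left.1 (P.edge_disjoint k j h1 h3 h2) (P.vertex_mem_edge k) h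

theorem disjoint_openEdge_edge {i j : Fin n} (h : i ≠ j) :
    Disjoint (P.openEdge i) (P.edge j) := by
  rw [Set.disjoint_left]
  intro y hi hj
  have hi' := P.openEdge_subset_edge i hi
  by_cases h1 : j = finRotate n i
  · have : y ∈ P.edge i ∩ P.edge (finRotate n i) := ⟨hi', h1 ▸ hj⟩
    rw [edge_inter_edge_next] at this
    rw [Set.mem_singleton_iff.1 this] at hi
    exact P.next_vertex_notMem_openEdge i hi
  by_cases h2 : i = finRotate n j
  · have : y ∈ P.edge j ∩ P.edge (finRotate n j) := ⟨hj, h2 ▸ hi'⟩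
    rw [edge_inter_edge_next] at this
    rw [Set.mem_singleton_iff.1 this, ← h2] at hi
    exact P.vertex_notMem_openEdge_self i hi
  exact Set.disjoint_left.1 (P.edge_disjoint i j h h1 h2) hi' hj

theorem vertex_notMem_openEdge (k i : Fin n) : P.vertices k ∉ P.openEdge i := by
  intro h
  by_cases hk : i = k
  · subst hk; exact P.vertex_notMem_openEdge_self i h
  · exact Set.disjoint_left.1 (P.disjoint_openEdge_edge hk) h (P.vertex_mem_edge k)

theorem eq_of_mem_openEdge {i j : Fin n} {y : ℂ} (hi : y ∈ P.openEdge i) (hj : y ∈ P.edge j) :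
    i = j := by
  by_contra h
  exact Set.disjoint_left.1 (P.disjoint_openEdge_edge h) hi hj

/-! ### The region and its boundary -/

theorem frontier_eq : frontier P.region = ⋃ i, P.edge i := P.frontier_region

theorem edge_subset_frontier (i : Fin n) : P.edge i ⊆ frontier P.region := by
  rw [frontier_eq]; exact Set.subset_iUnion _ i

theorem isClosed_region : IsClosed P.region := P.region_compact.isClosed

theorem frontier_subset_region : frontier P.region ⊆ P.region :=
  P.isClosed_region.frontier_subset

theorem edge_subset_region (i : Fin n) : P.edge i ⊆ P.region :=
  (P.edge_subset_frontier i).trans P.frontier_subset_region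

theorem notMem_interior_of_mem_edge {i : Fin n} {y : ℂ} (h : y ∈ P.edge i) :
    y ∉ interior P.region := by
  have := P.edge_subset_frontier i h
  rw [P.isClosed_region.frontier_eq] at this
  exact this.2

theorem mem_frontier_or_interior {y : ℂ} (h : y ∈ P.region) :
    (∃ i, y ∈ P.edge i) ∨ y ∈ interior P.region := by
  by_cases hy : y ∈ interior P.region
  · exact Or.inr hy
  · left
    have : y ∈ frontier P.region := by rw [P.isClosed_region.frontier_eq]; exact ⟨h, hy⟩
    rw [frontier_eq] at this
    simpa using this

/-- A connected set that misses the boundary lies in the interior or in the exterior. -/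
theorem subset_interior_or_disjoint {S : Set ℂ} (hS : IsPreconnected S)
    (h : ∀ i, Disjoint (P.edge i) S) : S ⊆ interior P.region ∨ Disjoint S P.region := by
  by_contra! hc
  obtain ⟨h1, h2⟩ := hc
  obtain ⟨a, ha, ha'⟩ := Set.not_disjoint_iff.1 h2
  obtain ⟨b, hb, hb'⟩ := Set.not_subset.1 h1
  have hbr : b ∉ P.region := by
    intro hbr
    rcases P.mem_frontier_or_interior hbr with ⟨i, hi⟩ | hi
    · exact Set.disjoint_left.1 (h i) hi hb
    · exact hb' hi
  obtain ⟨z, hz, hz'⟩ := inter_frontier_nonempty hS ⟨a, ha, ha'⟩ ⟨b, hb, hbr⟩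
  rw [frontier_eq, Set.mem_iUnion] at hz'
  obtain ⟨i, hi⟩ := hz'
  exact Set.disjoint_left.1 (h i) hi hz

/-- If the boundary of the open set `U` meets only edges that stay outside `U`, then no edge
enters `U`. -/
theorem disjoint_edge_of_frontier {U : Set ℂ} {S : Set (Fin n)}
    (hne : S.Nonempty) (h₁ : ∀ i ∈ S, Disjoint (P.edge i) U)
    (h₂ : ∀ i ∉ S, Disjoint (P.edge i) (frontier U)) (i : Fin n) : Disjoint (P.edge i) U := by
  -- An edge is connected: if it starts outside `U` and misses the frontier of `U`, it stays
  -- outside, and so does the start of the next edge.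
  have key : ∀ j, P.vertices j ∉ U → Disjoint (P.edge j) U := by
    intro j hj
    by_cases hjS : j ∈ S
    · exact h₁ j hjS
    rw [Set.disjoint_iff_inter_eq_empty, ← Set.not_nonempty_iff_eq_empty]
    rintro hne
    have hz := inter_frontier_nonempty (P.convex_edge j).isPreconnected (t := U) hne
      ⟨_, P.vertex_mem_edge j, hj⟩
    exact Set.not_disjoint_iff_nonempty_inter.2 hz (h₂ j hjS)
  obtain ⟨i₀, hi₀⟩ := hne
  apply key
  refine P.forall_of_next (i₀ := i₀) (p := fun i => P.vertices i ∉ U) ?_ ?_ i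
  · exact fun h => Set.disjoint_left.1 (h₁ i₀ hi₀) (P.vertex_mem_edge i₀) h
  · exact fun j hj h => Set.disjoint_left.1 (key j hj) (P.next_vertex_mem_edge j) h

/-- An open preconnected set whose boundary avoids the edges, apart from edges outside the set, is
contained in the interior of the table as soon as it meets it. -/
theorem subset_interior_of_frontier {U : Set ℂ} (hc : IsPreconnected U)
    {S : Set (Fin n)} (hne : S.Nonempty) (h₁ : ∀ i ∈ S, Disjoint (P.edge i) U)
    (h₂ : ∀ i ∉ S, Disjoint (P.edge i) (frontier U)) (hm : (U ∩ interior P.region).Nonempty) :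
    U ⊆ interior P.region := by
  rcases P.subset_interior_or_disjoint hc (P.disjoint_edge_of_frontier hne h₁ h₂) with h | h
  · exact h
  · obtain ⟨z, hz, hz'⟩ := hm
    exact absurd (interior_subset hz') (Set.disjoint_left.1 h hz)

end PolygonalTable

namespace PolygonalTable

variable {n : ℕ} (P : PolygonalTable n)

/-! ### The inner side of an edge -/

theorem exists_ball_mem_edge (y : ℂ) :
    ∃ ρ > 0, ∀ w ∈ Metric.ball y ρ, ∀ j, w ∈ P.edge j → y ∈ P.edge j := by
  have hcl : IsClosed (⋃ j ∈ {j : Fin n | y ∉ P.edge j}, P.edge j) :=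
    (Set.toFinite _).isClosed_biUnion fun j _ => (P.isCompact_edge j).isClosed
  obtain ⟨ρ, hρ, h⟩ := Metric.isOpen_iff.1 hcl.isOpen_compl y (by simp)
  refine ⟨ρ, hρ, fun w hw j hj => ?_⟩
  by_contra hy
  exact h hw (Set.mem_biUnion (show j ∈ {j : Fin n | y ∉ P.edge j} from hy) hj)

theorem mem_openEdge_iff {i : Fin n} {y : ℂ} : y ∈ P.openEdge i ↔
    cross (P.edgeVec i) (y - P.vertices i) = 0 ∧ 0 < dot (P.edgeVec i) (y - P.vertices i) ∧
      dot (P.edgeVec i) (y - P.vertices i) < ‖P.edgeVec i‖ ^ 2 := by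
  have hn : 0 < ‖P.edgeVec i‖ ^ 2 := by have := P.edgeVec_ne_zero i; positivity
  rw [mem_openEdge]
  constructor
  · rintro ⟨t, h0, h1, rfl⟩
    rw [add_sub_cancel_left, cross_smul_right, cross_self, dot_smul_right, dot_self]
    exact ⟨by ring, by positivity, by nlinarith⟩
  · rintro ⟨h, h0, h1⟩
    obtain ⟨t, ht⟩ := exists_smul_of_cross_eq_zero (P.edgeVec_ne_zero i) h
    rw [ht, dot_smul_right, dot_self] at h0 h1
    exact ⟨t, pos_of_mul_pos_left h0 hn.le, by nlinarith, by rw [← ht]; ring⟩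

theorem exists_ball_openEdge {i : Fin n} {y : ℂ} (hy : y ∈ P.openEdge i) :
    ∃ ρ > 0, ∀ w ∈ Metric.ball y ρ, cross (P.edgeVec i) (w - P.vertices i) = 0 →
      w ∈ P.openEdge i := by
  have ho : IsOpen {w | 0 < dot (P.edgeVec i) (w - P.vertices i) ∧
      dot (P.edgeVec i) (w - P.vertices i) < ‖P.edgeVec i‖ ^ 2} :=
    (isOpen_lt (by fun_prop) (by fun_prop)).and (isOpen_lt (by fun_prop) (by fun_prop))
  obtain ⟨ρ, hρ, h⟩ := Metric.isOpen_iff.1 ho y (P.mem_openEdge_iff.1 hy).2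
  exact ⟨ρ, hρ, fun w hw hc => P.mem_openEdge_iff.2 ⟨hc, h hw⟩⟩

theorem cross_eq_zero_of_mem_edge {i : Fin n} {y : ℂ} (hy : y ∈ P.edge i) :
    cross (P.edgeVec i) (y - P.vertices i) = 0 := by
  obtain ⟨t, -, -, rfl⟩ := P.mem_edge.1 hy
  rw [add_sub_cancel_left, cross_smul_right, cross_self, mul_zero]

theorem convex_setOf_cross_pos (a p : ℂ) : Convex ℝ {z | 0 < cross a (z - p)} := by
  intro x hx y hy s t hs ht hst
  simp only [Set.mem_ofPred_eq] at *
  have : s • x + t • y - p = s • (x - p) + t • (y - p) := by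
    rw [smul_sub, smul_sub, sub_add_sub_comm, ← add_smul, hst, one_smul]
  rw [this, cross_add_right, cross_smul_right, cross_smul_right]
  rcases hs.eq_or_lt with rfl | hs
  · have : t = 1 := by linarith
    subst this; simpa using hy
  · have := mul_pos hs hx
    have := mul_nonneg ht hy.le
    linarith

/-- Near `y`, the table is the side of the edge `i` of sign `σ`. -/
def LocalSide (i : Fin n) (σ : ℝ) (y : ℂ) : Prop :=
  ∃ ρ > 0, ∀ w ∈ Metric.ball y ρ,
    (0 < σ * cross (P.edgeVec i) (w - P.vertices i) → w ∈ interior P.region) ∧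
    (σ * cross (P.edgeVec i) (w - P.vertices i) < 0 → w ∉ P.region)

theorem isOpen_localSide (i : Fin n) (σ : ℝ) : IsOpen {y | P.LocalSide i σ y} := by
  rw [Metric.isOpen_iff]
  rintro y ⟨ρ, hρ, h⟩
  refine ⟨ρ / 2, by positivity, fun z hz => ⟨ρ / 2, by positivity, fun w hw => h w ?_⟩⟩
  rw [Metric.mem_ball] at *
  linarith [dist_triangle w z y]

/-- Near an inner point of an edge no other edge is present, so each half disc lies inside or
outside the table. Both inside would make `y` an interior point; both outside contradicts
`region_regular`. -/
theorem exists_localSide {i : Fin n} {y : ℂ} (hy : y ∈ P.openEdge i) :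
    P.LocalSide i 1 y ∨ P.LocalSide i (-1) y := by
  obtain ⟨ρ₁, hρ₁, h₁⟩ := P.exists_ball_mem_edge y
  obtain ⟨ρ₂, hρ₂, h₂⟩ := P.exists_ball_openEdge hy
  set ρ := min ρ₁ ρ₂ with hρdef
  have hρ : 0 < ρ := lt_min hρ₁ hρ₂
  have hb₁ : ∀ w ∈ Metric.ball y ρ, w ∈ Metric.ball y ρ₁ := fun w hw =>
    Metric.ball_subset_ball (min_le_left _ _) hw
  have hb₂ : ∀ w ∈ Metric.ball y ρ, w ∈ Metric.ball y ρ₂ := fun w hw =>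
    Metric.ball_subset_ball (min_le_right _ _) hw
  have half : ∀ σ : ℝ,
      (∀ w ∈ Metric.ball y ρ, 0 < σ * cross (P.edgeVec i) (w - P.vertices i) →
        w ∈ interior P.region) ∨
      (∀ w ∈ Metric.ball y ρ, 0 < σ * cross (P.edgeVec i) (w - P.vertices i) →
        w ∉ P.region) := by
    intro σ
    have hc : IsPreconnected
        (Metric.ball y ρ ∩ {w | 0 < cross (σ • P.edgeVec i) (w - P.vertices i)}) :=
      ((convex_ball y ρ).inter (convex_setOf_cross_pos _ _)).isPreconnected
    have hd : ∀ j, Disjoint (P.edge j)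
        (Metric.ball y ρ ∩ {w | 0 < cross (σ • P.edgeVec i) (w - P.vertices i)}) := by
      intro j
      rw [Set.disjoint_left]
      rintro w hw ⟨hwb, hp⟩
      have := P.eq_of_mem_openEdge hy (h₁ w (hb₁ w hwb) j hw)
      subst this
      rw [Set.mem_ofPred_eq, cross_smul_left, P.cross_eq_zero_of_mem_edge hw] at hp
      simp at hp
    rcases P.subset_interior_or_disjoint hc hd with h | h
    · left; intro w hw hp; exact h ⟨hw, by rwa [Set.mem_ofPred_eq, cross_smul_left]⟩
    · right; intro w hw hp
      exact Set.disjoint_left.1 h ⟨hw, by rwa [Set.mem_ofPred_eq, cross_smul_left]⟩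
  rcases half 1 with hp | hp <;> rcases half (-1) with hm | hm
  · exfalso
    refine P.notMem_interior_of_mem_edge (P.openEdge_subset_edge i hy)
      (mem_interior.2 ⟨Metric.ball y ρ, fun w hw => ?_, Metric.isOpen_ball,
        Metric.mem_ball_self hρ⟩)
    rcases lt_trichotomy (cross (P.edgeVec i) (w - P.vertices i)) 0 with h | h | h
    · exact interior_subset (hm w hw (by linarith))
    · exact P.edge_subset_region i (P.openEdge_subset_edge i (h₂ w (hb₂ w hw) h))
    · exact interior_subset (hp w hw (by linarith))
  · exact Or.inl ⟨ρ, hρ, fun w hw => ⟨hp w hw, fun h => hm w hw (by linarith)⟩⟩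
  · exact Or.inr ⟨ρ, hρ, fun w hw => ⟨hm w hw, fun h => hp w hw (by linarith)⟩⟩
  · exfalso
    have hyc : y ∈ closure (interior P.region) := by
      rw [P.region_regular]; exact P.edge_subset_region i (P.openEdge_subset_edge i hy)
    obtain ⟨w, hw, hwd⟩ := Metric.mem_closure_iff.1 hyc ρ hρ
    have hw' : w ∈ Metric.ball y ρ := by rwa [Metric.mem_ball, dist_comm]
    rcases lt_trichotomy (cross (P.edgeVec i) (w - P.vertices i)) 0 with h | h | h
    · exact hm w hw' (by linarith) (interior_subset hw)
    · exact P.notMem_interior_of_mem_edge (P.openEdge_subset_edge i (h₂ w (hb₂ w hw') h)) hw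
    · exact hp w hw' (by linarith) (interior_subset hw)

theorem not_localSide_both {i : Fin n} {y : ℂ} (hy : y ∈ P.openEdge i)
    (h₁ : P.LocalSide i 1 y) (h₂ : P.LocalSide i (-1) y) : False := by
  obtain ⟨ρ₁, hρ₁, h₁⟩ := h₁
  obtain ⟨ρ₂, hρ₂, h₂⟩ := h₂
  have hn : 0 < ‖P.edgeVec i‖ := norm_pos_iff.2 (P.edgeVec_ne_zero i)
  set s := min ρ₁ ρ₂ / 2 / ‖P.edgeVec i‖ with hs
  have hm : 0 < min ρ₁ ρ₂ := lt_min hρ₁ hρ₂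
  have hs0 : 0 < s := by positivity
  set w := y + s • (Complex.I * P.edgeVec i) with hw
  have hd : dist w y < min ρ₁ ρ₂ := by
    rw [hw, dist_eq_norm, add_sub_cancel_left, norm_smul, norm_mul, Complex.norm_I, one_mul,
      Real.norm_of_nonneg hs0.le, hs]
    field_simp; linarith
  have hc : 0 < cross (P.edgeVec i) (w - P.vertices i) := by
    have e : w - P.vertices i = (y - P.vertices i) + s • (Complex.I * P.edgeVec i) := by
      rw [hw]; ring
    rw [e, cross_add_right, P.cross_eq_zero_of_mem_edge (P.openEdge_subset_edge i hy),
      cross_smul_right, zero_add]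
    refine mul_pos hs0 ?_
    have : cross (P.edgeVec i) (Complex.I * P.edgeVec i) = ‖P.edgeVec i‖ ^ 2 := by
      rw [← dot_self]; simp only [cross, dot]; simp
    rw [this]; positivity
  exact (h₂ w (lt_of_lt_of_le hd (min_le_right _ _))).2 (by linarith)
    (interior_subset ((h₁ w (lt_of_lt_of_le hd (min_le_left _ _))).1 (by linarith)))

/-- The two sides define disjoint open conditions that cover the connected open edge, so the side is
constant along it. -/
theorem exists_sign (i : Fin n) :
    ∃ σ : ℝ, (σ = 1 ∨ σ = -1) ∧ ∀ y ∈ P.openEdge i, P.LocalSide i σ y := by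
  have hpre : IsPreconnected (P.openEdge i) := (convex_openSegment _ _).isPreconnected
  rcases isPreconnected_iff_subset_of_disjoint.1 hpre _ _ (P.isOpen_localSide i 1)
    (P.isOpen_localSide i (-1)) (fun y hy => P.exists_localSide hy) (by
      rw [Set.eq_empty_iff_forall_notMem]
      rintro y ⟨hy, h1, h2⟩
      exact P.not_localSide_both hy h1 h2) with h | h
  · exact ⟨1, Or.inl rfl, h⟩
  · exact ⟨-1, Or.inr rfl, h⟩

/-- The edge vector, up to sign, such that the table lies locally to its left. -/
noncomputable def leftVec (i : Fin n) : ℂ := (P.exists_sign i).choose • P.edgeVec i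

theorem leftVec_eq_or (i : Fin n) :
    P.leftVec i = P.edgeVec i ∨ P.leftVec i = -P.edgeVec i := by
  rcases (P.exists_sign i).choose_spec.1 with h | h <;> rw [leftVec, h] <;> simp

theorem leftVec_ne_zero (i : Fin n) : P.leftVec i ≠ 0 := by
  rcases P.leftVec_eq_or i with h | h <;> rw [h]
  · exact P.edgeVec_ne_zero i
  · exact neg_ne_zero.2 (P.edgeVec_ne_zero i)

/-- The signed distance of `w` from the line through the edge `i`, up to a positive factor; it is
positive on the side of the table. -/
noncomputable def depth (i : Fin n) (w : ℂ) : ℝ := cross (P.leftVec i) (w - P.vertices i)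

theorem depth_add_smul (i : Fin n) (y : ℂ) (t : ℝ) (u : ℂ) :
    P.depth i (y + t • u) = P.depth i y + t * cross (P.leftVec i) u := by
  rw [depth, depth, add_sub_right_comm, cross_add_right, cross_smul_right]

theorem exists_ball_depth {i : Fin n} {y : ℂ} (hy : y ∈ P.openEdge i) :
    ∃ ρ > 0, ∀ w ∈ Metric.ball y ρ, (0 < P.depth i w → w ∈ interior P.region) ∧
      (P.depth i w < 0 → w ∉ P.region) := by
  obtain ⟨ρ, hρ, h⟩ := (P.exists_sign i).choose_spec.2 y hy
  refine ⟨ρ, hρ, fun w hw => ?_⟩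
  rw [depth, leftVec, cross_smul_left]
  exact h w hw

theorem depth_eq_zero_iff {i : Fin n} {w : ℂ} :
    P.depth i w = 0 ↔ cross (P.edgeVec i) (w - P.vertices i) = 0 := by
  rcases P.leftVec_eq_or i with h | h <;> rw [depth, h]
  rw [cross_neg_left, neg_eq_zero]

theorem depth_eq_zero {i : Fin n} {w : ℂ} (hw : w ∈ P.edge i) : P.depth i w = 0 :=
  P.depth_eq_zero_iff.2 (P.cross_eq_zero_of_mem_edge hw)

theorem continuous_depth (i : Fin n) : Continuous (P.depth i) := by
  unfold depth; fun_prop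

theorem notMem_interior_of_mem_openEdge {i : Fin n} {y : ℂ} (h : y ∈ P.openEdge i) :
    y ∉ interior P.region := P.notMem_interior_of_mem_edge (P.openEdge_subset_edge i h)

/-- A ray that leaves a point of an edge into the interior leaves to the inner side. -/
theorem cross_leftVec_pos {i : Fin n} {y u : ℂ} (hy : y ∈ P.openEdge i) {r : ℝ} (hr : 0 < r)
    (h : ∀ t ∈ Set.Ioo 0 r, y + t • u ∈ interior P.region) : 0 < cross (P.leftVec i) u := by
  obtain ⟨ρ₁, hρ₁, h₁⟩ := P.exists_ball_depth hy
  obtain ⟨ρ₂, hρ₂, h₂⟩ := P.exists_ball_openEdge hy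
  obtain ⟨t, ht, ht1, ht2⟩ : ∃ t ∈ Set.Ioo 0 r, y + t • u ∈ Metric.ball y ρ₁ ∧
      y + t • u ∈ Metric.ball y ρ₂ := by
    have hc : Filter.Tendsto (fun t : ℝ => y + t • u) (nhdsWithin 0 (Set.Ioi 0)) (nhds y) := by
      have : Continuous fun t : ℝ => y + t • u := by fun_prop
      simpa using (this.tendsto 0).mono_left nhdsWithin_le_nhds
    exact ((Filter.Eventually.and (Ioo_mem_nhdsGT hr :
        ∀ᶠ t in nhdsWithin (0 : ℝ) (Set.Ioi 0), t ∈ Set.Ioo 0 r)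
      ((hc.eventually (Metric.ball_mem_nhds y hρ₁)).and
      (hc.eventually (Metric.ball_mem_nhds y hρ₂))))).exists
  have hd := P.depth_add_smul i y t u
  rw [P.depth_eq_zero (P.openEdge_subset_edge i hy), zero_add] at hd
  have hint := h t ht
  rcases lt_trichotomy (cross (P.leftVec i) u) 0 with hlt | heq | hgt
  · exact absurd (interior_subset hint) ((h₁ _ ht1).2 (by rw [hd]; nlinarith [ht.1]))
  · refine absurd hint (P.notMem_interior_of_mem_openEdge (h₂ _ ht2 ?_))
    rw [← P.depth_eq_zero_iff, hd, heq, mul_zero]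
  · exact hgt

variable {P}

theorem FreeFlight.symm {x y : ℂ} (h : P.FreeFlight x y) : P.FreeFlight y x :=
  ⟨h.1.symm, by rw [openSegment_symm]; exact h.2⟩

theorem FreeFlight.mem {x y : ℂ} (h : P.FreeFlight x y) {t : ℝ} (h0 : 0 < t) (h1 : t < 1) :
    x + t • (y - x) ∈ interior P.region := by
  apply h.2
  rw [openSegment_eq_image']
  exact ⟨t, ⟨h0, h1⟩, rfl⟩

theorem freeFlight_of_forall {x y : ℂ} (hne : x ≠ y)
    (h : ∀ t : ℝ, 0 < t → t < 1 → x + t • (y - x) ∈ interior P.region) : P.FreeFlight x y := by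
  refine ⟨hne, ?_⟩
  rw [openSegment_eq_image']
  rintro _ ⟨t, ⟨h0, h1⟩, rfl⟩
  exact h t h0 h1

theorem FreeFlight.cross_pos {i : Fin n} {y z : ℂ} (h : P.FreeFlight y z)
    (hy : y ∈ P.openEdge i) : 0 < cross (P.leftVec i) (z - y) :=
  P.cross_leftVec_pos hy one_pos fun _ ht => h.mem ht.1 ht.2

theorem FreeFlight.depth_pos {i : Fin n} {y z : ℂ} (h : P.FreeFlight y z)
    (hy : y ∈ P.openEdge i) : 0 < P.depth i z := by
  have := P.depth_add_smul i y 1 (z - y)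
  rw [one_smul, add_sub_cancel, P.depth_eq_zero (P.openEdge_subset_edge i hy)] at this
  rw [this]
  linarith [h.cross_pos hy]

/-- A flight that leaves an edge ends strictly on the inner side of its line, hence not on the same
edge. -/
theorem FreeFlight.ne_edge {i j : Fin n} {y z : ℂ} (h : P.FreeFlight y z)
    (hy : y ∈ P.openEdge i) (hz : z ∈ P.edge j) : i ≠ j := by
  rintro rfl
  exact (h.depth_pos hy).ne' (P.depth_eq_zero hz)

/-! ### Convex cells -/

variable (P)

/-- An open convex polygon whose sides lie in the interior of the table or on edges that do not
enter it. -/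
theorem halfplanes_subset_interior {ι : Type*} [Finite ι] (a p : ι → ℂ) (S : Set (Fin n))
    (hne : S.Nonempty) (h₁ : ∀ j ∈ S, ∃ i, ∀ z ∈ P.edge j, cross (a i) (z - p i) ≤ 0)
    (h₂ : ∀ z, (∀ i, 0 ≤ cross (a i) (z - p i)) → (∃ i, cross (a i) (z - p i) = 0) →
      ∀ k, z ∈ P.edge k → k ∈ S)
    {m : ℂ} (hm : m ∈ interior P.region) (hm' : ∀ i, 0 ≤ cross (a i) (m - p i))
    {w : ℂ} (hw : ∀ i, 0 < cross (a i) (w - p i)) :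
    {z | ∀ i, 0 < cross (a i) (z - p i)} ⊆ interior P.region := by
  have hU : IsOpen {z | ∀ i, 0 < cross (a i) (z - p i)} := by
    rw [Set.ofPred_forall]
    exact isOpen_iInter_of_finite fun i => isOpen_lt (by fun_prop) (by fun_prop)
  have hconv : Convex ℝ {z | ∀ i, 0 < cross (a i) (z - p i)} := by
    rw [Set.ofPred_forall]
    exact convex_iInter fun i => convex_setOf_cross_pos _ _
  refine P.subset_interior_of_frontier hconv.isPreconnected hne ?_ ?_ ?_
  · intro j hj
    obtain ⟨i, hi⟩ := h₁ j hj
    rw [Set.disjoint_left]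
    exact fun z hz hzU => absurd (hzU i) (not_lt.2 (hi z hz))
  · intro j hj
    rw [Set.disjoint_left]
    intro z hz hzf
    have hcl : z ∈ {z | ∀ i, 0 ≤ cross (a i) (z - p i)} := by
      refine closure_minimal (fun z hz i => (hz i).le) ?_ hzf.1
      rw [Set.ofPred_forall]
      exact isClosed_iInter fun i => isClosed_le (by fun_prop) (by fun_prop)
    have hnot : z ∉ {z | ∀ i, 0 < cross (a i) (z - p i)} := by
      have := hzf.2; rwa [hU.interior_eq] at this
    simp only [Set.mem_ofPred_eq, not_forall, not_lt] at hnot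
    obtain ⟨i, hi⟩ := hnot
    exact hj (h₂ z hcl ⟨i, le_antisymm hi (hcl i)⟩ j hz)
  -- The point `m` may lie on a side of the cell. Moved slightly towards `w` it enters the cell and
  -- is still interior to the table.
  · have hc : Filter.Tendsto (fun t : ℝ => m + t • (w - m)) (nhdsWithin 0 (Set.Ioi 0))
        (nhds m) := by
      have : Continuous fun t : ℝ => m + t • (w - m) := by fun_prop
      simpa using (this.tendsto 0).mono_left nhdsWithin_le_nhds
    obtain ⟨t, ht, ht'⟩ := (Filter.Eventually.and (Ioo_mem_nhdsGT one_pos :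
        ∀ᶠ t in nhdsWithin (0 : ℝ) (Set.Ioi 0), t ∈ Set.Ioo (0 : ℝ) 1)
      (hc.eventually (isOpen_interior.mem_nhds hm))).exists
    refine ⟨_, fun i => ?_, ht'⟩
    have e : m + t • (w - m) - p i = (1 - t) • (m - p i) + t • (w - p i) := by
      simp only [smul_sub, sub_smul, one_smul]; ring
    rw [e, cross_add_right, cross_smul_right, cross_smul_right]
    have := mul_nonneg (sub_nonneg.2 ht.2.le) (hm' i)
    have := mul_pos ht.1 (hw i)
    linarith

theorem cross_pos_of_mem_openSegment {a p x y z : ℂ} (hz : z ∈ openSegment ℝ x y)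
    (hx : 0 ≤ cross a (x - p)) (hy : 0 ≤ cross a (y - p))
    (h : 0 < cross a (x - p) ∨ 0 < cross a (y - p)) : 0 < cross a (z - p) := by
  obtain ⟨s, t, hs, ht, hst, rfl⟩ := hz
  have : s • x + t • y - p = s • (x - p) + t • (y - p) := by
    rw [smul_sub, smul_sub, sub_add_sub_comm, ← add_smul, hst, one_smul]
  rw [this, cross_add_right, cross_smul_right, cross_smul_right]
  rcases h with h | h
  · have := mul_pos hs h
    have := mul_nonneg ht.le hy
    linarith
  · have := mul_pos ht h
    have := mul_nonneg hs.le hx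
    linarith

/-- On the line through `a` and `b`, a half-plane bounded at `a` and containing `b`, together with
one bounded at `b` and containing `a`, cuts out the segment. -/
theorem mem_segment_of_cross {a b z : ℂ} (hab : a ≠ b) (h : cross (b - a) (z - a) = 0)
    {p q p' q' : ℂ} (ha : cross p (a - q) = 0) (hb : 0 < cross p (b - q))
    (hz : 0 ≤ cross p (z - q)) (hb' : cross p' (b - q') = 0) (ha' : 0 < cross p' (a - q'))
    (hz' : 0 ≤ cross p' (z - q')) : z ∈ segment ℝ a b := by
  obtain ⟨t, ht⟩ := exists_smul_of_cross_eq_zero (sub_ne_zero.2 hab.symm) h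
  have hz0 : z = a + t • (b - a) := by rw [← ht]; ring
  have e1 : z - q = (1 - t) • (a - q) + t • (b - q) := by
    rw [hz0]; simp only [smul_sub, sub_smul, one_smul]; ring
  have e2 : z - q' = (1 - t) • (a - q') + t • (b - q') := by
    rw [hz0]; simp only [smul_sub, sub_smul, one_smul]; ring
  rw [e1, cross_add_right, cross_smul_right, cross_smul_right, ha] at hz
  rw [e2, cross_add_right, cross_smul_right, cross_smul_right, hb'] at hz'
  rw [segment_eq_image']
  exact ⟨t, ⟨by nlinarith, by nlinarith⟩, hz0.symm⟩

theorem FreeFlight.edge_of_mem_segment {P : PolygonalTable n} {i j : Fin n} {a b z : ℂ}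
    (h : P.FreeFlight a b) (ha : a ∈ P.openEdge i) (hb : b ∈ P.openEdge j)
    (hz : z ∈ segment ℝ a b) {k : Fin n} (hk : z ∈ P.edge k) : k = i ∨ k = j := by
  rw [← insert_endpoints_openSegment] at hz
  rcases hz with rfl | rfl | hz
  · exact Or.inl (P.eq_of_mem_openEdge ha hk).symm
  · exact Or.inr (P.eq_of_mem_openEdge hb hk).symm
  · exact absurd (h.2 hz) (P.notMem_interior_of_mem_edge hk)

/-- Between two free chords that join two edges without crossing, all chords are free. -/
theorem freeFlight_of_between {i j : Fin n} {a b a' b' p q : ℂ} (ha : a ∈ P.openEdge i)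
    (hb : b ∈ P.openEdge i) (ha' : a' ∈ P.openEdge j) (hb' : b' ∈ P.openEdge j)
    (hfa : P.FreeFlight a a') (hfb : P.FreeFlight b b') {σ : ℝ}
    (h₁ : 0 < σ * cross (a' - a) (b - a)) (h₂ : 0 < σ * cross (a' - a) (b' - a))
    (h₃ : σ * cross (b' - b) (a - b) < 0) (h₄ : σ * cross (b' - b) (a' - b) < 0)
    (hp : p ∈ openSegment ℝ a b) (hq : q ∈ openSegment ℝ a' b') : P.FreeFlight p q := by
  have hij : i ≠ j := hfa.ne_edge ha (P.openEdge_subset_edge j ha')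
  have hpi : p ∈ P.openEdge i := (convex_openSegment _ _).openSegment_subset ha hb hp
  have hqj : q ∈ P.openEdge j := (convex_openSegment _ _).openSegment_subset ha' hb' hq
  have hne : p ≠ q := fun h => hij (P.eq_of_mem_openEdge hpi (P.openEdge_subset_edge j (h ▸ hqj)))
  refine ⟨hne, ?_⟩
  -- The cell is the quadrilateral between the two edges and the two given chords; `σ` accounts for
  -- its orientation.
  set A : Fin 4 → ℂ := ![P.leftVec i, P.leftVec j, σ • (a' - a), (-σ) • (b' - b)] with hA
  set Q : Fin 4 → ℂ := ![P.vertices i, P.vertices j, a, b] with hQ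
  have z1 : ∀ z ∈ P.openEdge i, cross (P.leftVec i) (z - P.vertices i) = 0 := fun z hz =>
    P.depth_eq_zero (P.openEdge_subset_edge i hz)
  have z2 : ∀ z ∈ P.openEdge j, cross (P.leftVec j) (z - P.vertices j) = 0 := fun z hz =>
    P.depth_eq_zero (P.openEdge_subset_edge j hz)
  have da' : 0 < cross (P.leftVec i) (a' - P.vertices i) := hfa.depth_pos ha
  have db' : 0 < cross (P.leftVec i) (b' - P.vertices i) := hfb.depth_pos hb
  have da : 0 < cross (P.leftVec j) (a - P.vertices j) := hfa.symm.depth_pos ha'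
  have db : 0 < cross (P.leftVec j) (b - P.vertices j) := hfb.symm.depth_pos hb'
  have g₁ : 0 < cross (σ • (a' - a)) (b - a) := by rwa [cross_smul_left]
  have g₂ : 0 < cross (σ • (a' - a)) (b' - a) := by rwa [cross_smul_left]
  have g₃ : 0 < cross ((-σ) • (b' - b)) (a - b) := by rw [cross_smul_left]; linarith
  have g₄ : 0 < cross ((-σ) • (b' - b)) (a' - b) := by rw [cross_smul_left]; linarith
  have g₅ : cross (σ • (a' - a)) (a - a) = 0 := by rw [sub_self, cross_zero_right]
  have g₆ : cross (σ • (a' - a)) (a' - a) = 0 := by rw [cross_smul_left, cross_self, mul_zero]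
  have g₇ : cross ((-σ) • (b' - b)) (b - b) = 0 := by rw [sub_self, cross_zero_right]
  have g₈ : cross ((-σ) • (b' - b)) (b' - b) = 0 := by rw [cross_smul_left, cross_self, mul_zero]
  have hσ : σ ≠ 0 := by rintro rfl; simp at h₁
  have hab : a ≠ b := by rintro rfl; simp [cross_zero_right] at h₁
  have hab' : a' ≠ b' := by rintro rfl; simp [cross_self] at h₂
  have par : ∀ {k : Fin n} {x y z : ℂ}, x ∈ P.openEdge k → y ∈ P.openEdge k →
      cross (P.leftVec k) (z - P.vertices k) = 0 → cross (y - x) (z - x) = 0 := by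
    intro k x y z hx hy hz
    have hx' : cross (P.leftVec k) (x - P.vertices k) = 0 :=
      P.depth_eq_zero (P.openEdge_subset_edge k hx)
    have hy' : cross (P.leftVec k) (y - P.vertices k) = 0 :=
      P.depth_eq_zero (P.openEdge_subset_edge k hy)
    obtain ⟨s, hs⟩ := exists_smul_of_cross_eq_zero (P.leftVec_ne_zero k)
      (show cross (P.leftVec k) (y - x) = 0 by
        rw [← sub_sub_sub_cancel_right y x (P.vertices k), cross_sub_right, hx', hy', sub_zero])
    obtain ⟨t, ht⟩ := exists_smul_of_cross_eq_zero (P.leftVec_ne_zero k)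
      (show cross (P.leftVec k) (z - x) = 0 by
        rw [← sub_sub_sub_cancel_right z x (P.vertices k), cross_sub_right, hx', hz, sub_zero])
    rw [hs, ht, cross_smul_left, cross_smul_right, cross_self, mul_zero, mul_zero]
  have sub := P.halfplanes_subset_interior A Q {i, j} ⟨i, by simp⟩ ?_ ?_
    (hfa.mem (t := 1 / 2) (by norm_num) (by norm_num)) ?_ (w := p + (1 / 2 : ℝ) • (q - p)) ?_
  · intro z hz
    apply sub
    intro k
    fin_cases k
    · exact cross_pos_of_mem_openSegment hz (z1 p hpi).ge (cross_pos_of_mem_openSegment hq da'.le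
        db'.le (Or.inl da')).le (Or.inr (cross_pos_of_mem_openSegment hq da'.le db'.le (Or.inl da')))
    · exact cross_pos_of_mem_openSegment hz (cross_pos_of_mem_openSegment hp da.le
        db.le (Or.inl da)).le (z2 q hqj).ge
        (Or.inl (cross_pos_of_mem_openSegment hp da.le db.le (Or.inl da)))
    · have := cross_pos_of_mem_openSegment hp g₅.ge g₁.le (Or.inr g₁)
      exact cross_pos_of_mem_openSegment hz this.le
        (cross_pos_of_mem_openSegment hq g₆.ge g₂.le (Or.inr g₂)).le (Or.inl this)
    · have := cross_pos_of_mem_openSegment hp g₃.le g₇.ge (Or.inl g₃)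
      exact cross_pos_of_mem_openSegment hz this.le
        (cross_pos_of_mem_openSegment hq g₄.le g₈.ge (Or.inl g₄)).le (Or.inl this)
  · rintro k (rfl | rfl)
    · exact ⟨0, fun z hz => (P.depth_eq_zero hz).le⟩
    · exact ⟨1, fun z hz => (P.depth_eq_zero hz).le⟩
  -- A point of the closed cell on one of the four lines lies on the corresponding side, which is
  -- part of an open edge or a free chord; either way only `i` and `j` can contain it.
  · rintro z hz ⟨k, hk⟩ l hl
    have c0 : 0 ≤ cross (P.leftVec i) (z - P.vertices i) := hz 0
    have c1 : 0 ≤ cross (P.leftVec j) (z - P.vertices j) := hz 1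
    have c2 : 0 ≤ cross (σ • (a' - a)) (z - a) := hz 2
    have c3 : 0 ≤ cross ((-σ) • (b' - b)) (z - b) := hz 3
    fin_cases k
    · have hs : z ∈ segment ℝ a b := mem_segment_of_cross hab (par ha hb hk) g₅ g₁ c2 g₇ g₃ c3
      have := (convex_openSegment (𝕜 := ℝ) (P.vertices i) _).segment_subset ha hb hs
      exact Or.inl (P.eq_of_mem_openEdge this hl).symm
    · have hs : z ∈ segment ℝ a' b' := mem_segment_of_cross hab' (par ha' hb' hk) g₆ g₂ c2 g₈ g₄ c3
      have := (convex_openSegment (𝕜 := ℝ) (P.vertices j) _).segment_subset ha' hb' hs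
      exact Or.inr (P.eq_of_mem_openEdge this hl).symm
    · refine hfa.edge_of_mem_segment ha ha' (mem_segment_of_cross hfa.1 ?_ (z1 a ha) da' c0
        (z2 a' ha') da c1) hl
      have : cross (σ • (a' - a)) (z - a) = 0 := hk
      rw [cross_smul_left] at this
      exact (mul_eq_zero.1 this).resolve_left hσ
    · refine hfb.edge_of_mem_segment hb hb' (mem_segment_of_cross hfb.1 ?_ (z1 b hb) db' c0
        (z2 b' hb') db c1) hl
      have : cross ((-σ) • (b' - b)) (z - b) = 0 := hk
      rw [cross_smul_left] at this
      exact (mul_eq_zero.1 this).resolve_left (neg_ne_zero.2 hσ)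
  · have hmid : a + (1 / 2 : ℝ) • (a' - a) ∈ openSegment ℝ a a' := by
      rw [openSegment_eq_image']; exact ⟨1 / 2, ⟨by norm_num, by norm_num⟩, rfl⟩
    intro k
    fin_cases k
    · exact (cross_pos_of_mem_openSegment hmid (z1 a ha).ge da'.le (Or.inr da')).le
    · exact (cross_pos_of_mem_openSegment hmid da.le (z2 a' ha').ge (Or.inl da)).le
    · show 0 ≤ cross (σ • (a' - a)) (a + (1 / 2 : ℝ) • (a' - a) - a)
      rw [add_sub_cancel_left, cross_smul_left, cross_smul_right, cross_self]; simp
    · exact (cross_pos_of_mem_openSegment hmid g₃.le g₄.le (Or.inl g₃)).le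
  · have hmid : p + (1 / 2 : ℝ) • (q - p) ∈ openSegment ℝ p q := by
      rw [openSegment_eq_image']; exact ⟨1 / 2, ⟨by norm_num, by norm_num⟩, rfl⟩
    generalize p + (1 / 2 : ℝ) • (q - p) = z at hmid
    have hz := hmid
    intro k
    fin_cases k
    · exact cross_pos_of_mem_openSegment hz (z1 p hpi).ge (cross_pos_of_mem_openSegment hq da'.le
        db'.le (Or.inl da')).le (Or.inr (cross_pos_of_mem_openSegment hq da'.le db'.le (Or.inl da')))
    · exact cross_pos_of_mem_openSegment hz (cross_pos_of_mem_openSegment hp da.le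
        db.le (Or.inl da)).le (z2 q hqj).ge
        (Or.inl (cross_pos_of_mem_openSegment hp da.le db.le (Or.inl da)))
    · have := cross_pos_of_mem_openSegment hp g₅.ge g₁.le (Or.inr g₁)
      exact cross_pos_of_mem_openSegment hz this.le
        (cross_pos_of_mem_openSegment hq g₆.ge g₂.le (Or.inr g₂)).le (Or.inl this)
    · have := cross_pos_of_mem_openSegment hp g₃.le g₇.ge (Or.inl g₃)
      exact cross_pos_of_mem_openSegment hz this.le
        (cross_pos_of_mem_openSegment hq g₄.le g₈.ge (Or.inl g₄)).le (Or.inl this)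

end PolygonalTable

namespace PolygonalTable

/-! ### Trajectories -/

theorem exists_pos_forall_le {ι : Type*} [Finite ι] (f : ι → ℝ) (hf : ∀ i, 0 < f i) :
    ∃ ρ > 0, ∀ i, ρ ≤ f i := by
  rcases isEmpty_or_nonempty ι with h | h
  · exact ⟨1, one_pos, fun i => h.elim i⟩
  · obtain ⟨i, hi⟩ := Finite.exists_min f
    exact ⟨f i, hf i, hi⟩

variable {n : ℕ} (P : PolygonalTable n)

/-- The linear reflection in the direction of the edge `i`. -/
noncomputable def refl (i : Fin n) : ℂ ≃ₗᵢ[ℝ] ℂ :=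
  (Submodule.span ℝ {P.edgeVec i}).reflection

theorem refl_refl (i : Fin n) (z : ℂ) : P.refl i (P.refl i z) = z :=
  Submodule.reflection_reflection _ _

theorem cross_edgeVec_refl (i : Fin n) (z : ℂ) :
    cross (P.edgeVec i) (P.refl i z) = -cross (P.edgeVec i) z := cross_reflection _ _

theorem dot_edgeVec_refl (i : Fin n) (z : ℂ) :
    dot (P.edgeVec i) (P.refl i z) = dot (P.edgeVec i) z := dot_reflection (P.edgeVec_ne_zero i) _

theorem cross_leftVec_refl (i : Fin n) (z : ℂ) :
    cross (P.leftVec i) (P.refl i z) = -cross (P.leftVec i) z := by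
  rcases P.leftVec_eq_or i with h | h <;>
    simp only [h, cross_neg_left, cross_edgeVec_refl]

theorem dot_refl_refl (i : Fin n) (a b : ℂ) : dot (P.refl i a) (P.refl i b) = dot a b :=
  dot_reflection_reflection _ _ _

theorem refl_of_cross_eq_zero {i : Fin n} {z : ℂ} (h : cross (P.edgeVec i) z = 0) :
    P.refl i z = z :=
  ext_of_dot_cross (P.edgeVec_ne_zero i) (P.dot_edgeVec_refl i z)
    (by rw [cross_edgeVec_refl, h, neg_zero])

theorem refl_sub_of_mem {i : Fin n} {y z : ℂ} (hy : y ∈ P.edge i) (hz : z ∈ P.edge i) :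
    P.refl i (y - z) = y - z := by
  apply P.refl_of_cross_eq_zero
  rw [← sub_sub_sub_cancel_right y z (P.vertices i), cross_sub_right,
    P.cross_eq_zero_of_mem_edge hy, P.cross_eq_zero_of_mem_edge hz, sub_zero]

variable {P}

theorem bounce_iff {i : Fin n} {x y z : ℂ} (hxy : x ≠ y) (hyz : y ≠ z) :
    P.Bounce i x y z ↔ y ∈ P.openEdge i ∧ dir y z = P.refl i (dir x y) := by
  have h0 : P.refl i (y - x) ≠ 0 := by
    rw [Ne, map_eq_zero_iff _ (P.refl i).injective]; exact sub_ne_zero.2 hxy.symm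
  have : P.Bounce i x y z ↔ y ∈ P.openEdge i ∧ SameRay ℝ (z - y) (P.refl i (y - x)) := Iff.rfl
  rw [this, sameRay_iff_inv_norm_smul_eq_of_ne (sub_ne_zero.2 hyz.symm) h0,
    LinearIsometryEquiv.norm_map, ← map_smul]
  rfl

theorem Bounce.symm {i : Fin n} {x y z : ℂ} (hxy : x ≠ y) (hyz : y ≠ z)
    (h : P.Bounce i x y z) : P.Bounce i z y x := by
  rw [bounce_iff hxy hyz] at h
  rw [bounce_iff hyz.symm hxy.symm, dir_swap x y, dir_swap y z, h.2, map_neg, refl_refl]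
  exact ⟨h.1, rfl⟩

theorem FreeFlight.left_mem_region {x y : ℂ} (h : P.FreeFlight x y) : x ∈ P.region := by
  rw [← P.region_regular]
  exact closure_mono h.2 (segment_subset_closure_openSegment (left_mem_segment ℝ x y))

variable (P)

/-- The points `x 0, x 1, …` start a trajectory whose first `N` hits are on the edges
`c 0, c 1, …`. -/
def Follows (c : ℕ → Fin n) (N : ℕ) (x : ℕ → ℂ) : Prop :=
  ∀ k < N, P.FreeFlight (x k) (x (k + 1)) ∧ P.Bounce (c k) (x k) (x (k + 1)) (x (k + 2))

/-- The linear part of the unfolding along the first `k` edges of `c`. -/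
noncomputable def frame (c : ℕ → Fin n) : ℕ → (ℂ ≃ₗᵢ[ℝ] ℂ)
  | 0 => LinearIsometryEquiv.refl ℝ ℂ
  | k + 1 => (P.refl (c k)).trans (frame c k)

theorem frame_succ (c : ℕ → Fin n) (k : ℕ) (z : ℂ) :
    P.frame c (k + 1) z = P.frame c k (P.refl (c k) z) := rfl

variable {P}

theorem Follows.mono {c : ℕ → Fin n} {N M : ℕ} {x : ℕ → ℂ} (h : P.Follows c N x) (hM : M ≤ N) :
    P.Follows c M x := fun k hk => h k (hk.trans_le hM)

theorem Follows.mem {c : ℕ → Fin n} {N : ℕ} {x : ℕ → ℂ} (h : P.Follows c N x) {k : ℕ}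
    (hk : k < N) : x (k + 1) ∈ P.openEdge (c k) := (h k hk).2.1

theorem Follows.dir_succ {c : ℕ → Fin n} {N : ℕ} {x : ℕ → ℂ} (h : P.Follows c N x) {k : ℕ}
    (hk : k + 1 < N) :
    dir (x (k + 1)) (x (k + 2)) = P.refl (c k) (dir (x k) (x (k + 1))) := by
  have h1 := h k (by omega)
  exact ((bounce_iff h1.1.1 (h (k + 1) hk).1.1).1 h1.2).2

theorem Follows.ne_succ {c : ℕ → Fin n} {N : ℕ} {x : ℕ → ℂ} (h : P.Follows c N x) {k : ℕ}
    (hk : k + 1 < N) : c k ≠ c (k + 1) :=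
  (h (k + 1) hk).1.ne_edge (h.mem (by omega)) (P.openEdge_subset_edge _ (h.mem hk))

/-- Unfolded, a trajectory is a straight line with its initial direction. -/
theorem Follows.frame_dir {c : ℕ → Fin n} {N : ℕ} {x : ℕ → ℂ} (h : P.Follows c N x) {k : ℕ}
    (hk : k < N) : P.frame c k (dir (x k) (x (k + 1))) = dir (x 0) (x 1) := by
  induction k with
  | zero => rfl
  | succ k ih => rw [h.dir_succ hk, frame_succ, refl_refl, ih (by omega)]

/-- Equal codes mean that both trajectories are straightened by the same reflections. At each hit
the two points lie on one edge, so their difference is fixed by the reflection in it and nothing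
jumps. -/
theorem Follows.frame_sub {c : ℕ → Fin n} {N : ℕ} {x y : ℕ → ℂ} (hx : P.Follows c N x)
    (hy : P.Follows c N y) {k : ℕ} (hk : k ≤ N) :
    P.frame c k (x k - y k) = (x 0 - y 0) +
      (∑ i ∈ Finset.range k, ‖x (i + 1) - x i‖) • dir (x 0) (x 1) -
      (∑ i ∈ Finset.range k, ‖y (i + 1) - y i‖) • dir (y 0) (y 1) := by
  induction k with
  | zero => simp [frame]
  | succ k ih =>
    have hk' : k < N := hk
    have e : x (k + 1) - y (k + 1) = (x k - y k) + ‖x (k + 1) - x k‖ • dir (x k) (x (k + 1)) -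
        ‖y (k + 1) - y k‖ • dir (y k) (y (k + 1)) := by
      rw [norm_smul_dir, norm_smul_dir]; ring
    rw [frame_succ, P.refl_sub_of_mem (P.openEdge_subset_edge _ (hx.mem hk'))
      (P.openEdge_subset_edge _ (hy.mem hk')), e, map_sub, map_add, map_smul, map_smul,
      hx.frame_dir hk', hy.frame_dir hk', ih hk'.le, Finset.sum_range_succ, Finset.sum_range_succ,
      add_smul, add_smul]
    ring

variable (P)

theorem exists_bound : ∃ D > 0, ∀ x ∈ P.region, ∀ y ∈ P.region, ‖x - y‖ ≤ D := by
  refine ⟨Metric.diam P.region + 1, by positivity, fun x hx y hy => ?_⟩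
  rw [← dist_eq_norm]
  linarith [Metric.dist_le_diam_of_mem P.region_compact.isBounded hx hy]

/-! ### Short flights -/

theorem exists_vertex_of_mem_edges {i j : Fin n} (hij : i ≠ j) {z : ℂ} (hi : z ∈ P.edge i)
    (hj : z ∈ P.edge j) : ∃ k, z = P.vertices k := by
  rcases P.mem_edge_cases hi with h | h | h
  · exact ⟨_, h⟩
  · exact ⟨_, h⟩
  · exact absurd (P.eq_of_mem_openEdge h hj) hij

/-- Pairs of points on two edges that are not both near a common vertex form a compact set, on which
the distance has no zero. -/
theorem exists_near_vertex {ρ : ℝ} (hρ : 0 < ρ) : ∃ δ > 0, ∀ i j, i ≠ j → ∀ x ∈ P.edge i,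
    ∀ y ∈ P.edge j, dist x y < δ → ∃ k, P.vertices k ∈ P.edge i ∧ P.vertices k ∈ P.edge j ∧
      dist x (P.vertices k) < ρ ∧ dist y (P.vertices k) < ρ := by
  have key : ∀ p : Fin n × Fin n, ∃ δ > 0, p.1 ≠ p.2 → ∀ x ∈ P.edge p.1, ∀ y ∈ P.edge p.2,
      dist x y < δ → ∃ k, P.vertices k ∈ P.edge p.1 ∧ P.vertices k ∈ P.edge p.2 ∧
      dist x (P.vertices k) < ρ ∧ dist y (P.vertices k) < ρ := by
    rintro ⟨i, j⟩
    by_cases hij : i = j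
    · exact ⟨1, one_pos, fun h => absurd hij h⟩
    set C : Set (ℂ × ℂ) := (P.edge i ×ˢ P.edge j) ∩
      ⋂ k ∈ {k | P.vertices k ∈ P.edge i ∧ P.vertices k ∈ P.edge j},
        {p | ρ ≤ dist p.1 (P.vertices k)} ∪ {p | ρ ≤ dist p.2 (P.vertices k)} with hC
    have hCc : IsCompact C := by
      refine ((P.isCompact_edge i).prod (P.isCompact_edge j)).inter_right ?_
      exact isClosed_biInter fun k _ => (isClosed_le (by fun_prop) (by fun_prop)).union
        (isClosed_le (by fun_prop) (by fun_prop))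
    have hCmem : ∀ x ∈ P.edge i, ∀ y ∈ P.edge j,
        (¬ ∃ k, P.vertices k ∈ P.edge i ∧ P.vertices k ∈ P.edge j ∧
        dist x (P.vertices k) < ρ ∧ dist y (P.vertices k) < ρ) → (x, y) ∈ C := by
      intro x hx y hy hk
      push Not at hk
      refine ⟨⟨hx, hy⟩, Set.mem_iInter₂.2 fun k hk' => ?_⟩
      by_cases h : dist x (P.vertices k) < ρ
      · exact Or.inr (hk k hk'.1 hk'.2 h)
      · exact Or.inl (not_lt.1 h)
    have hpos : ∀ p ∈ C, 0 < dist p.1 p.2 := by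
      rintro ⟨x, y⟩ ⟨⟨hx, hy⟩, hk⟩
      rw [dist_pos]
      intro hxy
      simp only at hx hy hxy
      subst hxy
      obtain ⟨k, rfl⟩ := P.exists_vertex_of_mem_edges hij hx hy
      have := Set.mem_iInter₂.1 hk k ⟨hx, hy⟩
      rcases this with h | h <;> simp at h <;> linarith
    rcases C.eq_empty_or_nonempty with hE | hE
    · refine ⟨1, one_pos, fun _ x hx y hy _ => ?_⟩
      by_contra hk
      have := hCmem x hx y hy hk
      rw [hE] at this; exact this
    · obtain ⟨p, hp, hmin⟩ := hCc.exists_isMinOn hE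
        (f := fun p : ℂ × ℂ => dist p.1 p.2) (by fun_prop)
      refine ⟨dist p.1 p.2, hpos p hp, fun _ x hx y hy hd => ?_⟩
      by_contra hk
      exact absurd (hmin (hCmem x hx y hy hk)) (not_le.2 hd)
  choose δ hδ h using key
  obtain ⟨ε, hε, hle⟩ := exists_pos_forall_le δ hδ
  exact ⟨ε, hε, fun i j hij x hx y hy hd => h (i, j) hij x hx y hy (hd.trans_le (hle _))⟩

theorem exists_vertex_separation : ∃ ρ > 0, ∀ k l, P.vertices k ≠ P.vertices l →
    ρ ≤ dist (P.vertices k) (P.vertices l) := by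
  classical
  obtain ⟨ρ, hρ, h⟩ := exists_pos_forall_le (fun p : Fin n × Fin n =>
    if P.vertices p.1 = P.vertices p.2 then 1 else dist (P.vertices p.1) (P.vertices p.2)) (by
      intro p; split_ifs with hp
      · exact one_pos
      · exact dist_pos.2 hp)
  refine ⟨ρ, hρ, fun k l hkl => ?_⟩
  have := h (k, l)
  rwa [if_neg hkl] at this

/-- The vector of the edge `i`, seen from one of its endpoints. -/
theorem exists_edge_direction {i : Fin n} {k : Fin n} (h : P.vertices k ∈ P.edge i) :
    ∃ w : ℂ, (w = P.edgeVec i ∨ w = -P.edgeVec i) ∧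
      (∀ x, x ∈ P.edge i ↔ ∃ t : ℝ, 0 ≤ t ∧ t ≤ 1 ∧ x = P.vertices k + t • w) ∧
      (∀ x, x ∈ P.openEdge i ↔ ∃ t : ℝ, 0 < t ∧ t < 1 ∧ x = P.vertices k + t • w) := by
  rcases P.eq_or_eq_of_vertex_mem_edge h with rfl | rfl
  · exact ⟨P.edgeVec k, Or.inl rfl, fun x => P.mem_edge, fun x => P.mem_openEdge⟩
  · have e : ∀ t : ℝ, P.vertices (finRotate n i) + t • -P.edgeVec i =
        P.vertices i + (1 - t) • P.edgeVec i := by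
      intro t; rw [edgeVec]; simp only [smul_neg, sub_smul, one_smul, smul_sub]; ring
    have e' : ∀ t : ℝ, P.vertices i + t • P.edgeVec i =
        P.vertices (finRotate n i) + (1 - t) • -P.edgeVec i := by
      intro t; rw [e]; congr 2; ring
    refine ⟨-P.edgeVec i, Or.inr rfl, fun x => P.mem_edge.trans ?_,
      fun x => P.mem_openEdge.trans ?_⟩
    · constructor
      · rintro ⟨t, h0, h1, rfl⟩; exact ⟨1 - t, by linarith, by linarith, e' t⟩
      · rintro ⟨t, h0, h1, rfl⟩; exact ⟨1 - t, by linarith, by linarith, e t⟩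
    · constructor
      · rintro ⟨t, h0, h1, rfl⟩; exact ⟨1 - t, by linarith, by linarith, e' t⟩
      · rintro ⟨t, h0, h1, rfl⟩; exact ⟨1 - t, by linarith, by linarith, e t⟩

/-- The angle depends only on the two edges and the vertex, and there are finitely many choices.
Angle zero would make the edges overlap. -/
theorem exists_angle_bound : ∃ θ > 0, ∀ i j k, i ≠ j → P.vertices k ∈ P.edge i →
    P.vertices k ∈ P.edge j → ∀ x ∈ P.openEdge i, ∀ y ∈ P.openEdge j,
      θ ≤ InnerProductGeometry.angle (x - P.vertices k) (y - P.vertices k) := by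
  have key : ∀ p : Fin n × Fin n × Fin n, ∃ θ > 0, p.1 ≠ p.2.1 →
      P.vertices p.2.2 ∈ P.edge p.1 → P.vertices p.2.2 ∈ P.edge p.2.1 → ∀ x ∈ P.openEdge p.1,
      ∀ y ∈ P.openEdge p.2.1,
      θ ≤ InnerProductGeometry.angle (x - P.vertices p.2.2) (y - P.vertices p.2.2) := by
    rintro ⟨i, j, k⟩
    by_cases hp : i ≠ j ∧ P.vertices k ∈ P.edge i ∧ P.vertices k ∈ P.edge j
    swap
    · exact ⟨1, one_pos, fun h1 h2 h3 => absurd ⟨h1, h2, h3⟩ hp⟩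
    obtain ⟨hij, hi, hj⟩ := hp
    obtain ⟨w, -, -, hw⟩ := P.exists_edge_direction hi
    obtain ⟨w', -, -, hv⟩ := P.exists_edge_direction hj
    refine ⟨InnerProductGeometry.angle w w', ?_, fun _ _ _ x hx y hy => ?_⟩
    · refine lt_of_le_of_ne (InnerProductGeometry.angle_nonneg _ _) fun h0 => ?_
      obtain ⟨-, r, hr, e⟩ := InnerProductGeometry.angle_eq_zero_iff.1 h0.symm
      set t := min (1 / 2) (1 / (2 * r)) with ht
      have ht0 : 0 < t := by positivity
      have ht1 : t < 1 := lt_of_le_of_lt (min_le_left _ _) (by norm_num)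
      have htr : t * r < 1 := by
        have : t * r ≤ 1 / (2 * r) * r := mul_le_mul_of_nonneg_right (min_le_right _ _) hr.le
        have e2 : 1 / (2 * r) * r = 1 / 2 := by field_simp
        linarith
      have h1 := (hv _).2 ⟨t, ht0, ht1, rfl⟩
      have h2 := (hw _).2 ⟨t * r, by positivity, htr, rfl⟩
      rw [e, smul_smul] at h1
      exact hij (P.eq_of_mem_openEdge h2 (P.openEdge_subset_edge _ h1))
    · obtain ⟨s, hs, -, rfl⟩ := (hw x).1 hx
      obtain ⟨t, ht, -, rfl⟩ := (hv y).1 hy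
      rw [add_sub_cancel_left, add_sub_cancel_left,
        InnerProductGeometry.angle_smul_left_of_pos _ _ hs,
        InnerProductGeometry.angle_smul_right_of_pos _ _ ht]
  choose θ hθ h using key
  obtain ⟨ε, hε, hle⟩ := exists_pos_forall_le θ hθ
  exact ⟨ε, hε, fun i j k hij hi hj x hx y hy =>
    (hle (i, j, k)).trans (h (i, j, k) hij hi hj x hx y hy)⟩

variable {P}

/-- The reflection fixes the direction from `v` along the edge, so the angle after the bounce is the
one before it. The rest is the angle sum in the triangle `v`, `x (k + 1)`, `x (k + 2)`. -/
theorem Follows.angle_succ {c : ℕ → Fin n} {N : ℕ} {x : ℕ → ℂ} (h : P.Follows c N x) {k : ℕ}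
    (hk : k + 2 < N) {v : ℂ} (hv : v ∈ P.edge (c (k + 1))) (hne : x (k + 2) ≠ v) :
    InnerProductGeometry.angle (x (k + 2) - v) (x (k + 3) - x (k + 2)) =
      InnerProductGeometry.angle (x (k + 1) - v) (x (k + 2) - x (k + 1)) -
      InnerProductGeometry.angle (x (k + 1) - v) (x (k + 2) - v) := by
  have tri := InnerProductGeometry.angle_add_angle_sub_add_angle_sub_eq_pi (x (k + 1) - v)
    (sub_ne_zero.2 hne)
  rw [sub_sub_sub_cancel_right, sub_sub_sub_cancel_right, ← neg_sub (x (k + 2)) (x (k + 1)),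
    InnerProductGeometry.angle_neg_right] at tri
  have e : InnerProductGeometry.angle (x (k + 2) - v) (x (k + 3) - x (k + 2)) =
      InnerProductGeometry.angle (x (k + 2) - v) (x (k + 2) - x (k + 1)) := by
    have h1 := h (k + 1) (by omega)
    have h2 := h (k + 2) hk
    rw [← norm_smul_dir (x (k + 2)) (x (k + 3)), ← norm_smul_dir (x (k + 1)) (x (k + 2)),
      InnerProductGeometry.angle_smul_right_of_pos _ _
        (norm_pos_iff.2 (sub_ne_zero.2 h2.1.1.symm)),
      InnerProductGeometry.angle_smul_right_of_pos _ _
        (norm_pos_iff.2 (sub_ne_zero.2 h1.1.1.symm)), h.dir_succ (k := k + 1) hk]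
    conv_lhs => rw [← P.refl_sub_of_mem (P.openEdge_subset_edge _ (h.mem (k := k + 1) (by omega)))
      hv]
    exact (P.refl (c (k + 1))).toLinearIsometry.angle_map _ _
  rw [e]
  linarith

variable (P)

/-- A trajectory cannot make many consecutive short flights. -/
theorem exists_long_flight : ∃ m : ℕ, ∃ δ > 0, ∀ (c : ℕ → Fin n) (N : ℕ) (x : ℕ → ℂ),
    P.Follows c N x → ∀ k, k + m ≤ N → ∃ i, k ≤ i ∧ i < k + m ∧ δ ≤ ‖x (i + 1) - x i‖ := by
  obtain ⟨ρ, hρ, hsep⟩ := P.exists_vertex_separation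
  obtain ⟨δ, hδ, hnear⟩ := P.exists_near_vertex (half_pos hρ)
  obtain ⟨θ, hθ, hang⟩ := P.exists_angle_bound
  obtain ⟨m, hm⟩ := exists_nat_gt (π / θ)
  refine ⟨m + 3, δ, hδ, fun c N x hx k hk => ?_⟩
  by_contra! hc
  -- If all flights are short, consecutive hits lie near a common vertex of their two edges.
  have hv : ∀ i, k ≤ i → i + 1 < k + m + 3 → ∃ l, P.vertices l ∈ P.edge (c i) ∧
      P.vertices l ∈ P.edge (c (i + 1)) ∧ dist (x (i + 1)) (P.vertices l) < ρ / 2 ∧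
      dist (x (i + 2)) (P.vertices l) < ρ / 2 := by
    intro i hi hi'
    refine hnear _ _ (hx.ne_succ (k := i) (by omega)) _
      (P.openEdge_subset_edge _ (hx.mem (by omega))) _
      (P.openEdge_subset_edge _ (hx.mem (by omega))) ?_
    rw [dist_comm, dist_eq_norm]
    exact hc (i + 1) (by omega) (by omega)
  obtain ⟨l, hl⟩ := hv k le_rfl (by omega)
  -- The vertex never changes, since two candidates would both be within `ρ / 2` of the same hit.
  have hall : ∀ i, i < m + 2 → P.vertices l ∈ P.edge (c (k + i)) ∧
      P.vertices l ∈ P.edge (c (k + i + 1)) ∧ dist (x (k + i + 2)) (P.vertices l) < ρ / 2 := by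
    intro i
    induction i with
    | zero => exact fun _ => ⟨hl.1, hl.2.1, hl.2.2.2⟩
    | succ i ih =>
      intro hi
      have h1 := ih (by omega)
      obtain ⟨l', h2, h3, h4, h5⟩ := hv (k + (i + 1)) (by omega) (by omega)
      have : P.vertices l = P.vertices l' := by
        by_contra hne
        have := hsep l l' hne
        have := dist_triangle_left (P.vertices l) (P.vertices l') (x (k + i + 2))
        have h6 : dist (x (k + i + 2)) (P.vertices l') < ρ / 2 := h4
        linarith [h1.2.2]
      rw [this]
      exact ⟨h2, h3, h5⟩
  -- Each bounce lowers the angle between the flight and the ray from the vertex by at least `θ`,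
  -- which cannot happen more than `π / θ` times.
  have hle : ∀ i, i ≤ m → InnerProductGeometry.angle (x (k + i + 1) - P.vertices l)
      (x (k + i + 2) - x (k + i + 1)) ≤ π - i * θ := by
    intro i
    induction i with
    | zero => intro _; simpa using InnerProductGeometry.angle_le_pi _ _
    | succ i ih =>
      intro hi
      have h1 := hall i (by omega)
      have hmem1 := hx.mem (k := k + i) (by omega)
      have hmem2 := hx.mem (k := k + i + 1) (by omega)
      have h2 := hx.angle_succ (k := k + i) (by omega) h1.2.1
        (fun h => P.vertex_notMem_openEdge l _ (h ▸ hmem2))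
      have h3 := hang _ _ l (hx.ne_succ (k := k + i) (by omega)) h1.1 h1.2.1 _ hmem1 _ hmem2
      have h4 := ih (by omega)
      have h5 : InnerProductGeometry.angle (x (k + (i + 1) + 1) - P.vertices l)
          (x (k + (i + 1) + 2) - x (k + (i + 1) + 1)) = _ := h2
      rw [h5]
      push_cast
      linarith
  have h1 := hle m le_rfl
  have h2 := InnerProductGeometry.angle_nonneg (x (k + m + 1) - P.vertices l)
    (x (k + m + 2) - x (k + m + 1))
  rw [div_lt_iff₀ hθ] at hm
  linarith

/-- Every block of `m` consecutive flights contains one of length at least `δ`; enough blocks give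
any total length. -/
theorem exists_length_bound (C : ℝ) : ∃ N : ℕ, ∀ (c : ℕ → Fin n) (x : ℕ → ℂ),
    P.Follows c N x → C ≤ ∑ i ∈ Finset.range N, ‖x (i + 1) - x i‖ := by
  obtain ⟨m, δ, hδ, h⟩ := P.exists_long_flight
  obtain ⟨q, hq⟩ := exists_nat_gt (C / δ)
  rw [div_lt_iff₀ hδ] at hq
  refine ⟨q * m, fun c x hx => hq.le.trans ?_⟩
  clear hq
  induction q with
  | zero => simp
  | succ q ih =>
    have h1 := ih (hx.mono (by nlinarith))
    obtain ⟨i, hi, hi', hd⟩ := h c _ x hx (q * m) (by rw [Nat.succ_mul])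
    rw [Nat.succ_mul, Finset.sum_range_add, Nat.cast_succ, add_mul, one_mul]
    refine add_le_add h1 (hd.trans ?_)
    have := Finset.single_le_sum (f := fun j => ‖x (q * m + j + 1) - x (q * m + j)‖)
      (fun _ _ => norm_nonneg _) (Finset.mem_range.2 (show i - q * m < m by omega))
    simpa [show q * m + (i - q * m) = i by omega] using this

/-- The initial direction of a trajectory is determined by its hits. -/
theorem exists_direction_bound {ε : ℝ} (hε : 0 < ε) : ∃ N : ℕ, ∀ (c : ℕ → Fin n) (x y : ℕ → ℂ),
    P.Follows c N x → P.Follows c N y → ‖dir (x 0) (x 1) - dir (y 0) (y 1)‖ < ε := by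
  obtain ⟨D, hD, hd⟩ := P.exists_bound
  obtain ⟨N, hN⟩ := P.exists_length_bound (4 * D / ε + 1)
  refine ⟨N + 1, fun c x y hx hy => ?_⟩
  have hT := hN c x (hx.mono (by omega))
  set T := ∑ i ∈ Finset.range N, ‖x (i + 1) - x i‖
  have hfs := hx.frame_sub hy (Nat.le_succ N)
  set S := ∑ i ∈ Finset.range N, ‖y (i + 1) - y i‖
  have hS : 0 ≤ S := Finset.sum_nonneg fun _ _ => norm_nonneg _
  have hT0 : 0 < T := by have : 0 < 4 * D / ε := by positivity
                         linarith
  have hxN := (hx N (by omega)).1.left_mem_region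
  have hyN := (hy N (by omega)).1.left_mem_region
  have hx0 := (hx 0 (by omega)).1
  have hy0 := (hy 0 (by omega)).1
  have hux := norm_dir hx0.1
  have huy := norm_dir hy0.1
  rw [zero_add] at hux huy
  set u := dir (x 0) (x 1)
  set u' := dir (y 0) (y 1)
  -- Both ends of the two unfolded lines are at distance at most the diameter bound `D`, whatever
  -- their lengths `T` and `S`.
  have h1 : ‖T • u - S • u'‖ ≤ 2 * D := by
    have e : T • u - S • u' = P.frame c N (x N - y N) - (x 0 - y 0) := by rw [hfs]; ring
    rw [e]
    refine (norm_sub_le _ _).trans ?_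
    rw [LinearIsometryEquiv.norm_map]
    linarith [hd _ hxN _ hyN, hd _ hx0.left_mem_region _ hy0.left_mem_region]
  have h2 : |T - S| ≤ 2 * D := by
    have := abs_norm_sub_norm_le (T • u) (S • u')
    rw [norm_smul, norm_smul, hux, huy, mul_one, mul_one, Real.norm_of_nonneg hT0.le,
      Real.norm_of_nonneg hS] at this
    exact this.trans h1
  have h3 : T * ‖u - u'‖ ≤ 4 * D := by
    have e : T • (u - u') = (T • u - S • u') - (T - S) • u' := by
      rw [smul_sub, sub_smul]; ring
    rw [← Real.norm_of_nonneg hT0.le, ← norm_smul, e]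
    refine (norm_sub_le _ _).trans ?_
    rw [norm_smul, huy, mul_one, Real.norm_eq_abs]
    linarith
  have h4 : 4 * D < T * ε := by
    have : 4 * D / ε < T := by linarith
    rwa [div_lt_iff₀ hε] at this
  exact lt_of_mul_lt_mul_left (h3.trans_lt h4) hT0.le

end PolygonalTable

namespace PolygonalTable

/-! ### Words -/

section Words

variable {α : Type*}

theorem length_centralWord (f : ℕ → α) (w : List α) (g : ℕ → α) (N : ℕ) :
    (centralWord f w g N).length = N + w.length + N := by
  simp [centralWord]; omega

theorem getElem_centralWord_left (f : ℕ → α) (w : List α) (g : ℕ → α) {N i : ℕ} (hi : i < N) :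
    (centralWord f w g N)[N - 1 - i]'(by rw [length_centralWord]; omega) = f i := by
  simp only [centralWord]
  rw [List.getElem_append_left (by simp; omega), List.getElem_append_left (by simp; omega),
    List.getElem_reverse]
  simp only [List.length_map, List.length_range, List.getElem_map, List.getElem_range]
  congr 1; omega

theorem getElem_centralWord_mid (f : ℕ → α) (w : List α) (g : ℕ → α) {N j : ℕ}
    (hj : j < w.length) :
    (centralWord f w g N)[N + j]'(by rw [length_centralWord]; omega) = w[j] := by
  simp only [centralWord]
  rw [List.getElem_append_left (by simp; omega), List.getElem_append_right (by simp)]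
  simp

theorem getElem_centralWord_right (f : ℕ → α) (w : List α) (g : ℕ → α) {N i : ℕ} (hi : i < N) :
    (centralWord f w g N)[N + w.length + i]'(by rw [length_centralWord]; omega) = g i := by
  simp only [centralWord]
  rw [List.getElem_append_right (by simp)]
  simp

end Words

variable {n : ℕ} (P : PolygonalTable n)

/-- `x` is a bi-infinite nonsingular trajectory with hits `e`. -/
def IsTrajectory (e : ℤ → Fin n) (x : ℤ → ℂ) : Prop :=
  ∀ i : ℤ, P.FreeFlight (x i) (x (i + 1)) ∧ P.Bounce (e i) (x (i - 1)) (x i) (x (i + 1))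

variable {P}

theorem IsTrajectory.shift {e : ℤ → Fin n} {x : ℤ → ℂ} (h : P.IsTrajectory e x) (k : ℤ) :
    P.IsTrajectory (fun i => e (k + i)) (fun i => x (k + i)) := by
  intro i
  have := h (k + i)
  rwa [add_assoc, add_sub_assoc] at this

theorem IsTrajectory.follows {e : ℤ → Fin n} {x : ℤ → ℂ} (h : P.IsTrajectory e x) (a : ℤ)
    {c : ℕ → Fin n} {N : ℕ} (hc : ∀ k < N, e (a + 1 + k) = c k) :
    P.Follows c N fun k => x (a + k) := by
  intro k hk
  have h1 := (h (a + k)).1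
  have h2 := (h (a + 1 + k)).2
  rw [hc k hk] at h2
  push_cast
  rw [show a + 1 + (k : ℤ) - 1 = a + k by ring, show a + 1 + (k : ℤ) = a + (k + 1) by ring,
    show a + ((k : ℤ) + 1) + 1 = a + (k + 2) by ring] at h2
  rw [show a + (k : ℤ) + 1 = a + (k + 1) by ring] at h1
  exact ⟨h1, h2⟩

theorem IsTrajectory.reverse {e : ℤ → Fin n} {x : ℤ → ℂ} (h : P.IsTrajectory e x) :
    P.IsTrajectory (fun i => e (-i)) (fun i => x (-i)) := by
  intro i
  have h1 := (h (-i - 1)).1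
  have h2 := h (-i)
  rw [sub_add_cancel] at h1
  refine ⟨?_, ?_⟩
  · show P.FreeFlight (x (-i)) (x (-(i + 1)))
    rw [show -(i + 1) = -i - 1 by ring]; exact h1.symm
  · show P.Bounce (e (-i)) (x (-(i - 1))) (x (-i)) (x (-(i + 1)))
    rw [show -(i + 1) = -i - 1 by ring, show -(i - 1) = -i + 1 by ring]
    exact h2.2.symm h1.1 h2.1.1

theorem IsTrajectory.follows_reverse {e : ℤ → Fin n} {x : ℤ → ℂ} (h : P.IsTrajectory e x) (a : ℤ)
    {c : ℕ → Fin n} {N : ℕ} (hc : ∀ k < N, e (a - 1 - k) = c k) :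
    P.Follows c N fun k => x (a - k) := by
  have := h.reverse.follows (-a) (c := c) (N := N) (by
    intro k hk; rw [← hc k hk]; congr 1; ring)
  convert this using 3
  ring

theorem exists_trajectory_of_mem_language {f g : ℕ → Fin n} {w : List (Fin n)} {N : ℕ}
    (h : centralWord f w g N ∈ P.bounceLanguage) : ∃ e x, P.IsTrajectory e x ∧
      (∀ i < N, e (-1 - i) = f i) ∧ (∀ (j : ℕ) (hj : j < w.length), e j = w[j]) ∧
      (∀ i < N, e (w.length + i) = g i) := by
  obtain ⟨e, ⟨x, hx⟩, k, hk⟩ := h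
  have ht : P.IsTrajectory e x := hx
  refine ⟨_, _, ht.shift (k + N), fun i hi => ?_, fun j hj => ?_, fun i hi => ?_⟩
  · rw [← getElem_centralWord_left f w g hi, hk _ (by rw [length_centralWord]; omega)]
    congr 1; push_cast [Nat.sub_sub, show 1 + i ≤ N by omega]; ring
  · rw [← getElem_centralWord_mid f w g (N := N) hj, hk _ (by rw [length_centralWord]; omega)]
    congr 1; push_cast; ring
  · rw [← getElem_centralWord_right f w g hi, hk _ (by rw [length_centralWord]; omega)]
    congr 1; push_cast; ring

theorem mem_language_of_trajectory {f g : ℕ → Fin n} {w : List (Fin n)} {N : ℕ} {e : ℤ → Fin n}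
    {x : ℤ → ℂ} (h : P.IsTrajectory e x) (hf : ∀ i < N, e (-1 - i) = f i)
    (hw : ∀ (j : ℕ) (hj : j < w.length), e j = w[j]) (hg : ∀ i < N, e (w.length + i) = g i) :
    centralWord f w g N ∈ P.bounceLanguage := by
  refine ⟨e, ⟨x, h⟩, -N, fun i hi => ?_⟩
  rw [length_centralWord] at hi
  rcases lt_or_ge i N with h1 | h1
  · have := getElem_centralWord_left f w g (N := N) (i := N - 1 - i) (by omega)
    simp only [show N - 1 - (N - 1 - i) = i by omega] at this
    rw [this, ← hf _ (by omega)]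
    congr 1; omega
  rcases lt_or_ge i (N + w.length) with h2 | h2
  · have := getElem_centralWord_mid f w g (N := N) (j := i - N) (by omega)
    simp only [show N + (i - N) = i by omega] at this
    rw [this, ← hw _ (by omega)]
    congr 1; omega
  · have := getElem_centralWord_right f w g (N := N) (i := i - (N + w.length)) (by omega)
    simp only [show N + w.length + (i - (N + w.length)) = i by omega] at this
    rw [this, ← hg _ (by omega)]
    congr 1; omega

/-- The two halves of a trajectory through the middle of a word without insertion. -/
theorem exists_follows_of_nil {f g : ℕ → Fin n}
    (h : ∀ N, centralWord f [] g N ∈ P.bounceLanguage) (N : ℕ) :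
    ∃ x y, P.Follows f N x ∧ P.Follows g N y ∧ dir (x 0) (x 1) = -dir (y 0) (y 1) := by
  obtain ⟨e, x, hx, hf, -, hg⟩ := exists_trajectory_of_mem_language (h N)
  -- Both halves contain the flight between hits `-1` and `0`: the backward half is based at hit
  -- `0`, the forward half at hit `-1`, so their initial directions are opposite.
  refine ⟨_, _, hx.follows_reverse 0 (c := f) (N := N) ?_,
    hx.follows (-1) (c := g) (N := N) ?_, ?_⟩
  · intro k hk; rw [← hf k hk]; congr 1
  · intro k hk; rw [← hg k hk]; congr 1
  · simp only [Nat.cast_zero, Nat.cast_one]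
    rw [← dir_swap]; norm_num

/-- The two halves of a trajectory through the middle of a word with one inserted letter. -/
theorem exists_follows_of_singleton {f g : ℕ → Fin n} {A : Fin n}
    (h : ∀ N, centralWord f [A] g N ∈ P.bounceLanguage) (N : ℕ) :
    ∃ x y, P.Follows f N x ∧ P.Follows g N y ∧ x 0 ∈ P.openEdge A ∧ y 0 = x 0 ∧
      dir (x 0) (x 1) = -P.refl A (dir (y 0) (y 1)) := by
  obtain ⟨e, x, hx, hf, hw, hg⟩ := exists_trajectory_of_mem_language (h N)
  have h0 := hx 0
  have h1 := (hx (-1)).1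
  have hA : e 0 = A := by simpa using hw 0 (by simp)
  rw [show (-1 : ℤ) + 1 = 0 by norm_num] at h1
  rw [hA, zero_add, zero_sub] at h0
  refine ⟨_, _, hx.follows_reverse 0 (c := f) (N := N) ?_,
    hx.follows 0 (c := g) (N := N) ?_, ?_, ?_, ?_⟩
  · intro k hk; rw [← hf k hk]; congr 1
  · intro k hk; rw [← hg k hk]; congr 1
  · simpa using h0.2.1
  · simp
  · simp only [Nat.cast_zero, Nat.cast_one, sub_zero, add_zero, zero_sub, zero_add]
    rw [((bounce_iff h1.1 h0.1.1).1 h0.2).2, refl_refl, ← dir_swap]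

/-! ### The angle of the two edges -/

variable (P)

theorem refl_eq_mul (i : Fin n) (z : ℂ) :
    P.refl i z = P.edgeVec i ^ 2 / (‖P.edgeVec i‖ ^ 2 : ℝ) * (starRingEnd ℂ) z := by
  have h0 : (‖P.edgeVec i‖ ^ 2 : ℝ) ≠ 0 := by have := P.edgeVec_ne_zero i; positivity
  have h0' : ((‖P.edgeVec i‖ ^ 2 : ℝ) : ℂ) ≠ 0 := by exact_mod_cast h0
  rw [refl, reflection_span_apply, ← mul_div_assoc, Complex.real_smul, Complex.ofReal_div]
  rw [← dot_self] at h0' ⊢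
  field_simp
  apply Complex.ext <;> simp [dot, pow_two] <;> ring

/-- In complex notation the reflection along `e` is conjugation followed by multiplication by `e ^ 2
/ ‖e‖ ^ 2`, so `ω` is the square of the unit number in the direction of `b` times the conjugate of
`a`. If `ω ^ 2 = 1`, the square of that product is real, and its imaginary part is twice `dot a b *
cross a b`. -/
theorem exists_rotation (A B : Fin n) : ∃ ω : ℂ, (∀ z, P.refl B (P.refl A z) = ω * z) ∧
    (ω ^ 2 = 1 → dot (P.edgeVec A) (P.edgeVec B) = 0 ∨
      cross (P.edgeVec A) (P.edgeVec B) = 0) := by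
  set a := P.edgeVec A
  set b := P.edgeVec B
  have ha : (‖a‖ ^ 2 : ℝ) ≠ 0 := by have := P.edgeVec_ne_zero A; positivity
  have hb : (‖b‖ ^ 2 : ℝ) ≠ 0 := by have := P.edgeVec_ne_zero B; positivity
  have ha' : ((‖a‖ ^ 2 : ℝ) : ℂ) ≠ 0 := by exact_mod_cast ha
  have hb' : ((‖b‖ ^ 2 : ℝ) : ℂ) ≠ 0 := by exact_mod_cast hb
  refine ⟨b ^ 2 / (‖b‖ ^ 2 : ℝ) * (starRingEnd ℂ) (a ^ 2 / (‖a‖ ^ 2 : ℝ)), fun z => ?_, fun h => ?_⟩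
  · rw [refl_eq_mul, refl_eq_mul, map_mul, Complex.conj_conj]; ring
  · have key : (b * (starRingEnd ℂ) a) = dot a b + cross a b * Complex.I := by
      apply Complex.ext <;> simp [dot, cross] <;> ring
    have h2 : b ^ 2 / (‖b‖ ^ 2 : ℝ) * (starRingEnd ℂ) (a ^ 2 / (‖a‖ ^ 2 : ℝ)) =
        (b * (starRingEnd ℂ) a) ^ 2 / ((‖b‖ ^ 2 : ℝ) * (‖a‖ ^ 2 : ℝ)) := by
      rw [map_div₀, map_pow, Complex.conj_ofReal]; field_simp
    rw [h2, div_pow, div_eq_one_iff_eq (by positivity), ← sub_eq_zero] at h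
    rw [show ((b * (starRingEnd ℂ) a) ^ 2) ^ 2 - ((‖b‖ ^ 2 : ℝ) * (‖a‖ ^ 2 : ℝ) : ℂ) ^ 2 =
      ((b * (starRingEnd ℂ) a) ^ 2 - ((‖b‖ ^ 2 : ℝ) * (‖a‖ ^ 2 : ℝ) : ℂ)) *
      ((b * (starRingEnd ℂ) a) ^ 2 + ((‖b‖ ^ 2 : ℝ) * (‖a‖ ^ 2 : ℝ) : ℂ)) by ring, key] at h
    have him : dot a b * cross a b = 0 := by
      rcases mul_eq_zero.1 h with h | h <;>
      · have := congrArg Complex.im h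
        rw [← Complex.ofReal_mul] at this
        simp only [pow_two (_ + _), Complex.add_im, Complex.sub_im, Complex.mul_im, Complex.add_re,
          Complex.mul_re, Complex.ofReal_re, Complex.ofReal_im, Complex.I_re, Complex.I_im,
          Complex.zero_im] at this
        linarith
    exact mul_eq_zero.1 him

/-- The six words force the two edges to be parallel or perpendicular. -/
theorem dot_or_cross_eq_zero {A B : Fin n} {h₁ t₁ h₂ t₂ h₃ t₃ : ℕ → Fin n}
    (w₁ : ∀ N, centralWord h₁ [] t₁ N ∈ P.bounceLanguage)
    (w₂ : ∀ N, centralWord t₁ [B] h₂ N ∈ P.bounceLanguage)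
    (w₃ : ∀ N, centralWord h₂ [A] t₂ N ∈ P.bounceLanguage)
    (w₄ : ∀ N, centralWord t₂ [] h₃ N ∈ P.bounceLanguage)
    (w₅ : ∀ N, centralWord h₃ [B] t₃ N ∈ P.bounceLanguage)
    (w₆ : ∀ N, centralWord t₃ [A] h₁ N ∈ P.bounceLanguage) :
    dot (P.edgeVec A) (P.edgeVec B) = 0 ∨ cross (P.edgeVec A) (P.edgeVec B) = 0 := by
  obtain ⟨ω, hω, hfin⟩ := P.exists_rotation A B
  apply hfin
  have hsmall : ∀ ε > 0, ‖1 - ω ^ 2‖ ≤ 6 * ε := by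
    intro ε hε
    obtain ⟨N, hN⟩ := P.exists_direction_bound hε
    -- The extra hit ensures that at least one flight exists, so that the initial direction is a
    -- unit vector.
    set M := N + 1
    have hN' : ∀ {c : ℕ → Fin n} {x y : ℕ → ℂ}, P.Follows c M x → P.Follows c M y →
        ‖dir (x 0) (x 1) - dir (y 0) (y 1)‖ ≤ ε := fun hx hy =>
      (hN _ _ _ (hx.mono (Nat.le_succ N)) (hy.mono (Nat.le_succ N))).le
    obtain ⟨x₁, y₁, fx₁, fy₁, e₁⟩ := exists_follows_of_nil w₁ M
    obtain ⟨x₂, y₂, fx₂, fy₂, -, -, e₂⟩ := exists_follows_of_singleton w₂ M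
    obtain ⟨x₃, y₃, fx₃, fy₃, -, -, e₃⟩ := exists_follows_of_singleton w₃ M
    obtain ⟨x₄, y₄, fx₄, fy₄, e₄⟩ := exists_follows_of_nil w₄ M
    obtain ⟨x₅, y₅, fx₅, fy₅, -, -, e₅⟩ := exists_follows_of_singleton w₅ M
    obtain ⟨x₆, y₆, fx₆, fy₆, -, -, e₆⟩ := exists_follows_of_singleton w₆ M
    have b₁ := hN' fy₁ fx₂
    have b₂ := hN' fy₂ fx₃
    have b₃ := hN' fy₃ fx₄
    have b₄ := hN' fy₄ fx₅
    have b₅ := hN' fy₅ fx₆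
    have b₆ := hN' fy₆ fx₁
    have hd : ‖dir (x₁ 0) (x₁ 1)‖ = 1 := norm_dir (fx₁ 0 (Nat.succ_pos N)).1.1
    generalize dir (x₁ 0) (x₁ 1) = X₁ at *
    generalize dir (x₂ 0) (x₂ 1) = X₂ at *
    generalize dir (x₃ 0) (x₃ 1) = X₃ at *
    generalize dir (x₄ 0) (x₄ 1) = X₄ at *
    generalize dir (x₅ 0) (x₅ 1) = X₅ at *
    generalize dir (x₆ 0) (x₆ 1) = X₆ at *
    generalize dir (y₁ 0) (y₁ 1) = Y₁ at *
    generalize dir (y₂ 0) (y₂ 1) = Y₂ at *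
    generalize dir (y₃ 0) (y₃ 1) = Y₃ at *
    generalize dir (y₄ 0) (y₄ 1) = Y₄ at *
    generalize dir (y₅ 0) (y₅ 1) = Y₅ at *
    generalize dir (y₆ 0) (y₆ 1) = Y₆ at *
    -- Telescoping around the cycle of words: an empty insertion reverses the direction, a letter
    -- reverses and reflects it, and each passage to the next word costs one error of size at most
    -- `ε`. The six reversals cancel.
    have key : X₁ - ω ^ 2 * X₁ = -(Y₁ - X₂) + P.refl B (Y₂ - X₃) - P.refl B (P.refl A (Y₃ - X₄))
        + P.refl B (P.refl A (Y₄ - X₅)) - P.refl B (P.refl A (P.refl B (Y₅ - X₆))) +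
        P.refl B (P.refl A (P.refl B (P.refl A (Y₆ - X₁)))) := by
      have : ω ^ 2 * X₁ = P.refl B (P.refl A (P.refl B (P.refl A X₁))) := by
        rw [hω, hω]; ring
      rw [this, e₁, e₂, e₃, e₄, e₅, e₆]
      simp only [map_sub, map_neg]
      ring
    have hn : ‖1 - ω ^ 2‖ = ‖X₁ - ω ^ 2 * X₁‖ := by
      rw [← one_sub_mul, norm_mul, hd, mul_one]
    rw [hn, key]
    refine (norm_add_le _ _).trans ?_
    refine (add_le_add_left (norm_sub_le _ _) _).trans ?_
    refine (add_le_add_left (add_le_add_left (norm_add_le _ _) _) _).trans ?_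
    refine (add_le_add_left (add_le_add_left (add_le_add_left (norm_sub_le _ _) _) _) _).trans ?_
    refine (add_le_add_left (add_le_add_left (add_le_add_left (add_le_add_left
      (norm_add_le _ _) _) _) _) _).trans ?_
    simp only [LinearIsometryEquiv.norm_map, norm_neg]
    linarith
  have h0 : ‖1 - ω ^ 2‖ = 0 := by
    refine le_antisymm (le_of_forall_pos_le_add fun ε hε => ?_) (norm_nonneg _)
    have := hsmall (ε / 6) (by positivity)
    linarith
  exact (sub_eq_zero.1 (norm_eq_zero.1 h0)).symm

end PolygonalTable

namespace PolygonalTable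

variable {n : ℕ} (P : PolygonalTable n)

/-! ### Corners -/

theorem Adjacent.inter {P : PolygonalTable n} {A B : Fin n} (h : P.Adjacent A B) :
    A ≠ B ∧ ∃ k, P.edge A ∩ P.edge B = {P.vertices k} := by
  rcases h with rfl | rfl
  · exact ⟨(P.next_ne A).symm, _, P.edge_inter_edge_next A⟩
  · exact ⟨P.next_ne B, _, by rw [Set.inter_comm]; exact P.edge_inter_edge_next B⟩

/-- The edges `A` and `B` leave the vertex `v` in the unit directions `f` and `g`; their lengths
are `a` and `b`, and no other edge comes within distance `r` of `v`. -/
structure Corner (A B : Fin n) (v f g : ℂ) (a b r : ℝ) : Prop where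
  ne : A ≠ B
  vertex : ∃ k, v = P.vertices k
  norm_left : ‖f‖ = 1
  norm_right : ‖g‖ = 1
  pos : 0 < r
  le_left : r ≤ a
  le_right : r ≤ b
  mem_left : ∀ x, x ∈ P.edge A ↔ ∃ s : ℝ, 0 ≤ s ∧ s ≤ a ∧ x = v + s • f
  mem_right : ∀ x, x ∈ P.edge B ↔ ∃ s : ℝ, 0 ≤ s ∧ s ≤ b ∧ x = v + s • g
  mem_open_left : ∀ x, x ∈ P.openEdge A ↔ ∃ s : ℝ, 0 < s ∧ s < a ∧ x = v + s • f
  mem_open_right : ∀ x, x ∈ P.openEdge B ↔ ∃ s : ℝ, 0 < s ∧ s < b ∧ x = v + s • g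
  vec_left : ∃ c : ℝ, c ≠ 0 ∧ P.edgeVec A = c • f
  vec_right : ∃ c : ℝ, c ≠ 0 ∧ P.edgeVec B = c • g
  eq_or_eq : ∀ z ∈ Metric.ball v r, ∀ j, z ∈ P.edge j → j = A ∨ j = B
  inter : P.edge A ∩ P.edge B = {v}

variable {P}

theorem Corner.symm {A B : Fin n} {v f g : ℂ} {a b r : ℝ} (h : P.Corner A B v f g a b r) :
    P.Corner B A v g f b a r where
  ne := h.ne.symm
  vertex := h.vertex
  norm_left := h.norm_right
  norm_right := h.norm_left
  pos := h.pos
  le_left := h.le_right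
  le_right := h.le_left
  mem_left := h.mem_right
  mem_right := h.mem_left
  mem_open_left := h.mem_open_right
  mem_open_right := h.mem_open_left
  vec_left := h.vec_right
  vec_right := h.vec_left
  eq_or_eq := fun z hz j hj => (h.eq_or_eq z hz j hj).symm
  inter := by rw [Set.inter_comm]; exact h.inter

theorem exists_unit_direction {i k : Fin n} (h : P.vertices k ∈ P.edge i) :
    ∃ (f : ℂ) (a : ℝ), ‖f‖ = 1 ∧ 0 < a ∧
      (∀ x, x ∈ P.edge i ↔ ∃ s : ℝ, 0 ≤ s ∧ s ≤ a ∧ x = P.vertices k + s • f) ∧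
      (∀ x, x ∈ P.openEdge i ↔ ∃ s : ℝ, 0 < s ∧ s < a ∧ x = P.vertices k + s • f) ∧
      ∃ c : ℝ, c ≠ 0 ∧ P.edgeVec i = c • f := by
  obtain ⟨w, hw, hm, ho⟩ := P.exists_edge_direction h
  have hw0 : w ≠ 0 := by
    rcases hw with rfl | rfl
    · exact P.edgeVec_ne_zero i
    · exact neg_ne_zero.2 (P.edgeVec_ne_zero i)
  have hn : 0 < ‖w‖ := norm_pos_iff.2 hw0
  have e : ∀ t : ℝ, t • w = (t * ‖w‖) • (‖w‖⁻¹ • w) := by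
    intro t; rw [smul_smul]; congr 1; field_simp
  refine ⟨‖w‖⁻¹ • w, ‖w‖, ?_, hn, fun x => (hm x).trans ?_, fun x => (ho x).trans ?_, ?_⟩
  · rw [norm_smul, norm_inv, norm_norm, inv_mul_cancel₀ hn.ne']
  · constructor
    · rintro ⟨t, h0, h1, rfl⟩
      exact ⟨t * ‖w‖, by positivity, by nlinarith, by rw [e]⟩
    · rintro ⟨s, h0, h1, rfl⟩
      exact ⟨s / ‖w‖, by positivity, (div_le_one hn).2 h1, by
        rw [e (s / ‖w‖), div_mul_cancel₀ _ hn.ne']⟩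
  · constructor
    · rintro ⟨t, h0, h1, rfl⟩
      exact ⟨t * ‖w‖, by positivity, by nlinarith, by rw [e]⟩
    · rintro ⟨s, h0, h1, rfl⟩
      exact ⟨s / ‖w‖, by positivity, (div_lt_one hn).2 h1, by
        rw [e (s / ‖w‖), div_mul_cancel₀ _ hn.ne']⟩
  · rcases hw with h | h
    · exact ⟨‖w‖, hn.ne', by rw [← h, smul_smul, mul_inv_cancel₀ hn.ne', one_smul]⟩
    · exact ⟨-‖w‖, neg_ne_zero.2 hn.ne', by
        rw [neg_smul, smul_smul, mul_inv_cancel₀ hn.ne', one_smul, h, neg_neg]⟩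

theorem Adjacent.exists_corner {A B : Fin n} (h : P.Adjacent A B) :
    ∃ v f g a b r, P.Corner A B v f g a b r := by
  obtain ⟨hne, k, hk⟩ := h.inter
  have hkm : P.vertices k ∈ P.edge A ∩ P.edge B := by rw [hk]; rfl
  obtain ⟨f, a, hf, ha, hmA, hoA, hvA⟩ := exists_unit_direction hkm.1
  obtain ⟨g, b, hg, hb, hmB, hoB, hvB⟩ := exists_unit_direction hkm.2
  obtain ⟨r, hr, hloc⟩ := P.exists_ball_mem_edge (P.vertices k)
  refine ⟨P.vertices k, f, g, a, b, min r (min a b), hne, ⟨k, rfl⟩, hf, hg,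
    lt_min hr (lt_min ha hb), (min_le_right _ _).trans (min_le_left _ _),
    (min_le_right _ _).trans (min_le_right _ _), hmA, hmB, hoA, hoB, hvA, hvB, ?_, hk⟩
  intro z hz j hj
  have hkj := hloc z (Metric.ball_subset_ball (min_le_left _ _) hz) j hj
  have h1 := P.eq_or_eq_of_vertex_mem_edge hkj
  have h2 := P.eq_or_eq_of_vertex_mem_edge hkm.1
  have h3 := P.eq_or_eq_of_vertex_mem_edge hkm.2
  rcases h1 with h1 | h1 <;> rcases h2 with h2 | h2 <;> rcases h3 with h3 | h3
  · exact absurd (h2.symm.trans h3) hne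
  · exact Or.inl (h1.symm.trans h2)
  · exact Or.inr (h1.symm.trans h3)
  · exact absurd ((finRotate n).injective (h2.symm.trans h3)) hne
  · exact absurd (h2.symm.trans h3) hne
  · exact Or.inr ((finRotate n).injective (h1.symm.trans h3))
  · exact Or.inl ((finRotate n).injective (h1.symm.trans h2))
  · exact absurd ((finRotate n).injective (h2.symm.trans h3)) hne

/-- Near a corner, one of two connected pieces that the edges cut off lies in the interior. -/
theorem Corner.subset_interior_or {A B : Fin n} {v f g : ℂ} {a b r : ℝ}
    (h : P.Corner A B v f g a b r) {S₁ S₂ : Set ℂ} (h₁ : IsPreconnected S₁)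
    (h₂ : IsPreconnected S₂) (hd₁ : ∀ i, Disjoint (P.edge i) S₁)
    (hd₂ : ∀ i, Disjoint (P.edge i) S₂)
    (hcov : ∀ z ∈ Metric.ball v r, (∀ i, z ∉ P.edge i) → z ∈ S₁ ∨ z ∈ S₂) :
    S₁ ⊆ interior P.region ∨ S₂ ⊆ interior P.region := by
  have hv : v ∈ closure (interior P.region) := by
    rw [P.region_regular]
    obtain ⟨k, rfl⟩ := h.vertex
    exact P.edge_subset_region k (P.vertex_mem_edge k)
  obtain ⟨z, hz, hzd⟩ := Metric.mem_closure_iff.1 hv r h.pos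
  have hz' : ∀ i, z ∉ P.edge i := fun i hi => P.notMem_interior_of_mem_edge hi hz
  rcases hcov z (by rwa [Metric.mem_ball, dist_comm]) hz' with hs | hs
  · rcases P.subset_interior_or_disjoint h₁ hd₁ with h | h
    · exact Or.inl h
    · exact absurd (interior_subset hz) (Set.disjoint_left.1 h hs)
  · rcases P.subset_interior_or_disjoint h₂ hd₂ with h | h
    · exact Or.inr h
    · exact absurd (interior_subset hz) (Set.disjoint_left.1 h hs)

theorem cross_exp_mul {d : ℂ} (hd : ‖d‖ = 1) (s t : ℝ) :
    cross d ((s : ℂ) * (Complex.exp (t * Complex.I) * d)) = s * Real.sin t := by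
  have h := dot_self d
  rw [hd, one_pow] at h
  rw [← Complex.real_smul, cross_smul_right, Complex.exp_mul_I, ← Complex.ofReal_cos,
    ← Complex.ofReal_sin]
  simp only [cross, dot] at *
  simp [-Complex.ofReal_cos, -Complex.ofReal_sin]
  left
  linear_combination Real.sin t * h

theorem dot_exp_mul {d : ℂ} (hd : ‖d‖ = 1) (s t : ℝ) :
    dot d ((s : ℂ) * (Complex.exp (t * Complex.I) * d)) = s * Real.cos t := by
  have h := dot_self d
  rw [hd, one_pow] at h
  rw [← Complex.real_smul, dot_smul_right, Complex.exp_mul_I, ← Complex.ofReal_cos,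
    ← Complex.ofReal_sin]
  simp only [dot] at *
  simp [-Complex.ofReal_cos, -Complex.ofReal_sin]
  left
  linear_combination Real.cos t * h

theorem dist_exp_mul {p d : ℂ} (hd : ‖d‖ = 1) {s : ℝ} (hs : 0 ≤ s) (t : ℝ) :
    dist (p + (s : ℂ) * (Complex.exp (t * Complex.I) * d)) p = s := by
  rw [dist_eq_norm, add_sub_cancel_left, norm_mul, norm_mul, hd, Complex.norm_exp_ofReal_mul_I,
    Complex.norm_real, Real.norm_of_nonneg hs]; ring

theorem decompose {f : ℂ} (hf : ‖f‖ = 1) (z : ℂ) :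
    z = dot f z • f + cross f z • (Complex.I * f) := by
  have hf0 : f ≠ 0 := by rintro rfl; simp at hf
  have h2 : cross f (Complex.I * f) = 1 := by
    have h := dot_self f
    rw [hf, one_pow, dot] at h
    simp only [cross]; simp; linear_combination h
  have h1 : dot f (Complex.I * f) = 0 := by simp only [dot]; simp; ring
  apply ext_of_dot_cross hf0
  · rw [dot_add_right, dot_smul_right, dot_smul_right, dot_self, hf, h1]; ring
  · rw [cross_add_right, cross_smul_right, cross_smul_right, cross_self, h2]; ring

theorem Corner.ne_dir {A B : Fin n} {v f g : ℂ} {a b r : ℝ}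
    (h : P.Corner A B v f g a b r) : f ≠ g := by
  rintro rfl
  have h1 : v + (r / 2) • f ∈ P.openEdge A :=
    (h.mem_open_left _).2 ⟨r / 2, half_pos h.pos, by linarith [h.pos, h.le_left], rfl⟩
  have h2 : v + (r / 2) • f ∈ P.edge B :=
    (h.mem_right _).2 ⟨r / 2, (half_pos h.pos).le, by linarith [h.pos, h.le_right], rfl⟩
  exact h.ne (P.eq_of_mem_openEdge h1 h2)

/-- The straight boundary cuts the disc into two half discs, one of which lies in the table. Which
one decides whether the counterclockwise turn through the table goes from `A` to `B` or from `B` to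
`A`. -/
theorem Corner.straight {A B : Fin n} {v f g : ℂ} {a b r : ℝ}
    (h : P.Corner A B v f g a b r) (hg : g = -f) : P.HasInteriorAngle A B π := by
  have hf0 : f ≠ 0 := by have := h.norm_left; rintro rfl; simp at this
  have main : ∀ σ : ℝ, σ ≠ 0 → ∀ i, Disjoint (P.edge i)
      (Metric.ball v r ∩ {z | 0 < cross (σ • f) (z - v)}) := by
    intro σ _ i
    rw [Set.disjoint_left]
    rintro z hz ⟨hzb, hzc⟩
    rw [Set.mem_ofPred_eq, cross_smul_left] at hzc
    have : cross f (z - v) = 0 := by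
      rcases h.eq_or_eq z hzb i hz with rfl | rfl
      · obtain ⟨s, -, -, rfl⟩ := (h.mem_left z).1 hz
        rw [add_sub_cancel_left, cross_smul_right, cross_self, mul_zero]
      · obtain ⟨s, -, -, rfl⟩ := (h.mem_right z).1 hz
        rw [add_sub_cancel_left, cross_smul_right, hg, cross_neg_right, cross_self]; simp
    rw [this] at hzc; simp at hzc
  have hpc : ∀ σ : ℝ, IsPreconnected (Metric.ball v r ∩ {z | 0 < cross (σ • f) (z - v)}) :=
    fun σ => ((convex_ball v r).inter (convex_setOf_cross_pos _ _)).isPreconnected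
  have hr := h.pos
  have hra := h.le_left
  have hrb := h.le_right
  have hexp : Complex.exp ((π : ℝ) * Complex.I) = -1 := Complex.exp_pi_mul_I
  refine ⟨⟨Real.pi_pos, by linarith [Real.pi_pos]⟩, ?_⟩
  refine (h.subset_interior_or (hpc 1) (hpc (-1)) (main 1 one_ne_zero)
    (main (-1) (by norm_num)) ?_).elim (fun hs => ?_) (fun hs => ?_)
  rotate_left
  · left
    refine ⟨v, f, r / 2, h.norm_left, half_pos hr, fun s hs' => ⟨?_, ?_, fun t ht => ?_⟩⟩
    · exact (h.mem_left _).2 ⟨s, hs'.1.le, by linarith [hs'.2], by rw [Complex.real_smul]⟩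
    · exact (h.mem_right _).2 ⟨s, hs'.1.le, by linarith [hs'.2], by
        rw [hexp, hg, Complex.real_smul]; ring⟩
    · refine hs ⟨?_, ?_⟩
      · rw [Metric.mem_ball, dist_exp_mul h.norm_left hs'.1.le]; linarith [hs'.2]
      · rw [Set.mem_ofPred_eq, add_sub_cancel_left, one_smul, cross_exp_mul h.norm_left]
        exact mul_pos hs'.1 (Real.sin_pos_of_mem_Ioo ht)
  · right
    refine ⟨v, g, r / 2, h.norm_right, half_pos hr, fun s hs' => ⟨?_, ?_, fun t ht => ?_⟩⟩
    · exact (h.mem_right _).2 ⟨s, hs'.1.le, by linarith [hs'.2], by rw [Complex.real_smul]⟩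
    · exact (h.mem_left _).2 ⟨s, hs'.1.le, by linarith [hs'.2], by
        rw [hexp, hg, Complex.real_smul]; ring⟩
    · refine hs ⟨?_, ?_⟩
      · rw [Metric.mem_ball, dist_exp_mul h.norm_right hs'.1.le]; linarith [hs'.2]
      · rw [Set.mem_ofPred_eq, add_sub_cancel_left, neg_one_smul, ← hg,
          cross_exp_mul h.norm_right]
        exact mul_pos hs'.1 (Real.sin_pos_of_mem_Ioo ht)
  · intro z hz hne
    rcases lt_trichotomy (cross f (z - v)) 0 with hc | hc | hc
    · exact Or.inr ⟨hz, by rw [Set.mem_ofPred_eq, cross_smul_left]; linarith⟩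
    · exfalso
      obtain ⟨t, ht⟩ := exists_smul_of_cross_eq_zero hf0 hc
      have hzt : z = v + t • f := by rw [← ht]; ring
      rw [Metric.mem_ball, dist_eq_norm, ht, norm_smul, h.norm_left, mul_one,
        Real.norm_eq_abs, abs_lt] at hz
      rcases le_total 0 t with h0 | h0
      · exact hne A ((h.mem_left z).2 ⟨t, h0, by linarith, hzt⟩)
      · exact hne B ((h.mem_right z).2 ⟨-t, by linarith, by linarith, by
          rw [hzt, hg, smul_neg, neg_smul, neg_neg]⟩)
    · exact Or.inl ⟨hz, by rw [Set.mem_ofPred_eq, cross_smul_left]; linarith⟩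

/-- Parallel unit directions are equal or opposite: equal directions make the edges overlap,
opposite ones give the angle π. -/
theorem Corner.cross_ne_zero {A B : Fin n} {v f g : ℂ} {a b r : ℝ}
    (h : P.Corner A B v f g a b r) (hA : ¬ P.HasInteriorAngle A B π) : cross f g ≠ 0 := by
  intro hc
  have hf0 : f ≠ 0 := by have := h.norm_left; rintro rfl; simp at this
  obtain ⟨t, ht⟩ := exists_smul_of_cross_eq_zero hf0 hc
  have h1 := h.norm_right
  rw [ht, norm_smul, h.norm_left, mul_one, Real.norm_eq_abs] at h1
  rcases (abs_eq zero_le_one).1 h1 with rfl | rfl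
  · exact h.ne_dir (by rw [ht, one_smul])
  · exact hA (h.straight (by rw [ht, neg_one_smul]))

/-- At a right-angled corner, the table is locally the open quadrant or its complement. -/
theorem Corner.quadrant_or {A B : Fin n} {v f g : ℂ} {a b r : ℝ}
    (h : P.Corner A B v f g a b r) (hfg : dot f g = 0) :
    (∀ z ∈ Metric.ball v r, 0 < dot f (z - v) → 0 < dot g (z - v) → z ∈ interior P.region) ∨
    (∀ z ∈ Metric.ball v r, dot f (z - v) < 0 ∨ dot g (z - v) < 0 → z ∈ interior P.region) := by
  have hcv : ∀ e : ℂ, Convex ℝ {z | 0 < dot e (z - v)} := by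
    intro e
    have : ∀ z, dot e (z - v) = cross (-(Complex.I * e)) (z - v) := by
      intro z; simp only [dot, cross]; simp; ring
    simp only [this]
    exact convex_setOf_cross_pos _ _
  have hcv' : ∀ e : ℂ, Convex ℝ {z | dot e (z - v) < 0} := by
    intro e
    have := hcv (-e)
    simpa only [dot_neg_left, neg_pos] using this
  have hr := h.pos
  have ff : dot f f = 1 := by rw [dot_self, h.norm_left]; norm_num
  have gg : dot g g = 1 := by rw [dot_self, h.norm_right]; norm_num
  have gf : dot g f = 0 := by rw [dot_comm, hfg]
  have coords : ∀ i, ∀ z ∈ Metric.ball v r, z ∈ P.edge i →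
      (0 ≤ dot f (z - v) ∧ 0 ≤ dot g (z - v) ∧ (dot f (z - v) = 0 ∨ dot g (z - v) = 0)) := by
    intro i z hz hi
    rcases h.eq_or_eq z hz i hi with rfl | rfl
    · obtain ⟨s, hs, -, rfl⟩ := (h.mem_left z).1 hi
      rw [add_sub_cancel_left, dot_smul_right, dot_smul_right, ff, gf]
      exact ⟨by linarith, by linarith, Or.inr (by ring)⟩
    · obtain ⟨s, hs, -, rfl⟩ := (h.mem_right z).1 hi
      rw [add_sub_cancel_left, dot_smul_right, dot_smul_right, gg, hfg]
      exact ⟨by linarith, by linarith, Or.inl (by ring)⟩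
  have hS₁ : IsPreconnected (Metric.ball v r ∩ ({z | 0 < dot f (z - v)} ∩
      {z | 0 < dot g (z - v)})) :=
    ((convex_ball v r).inter ((hcv f).inter (hcv g))).isPreconnected
  -- The complement of the closed quadrant is a union of two half discs that share a point on the
  -- negative diagonal.
  have hS₂ : IsPreconnected ((Metric.ball v r ∩ {z | dot f (z - v) < 0}) ∪
      (Metric.ball v r ∩ {z | dot g (z - v) < 0})) := by
    refine IsPreconnected.union (v + (-(r / 4)) • (f + g)) ?_ ?_
      ((convex_ball v r).inter (hcv' f)).isPreconnected
      ((convex_ball v r).inter (hcv' g)).isPreconnected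
    all_goals
      refine ⟨?_, ?_⟩
      · rw [Metric.mem_ball, dist_eq_norm, add_sub_cancel_left, norm_smul, Real.norm_eq_abs,
          abs_neg, abs_of_pos (by positivity)]
        have := norm_add_le f g
        rw [h.norm_left, h.norm_right] at this
        nlinarith
      · rw [Set.mem_ofPred_eq, add_sub_cancel_left, dot_smul_right, dot_add_right]
        simp only [ff, gg, gf, hfg]
        linarith
  refine (h.subset_interior_or hS₁ hS₂ ?_ ?_ ?_).elim (fun hs => ?_) (fun hs => ?_)
  rotate_left 3
  · left
    exact fun z hz hf hg => hs ⟨hz, hf, hg⟩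
  · right
    rintro z hz (hf | hg)
    · exact hs (Or.inl ⟨hz, hf⟩)
    · exact hs (Or.inr ⟨hz, hg⟩)
  · intro i
    rw [Set.disjoint_left]
    rintro z hz ⟨hzb, hf, hg⟩
    rw [Set.mem_ofPred_eq] at hf hg
    rcases (coords i z hzb hz).2.2 with h0 | h0 <;> linarith
  · intro i
    rw [Set.disjoint_left]
    rintro z hz (⟨hzb, hf⟩ | ⟨hzb, hf⟩)
    · exact absurd hf (not_lt.2 (coords i z hzb hz).1)
    · exact absurd hf (not_lt.2 (coords i z hzb hz).2.1)
  -- A point of the disc in neither piece has nonnegative coordinates with product zero, so it lies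
  -- on `A` or on `B`.
  · intro z hz hne
    by_contra! hc
    obtain ⟨hc1, hc2⟩ := hc
    have h1 : 0 ≤ dot f (z - v) := not_lt.1 fun h => hc2 (Or.inl ⟨hz, h⟩)
    have h2 : 0 ≤ dot g (z - v) := not_lt.1 fun h => hc2 (Or.inr ⟨hz, h⟩)
    have hz' : ‖z - v‖ < r := by rwa [← dist_eq_norm]
    have hf0 : f ≠ 0 := by have := h.norm_left; rintro rfl; simp at this
    have key : z - v = dot f (z - v) • f + dot g (z - v) • g := by
      have hk := dot_sq_add_cross_sq f g
      rw [hfg, h.norm_left, h.norm_right] at hk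
      have hc : cross f g * cross f g = 1 := by linarith
      apply ext_of_dot_cross hf0
      · rw [dot_add_right, dot_smul_right, dot_smul_right, ff, hfg]; ring
      · rw [cross_add_right, cross_smul_right, cross_smul_right, cross_self]
        have e : dot g (z - v) * cross f g =
            cross f (z - v) * (cross f g * cross f g) + dot f g * (dot f (z - v) * cross f g) -
            (dot f f - 1) * (cross f (z - v) * dot f g * 0) := by
          rw [hc, hfg]
          have hg : g = cross f g • (Complex.I * f) := by
            have := decompose h.norm_left g; rw [hfg, zero_smul, zero_add] at this; exact this
          have : dot (Complex.I * f) (z - v) = cross f (z - v) := by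
            simp only [dot, cross]; simp; ring
          conv_lhs => rw [hg]
          rw [dot_smul_left, this, ← hg]
          linear_combination (cross f (z - v)) * hc
        rw [e, hc, hfg]; ring
    rcases h1.eq_or_lt with h1 | h1
    · refine hne B ((h.mem_right z).2 ⟨dot g (z - v), h2, ?_, ?_⟩)
      · have := (le_abs_self _).trans (abs_dot_le g (z - v))
        rw [h.norm_right, one_mul] at this
        linarith [h.le_right]
      · rw [← h1, zero_smul, zero_add] at key
        rw [← key]; ring
    · rcases h2.eq_or_lt with h2 | h2
      · refine hne A ((h.mem_left z).2 ⟨dot f (z - v), h1.le, ?_, ?_⟩)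
        · have := (le_abs_self _).trans (abs_dot_le f (z - v))
          rw [h.norm_left, one_mul] at this
          linarith [h.le_left]
        · rw [← h2, zero_smul, add_zero] at key
          rw [← key]; ring
      · exact hc1 ⟨hz, h1, h2⟩

theorem exp_three_pi_div_two : Complex.exp (((3 * π / 2 : ℝ) : ℂ) * Complex.I) = -Complex.I := by
  rw [Complex.exp_mul_I, ← Complex.ofReal_cos, ← Complex.ofReal_sin,
    show 3 * π / 2 = π / 2 + π by ring, Real.cos_add_pi, Real.sin_add_pi]
  simp

theorem dot_I_mul (f z : ℂ) : dot (-Complex.I * f) z = -cross f z := by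
  simp only [dot, cross]; simp; ring

theorem Corner.isCorner {A B : Fin n} {v f g : ℂ} {a b r : ℝ}
    (h : P.Corner A B v f g a b r) (hg : g = -Complex.I * f)
    (hin : ∀ z ∈ Metric.ball v r, dot f (z - v) < 0 ∨ dot g (z - v) < 0 →
      z ∈ interior P.region) : P.IsCorner A B (3 * π / 2) := by
  have hr := h.pos
  refine ⟨v, f, r / 2, h.norm_left, half_pos hr, fun s hs => ⟨?_, ?_, fun t ht => ?_⟩⟩
  · exact (h.mem_left _).2 ⟨s, hs.1.le, by linarith [hs.2, h.le_left], by
      rw [Complex.real_smul]⟩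
  · exact (h.mem_right _).2 ⟨s, hs.1.le, by linarith [hs.2, h.le_right], by
      rw [exp_three_pi_div_two, hg, Complex.real_smul]⟩
  · apply hin
    · rw [Metric.mem_ball, dist_exp_mul h.norm_left hs.1.le]; linarith [hs.2]
    · rw [add_sub_cancel_left, hg, dot_I_mul, cross_exp_mul h.norm_left, dot_exp_mul h.norm_left]
      rcases lt_or_ge t π with ht' | ht'
      · right
        have := mul_pos hs.1 (Real.sin_pos_of_pos_of_lt_pi ht.1 ht')
        linarith
      · left
        have := Real.cos_neg_of_pi_div_two_lt_of_lt (x := t) (by linarith [Real.pi_pos])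
          (by linarith [ht.2])
        exact mul_neg_of_pos_of_neg hs.1 this

theorem Corner.eq_or_of_dot {A B : Fin n} {v f g : ℂ} {a b r : ℝ}
    (h : P.Corner A B v f g a b r) (hfg : dot f g = 0) :
    g = -Complex.I * f ∨ f = -Complex.I * g := by
  have hd := decompose h.norm_left g
  rw [hfg, zero_smul, zero_add] at hd
  have h1 := h.norm_right
  rw [hd, norm_smul, norm_mul, h.norm_left, Complex.norm_I, mul_one, mul_one,
    Real.norm_eq_abs] at h1
  rcases (abs_eq zero_le_one).1 h1 with h1 | h1
  · right
    rw [hd, h1, one_smul, ← mul_assoc, neg_mul, Complex.I_mul_I]; ring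
  · left
    rw [hd, h1]; simp

theorem Corner.hasInteriorAngle {A B : Fin n} {v f g : ℂ} {a b r : ℝ}
    (h : P.Corner A B v f g a b r) (hfg : dot f g = 0)
    (hin : ∀ z ∈ Metric.ball v r, dot f (z - v) < 0 ∨ dot g (z - v) < 0 →
      z ∈ interior P.region) : P.HasInteriorAngle A B (3 * π / 2) := by
  refine ⟨⟨by positivity, by linarith [Real.pi_pos]⟩, ?_⟩
  rcases h.eq_or_of_dot hfg with hg | hg
  · exact Or.inl (h.isCorner hg hin)
  · exact Or.inr (h.symm.isCorner hg fun z hz hz' => hin z hz hz'.symm)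

/-- Translates the angular description into signs of coordinates: the angles strictly between 0 and
3π/2 are those with positive sine or negative cosine. -/
theorem Corner.of_isCorner {A B : Fin n} {v f g : ℂ} {a b r : ℝ}
    (h : P.Corner A B v f g a b r) (hc : P.IsCorner A B (3 * π / 2)) :
    dot f g = 0 ∧ ∃ ρ > 0, ∀ z ∈ Metric.ball v ρ, dot f (z - v) < 0 ∨ dot g (z - v) < 0 →
      z ∈ interior P.region := by
  obtain ⟨p, d, ρ, hd, hρ, hall⟩ := hc
  -- The apex `p` is a limit of points of both closed edges, so it is their common vertex `v`.
  have lim : ∀ (e : ℂ) (i : Fin n), (∀ s ∈ Set.Ioc 0 ρ, p + (s : ℂ) * e ∈ P.edge i) →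
      p ∈ P.edge i := by
    intro e i hs
    have hcont : Filter.Tendsto (fun s : ℝ => p + (s : ℂ) * e) (nhdsWithin 0 (Set.Ioi 0))
        (nhds p) := by
      have : Continuous fun s : ℝ => p + (s : ℂ) * e := by fun_prop
      simpa using (this.tendsto 0).mono_left nhdsWithin_le_nhds
    refine (P.isCompact_edge i).isClosed.mem_of_tendsto hcont ?_
    filter_upwards [Ioc_mem_nhdsGT hρ] with s hs' using hs s hs'
  have hp : p ∈ P.edge A ∩ P.edge B :=
    ⟨lim d A fun s hs => (hall s hs).1, lim _ B fun s hs => (hall s hs).2.1⟩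
  rw [h.inter, Set.mem_singleton_iff] at hp
  subst hp
  have hdir : ∀ (e e' : ℂ), ‖e‖ = 1 → ‖e'‖ = 1 → (∃ s : ℝ, 0 ≤ s ∧ (ρ : ℂ) * e = s • e') →
      e = e' := by
    rintro e e' he he' ⟨s, hs, heq⟩
    have hn := congrArg norm heq
    rw [norm_mul, norm_smul, he, he', Complex.norm_real, Real.norm_of_nonneg hs,
      Real.norm_of_nonneg hρ.le, mul_one, mul_one] at hn
    rw [← hn, ← Complex.real_smul] at heq
    exact smul_right_injective ℂ hρ.ne' heq
  have hρmem : ρ ∈ Set.Ioc 0 ρ := ⟨hρ, le_rfl⟩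
  have hdf : d = f := by
    obtain ⟨s, hs, -, he⟩ := (h.mem_left _).1 (hall ρ hρmem).1
    exact hdir d f hd h.norm_left ⟨s, hs, add_left_cancel he⟩
  subst hdf
  have hdg : -Complex.I * d = g := by
    obtain ⟨s, hs, -, he⟩ := (h.mem_right _).1 (hall ρ hρmem).2.1
    rw [exp_three_pi_div_two] at he
    exact hdir _ g (by rw [norm_mul, norm_neg, Complex.norm_I, hd, one_mul]) h.norm_right
      ⟨s, hs, add_left_cancel he⟩
  subst hdg
  refine ⟨by rw [dot_comm, dot_I_mul, cross_self, neg_zero], ρ, hρ, fun z hz hneg => ?_⟩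
  rw [dot_I_mul] at hneg
  have hd0 : d ≠ 0 := by rintro rfl; simp at hd
  have hz0 : z ≠ p := by
    rintro rfl; simp [dot, cross] at hneg
  set τ := Complex.arg ((z - p) / d) with hτ
  have hzn : (z - p) = (‖z - p‖ : ℂ) * (Complex.exp (τ * Complex.I) * d) := by
    have := Complex.norm_mul_exp_arg_mul_I ((z - p) / d)
    rw [norm_div, hd, div_one] at this
    rw [← mul_assoc, this, div_mul_cancel₀ _ hd0]
  have hnpos : 0 < ‖z - p‖ := norm_pos_iff.2 (sub_ne_zero.2 hz0)
  have hmem : ‖z - p‖ ∈ Set.Ioc 0 ρ := ⟨hnpos, by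
    rw [Metric.mem_ball, dist_eq_norm] at hz; exact hz.le⟩
  rw [hzn, cross_exp_mul hd, dot_exp_mul hd] at hneg
  have hτ1 : -π < τ := Complex.neg_pi_lt_arg _
  have hτ2 : τ ≤ π := Complex.arg_le_pi _
  have hcs : Real.cos τ < 0 ∨ 0 < Real.sin τ := by
    rcases hneg with h | h
    · left; by_contra! h'; nlinarith
    · right; by_contra! h'; nlinarith
  -- The argument lies in `(-π, π]`; the part of the sector beyond π is represented by nonpositive
  -- arguments and needs a full turn added.
  rcases le_or_gt τ 0 with h0 | h0
  · have hs : Real.sin τ ≤ 0 := Real.sin_nonpos_of_nonpos_of_neg_pi_le h0 hτ1.le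
    have hc : Real.cos τ < 0 := hcs.resolve_right (not_lt.2 hs)
    have hlt : τ < -(π / 2) := by
      by_contra! hge
      exact absurd (Real.cos_nonneg_of_mem_Icc ⟨hge, by linarith [Real.pi_pos]⟩) (not_le.2 hc)
    have := (hall _ hmem).2.2 (τ + 2 * π) ⟨by linarith, by linarith⟩
    push_cast at this
    rw [add_mul, Complex.exp_add, Complex.exp_two_pi_mul_I, mul_one, ← hzn] at this
    simpa using this
  · have := (hall _ hmem).2.2 τ ⟨h0, by linarith [Real.pi_pos]⟩
    rw [← hzn] at this
    simpa using this

theorem Corner.of_hasInteriorAngle {A B : Fin n} {v f g : ℂ} {a b r : ℝ}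
    (h : P.Corner A B v f g a b r) (hc : P.HasInteriorAngle A B (3 * π / 2)) :
    dot f g = 0 ∧ ∃ ρ > 0, ∀ z ∈ Metric.ball v ρ, dot f (z - v) < 0 ∨ dot g (z - v) < 0 →
      z ∈ interior P.region := by
  rcases hc.2 with hc | hc
  · exact h.of_isCorner hc
  · obtain ⟨h1, ρ, hρ, h2⟩ := h.symm.of_isCorner hc
    exact ⟨by rw [dot_comm, h1], ρ, hρ, fun z hz hz' => h2 z hz hz'.symm⟩

end PolygonalTable

namespace PolygonalTable

/-! ### Close returns -/

theorem norm_sub_le_abs_arg_sub {z w : ℂ} (hz : ‖z‖ = 1) (hw : ‖w‖ = 1) :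
    ‖z - w‖ ≤ |z.arg - w.arg| := by
  have h1 : z = Complex.exp (z.arg * Complex.I) := by
    have := Complex.norm_mul_exp_arg_mul_I z
    rw [hz] at this; simpa using this.symm
  have h2 : w = Complex.exp (w.arg * Complex.I) := by
    have := Complex.norm_mul_exp_arg_mul_I w
    rw [hw] at this; simpa using this.symm
  generalize z.arg = α at *
  generalize w.arg = β at *
  have h3 : z - w = w * (Complex.exp (Complex.I * ((α - β : ℝ) : ℂ)) - 1) := by
    rw [mul_sub, mul_one, h1, h2, ← Complex.exp_add]
    congr 2
    push_cast; ring
  rw [h3, norm_mul, hw, one_mul]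
  exact Real.norm_exp_I_mul_ofReal_sub_one_le

/-- Real numbers in a bounded interval cannot be separated by a divergent series of distances. -/
theorem sum_le_of_separated {s : Finset ℕ} {α : ℕ → ℝ} {M κ : ℝ} (hκ : 0 < κ) (hM : 0 ≤ M)
    (hα : ∀ k ∈ s, |α k| ≤ M)
    (hsep : ∀ k ∈ s, ∀ l ∈ s, k < l → κ / (k + 1) ≤ |α k - α l|) :
    ∑ k ∈ s, κ / ((k : ℝ) + 1) ≤ 2 * M + 2 * κ := by
  -- Intervals of length `κ / (k + 1)` around the points. For `k < l` the second is no longer than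
  -- the first, so the separation of the centres makes them disjoint, and their total length is at
  -- most that of the enclosing interval.
  set I : ℕ → Set ℝ := fun k =>
    Set.Ioo (α k - κ / (2 * ((k : ℝ) + 1))) (α k + κ / (2 * ((k : ℝ) + 1))) with hI
  have key : ∀ k ∈ s, ∀ l ∈ s, k < l → Disjoint (I k) (I l) := by
    intro k hk l hl hkl
    rw [Set.disjoint_left]
    rintro z ⟨h1, h2⟩ ⟨h3, h4⟩
    have h5 := hsep k hk l hl hkl
    have h6 : κ / (2 * ((l : ℝ) + 1)) ≤ κ / (2 * ((k : ℝ) + 1)) := by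
      have : (k : ℝ) ≤ l := by exact_mod_cast hkl.le
      gcongr
    have h7 : κ / ((k : ℝ) + 1) = κ / (2 * ((k : ℝ) + 1)) + κ / (2 * ((k : ℝ) + 1)) := by
      field_simp; ring
    rcases le_abs.1 h5 with h | h <;> linarith
  have hdis : Set.PairwiseDisjoint (s : Set ℕ) I := by
    intro k hk l hl hkl
    rcases lt_or_gt_of_ne hkl with h | h
    · exact key k hk l hl h
    · exact (key l hl k hk h).symm
  have hmeas := MeasureTheory.measure_biUnion_finset (μ := MeasureTheory.volume) hdis
    (fun k _ => measurableSet_Ioo)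
  have hsub : (⋃ k ∈ s, I k) ⊆ Set.Ioo (-M - κ) (M + κ) := by
    intro z hz
    obtain ⟨k, hk, h1, h2⟩ := Set.mem_iUnion₂.1 hz
    have h3 := abs_le.1 (hα k hk)
    have h4 : κ / (2 * ((k : ℝ) + 1)) ≤ κ := by
      apply div_le_self hκ.le
      have : (0 : ℝ) ≤ k := Nat.cast_nonneg k
      linarith
    exact ⟨by linarith, by linarith⟩
  have hle := MeasureTheory.measure_mono (μ := MeasureTheory.volume) hsub
  rw [hmeas, Real.volume_Ioo] at hle
  have hv : ∀ k ∈ s, MeasureTheory.volume (I k) = ENNReal.ofReal (κ / ((k : ℝ) + 1)) := by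
    intro k _
    rw [hI, Real.volume_Ioo]
    congr 1; field_simp; ring
  rw [Finset.sum_congr rfl hv, ← ENNReal.ofReal_sum_of_nonneg (fun k _ => by positivity)] at hle
  rw [ENNReal.ofReal_le_ofReal_iff (by linarith)] at hle
  linarith

/-- Otherwise, within each class of indices with the same edge and the same small ball, the
arguments of the directions would be separated at the rate `κ / (k + 1)`. There are finitely many
classes, while the harmonic series diverges. The bound is tied to the earlier index because the pair
is to be traced back that many steps, each adding to the transverse error. -/
theorem exists_close_pair {K : Set ℂ} (hK : IsCompact K) {x d : ℕ → ℂ} {n : ℕ} {c : ℕ → Fin n}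
    (hx : ∀ k, x k ∈ K) (hd : ∀ k, ‖d k‖ = 1) {w κ : ℝ} (hw : 0 < w) (hκ : 0 < κ) :
    ∃ k l, k < l ∧ c k = c l ∧ ‖x k - x l‖ < w ∧ ‖d k - d l‖ < κ / ((k : ℝ) + 1) := by
  classical
  by_contra! hc
  obtain ⟨t, -, htf, ht⟩ := hK.finite_cover_balls (half_pos hw)
  have hcl : ∀ k, ∃ y ∈ t, x k ∈ Metric.ball y (w / 2) := by
    intro k; simpa using ht (hx k)
  choose y hyt hy using hcl
  have : Finite t := htf
  have : Fintype t := Fintype.ofFinite t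
  set F : ℕ → Fin n × t := fun k => (c k, ⟨y k, hyt k⟩) with hF
  have hclass : ∀ (N : ℕ) (b : Fin n × t), ∑ k ∈ Finset.range N with F k = b,
      κ / ((k : ℝ) + 1) ≤ 2 * π + 2 * κ := by
    intro N b
    refine sum_le_of_separated (α := fun k => (d k).arg) hκ Real.pi_pos.le
      (fun k _ => Complex.abs_arg_le_pi _) ?_
    intro k hk l hl hkl
    have hkl' : F k = F l := (Finset.mem_filter.1 hk).2.trans (Finset.mem_filter.1 hl).2.symm
    have h1 : c k = c l := congrArg Prod.fst hkl'
    have h2 : y k = y l := congrArg (fun p => (p.2 : ℂ)) hkl'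
    have h3 : ‖x k - x l‖ < w := by
      have ha := hy k
      have hb := hy l
      rw [h2] at ha
      rw [Metric.mem_ball] at ha hb
      rw [← dist_eq_norm]
      linarith [dist_triangle_right (x k) (x l) (y l)]
    exact (hc k l hkl h1 h3).trans (norm_sub_le_abs_arg_sub (hd k) (hd l))
  have hall : ∀ N, κ * ∑ k ∈ Finset.range N, 1 / ((k : ℝ) + 1) ≤
      Fintype.card (Fin n × t) * (2 * π + 2 * κ) := by
    intro N
    rw [Finset.mul_sum]
    simp only [mul_one_div]
    rw [← Finset.sum_fiberwise (Finset.range N) F]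
    refine (Finset.sum_le_sum fun b _ => hclass N b).trans ?_
    rw [Finset.sum_const, nsmul_eq_mul, Finset.card_univ]
  obtain ⟨N, hN⟩ := (Real.tendsto_sum_range_one_div_nat_succ_atTop.eventually_gt_atTop
    (Fintype.card (Fin n × t) * (2 * π + 2 * κ) / κ)).exists
  rw [div_lt_iff₀ hκ] at hN
  linarith [hall N]

/-! ### Strips -/

theorem exists_smul_of_dot_eq_zero {d ν z : ℂ} (hd : d ≠ 0) (hν : ν ≠ 0) (h : dot d ν = 0)
    (hz : dot ν z = 0) : ∃ t : ℝ, z = t • d := by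
  apply exists_smul_of_cross_eq_zero hd
  have hn : ‖ν‖ ^ 2 ≠ 0 := by positivity
  apply mul_left_cancel₀ hn
  rw [← dot_self, mul_zero]
  have : dot ν ν * cross d z = dot d ν * cross ν z - cross ν d * dot ν z := by
    simp only [dot, cross]; ring
  rw [this, h, hz]; ring

theorem eq_of_dot_of_cross {e d ν y z : ℂ} (hν : ν ≠ 0) (h : dot d ν = 0)
    (hed : cross e d ≠ 0) (h₁ : dot ν (y - z) = 0) (h₂ : cross e (y - z) = 0) : y = z := by
  have hd : d ≠ 0 := by rintro rfl; exact hed (cross_zero_right e)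
  obtain ⟨t, ht⟩ := exists_smul_of_dot_eq_zero hd hν h h₁
  rw [ht, cross_smul_right] at h₂
  rw [(mul_eq_zero.1 h₂).resolve_right hed, zero_smul] at ht
  exact sub_eq_zero.1 ht

variable {n : ℕ} {P : PolygonalTable n}

theorem cross_leftVec_sub {i : Fin n} {y z : ℂ} (hy : y ∈ P.edge i) (hz : z ∈ P.edge i) :
    cross (P.leftVec i) (y - z) = 0 := by
  have h1 := P.depth_eq_zero hy
  have h2 := P.depth_eq_zero hz
  rw [depth] at h1 h2
  rw [← sub_sub_sub_cancel_right y z (P.vertices i), cross_sub_right, h1, h2, sub_zero]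

/-- A free chord that stays inside a strip between the edges `i` and `j`, and ends on `j`, starts
on `i`. -/
theorem mem_of_strip {i j k : Fin n} {o d ν : ℂ} {w : ℝ} (hν : ν ≠ 0) (hdν : dot d ν = 0)
    (strip : ∀ t, |t| < w → ∃ p ∈ P.openEdge i, ∃ q ∈ P.openEdge j, dot ν (p - o) = t ∧
      ∃ s : ℝ, 0 < s ∧ q = p + s • d ∧ P.FreeFlight p q)
    {y z : ℂ} (hy : y ∈ P.openEdge j) (hz : z ∈ P.edge k) (hyz : P.FreeFlight z y)
    (hyw : |dot ν (y - o)| < w) (hzw : |dot ν (z - o)| < w) : z ∈ P.openEdge i := by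
  have hνd : dot ν d = 0 := by rw [dot_comm, hdν]
  obtain ⟨p₀, hp₀, q₀, hq₀, ht₀, s₀, hs₀, rfl, hf₀⟩ := strip _ hyw
  obtain ⟨p₁, hp₁, q₁, hq₁, ht₁, s₁, hs₁, rfl, hf₁⟩ := strip _ hzw
  have hκ : 0 < cross (P.leftVec i) d := by
    have := hf₀.cross_pos hp₀
    rw [add_sub_cancel_left, cross_smul_right] at this
    exact pos_of_mul_pos_right this hs₀.le
  have hκ' : cross (P.leftVec j) d < 0 := by
    have := hf₀.symm.cross_pos hq₀
    rw [sub_add_cancel_left, cross_neg_right, cross_smul_right] at this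
    nlinarith
  have hd : d ≠ 0 := by rintro rfl; simp [cross_zero_right] at hκ
  have hy0 : y = p₀ + s₀ • d := by
    refine eq_of_dot_of_cross hν hdν hκ'.ne ?_
      (cross_leftVec_sub (P.openEdge_subset_edge j hy) (P.openEdge_subset_edge j hq₀))
    rw [show y - (p₀ + s₀ • d) = (y - o) - (p₀ - o) - s₀ • d by ring, dot_sub_right,
      dot_sub_right, dot_smul_right, ht₀, hνd]; ring
  obtain ⟨s, hs⟩ : ∃ s : ℝ, z - p₁ = s • d := by
    apply exists_smul_of_dot_eq_zero hd hν hdν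
    rw [← sub_sub_sub_cancel_right z p₁ o, dot_sub_right, ht₁, sub_self]
  have hz0 : z = p₁ + s • d := by rw [← hs]; ring
  -- On its parallel, `z` comes before the edge `j`, because a chord ending on `j` starts on the
  -- inner side of `j`.
  have hss : s < s₁ := by
    have h1 := hyz.symm.depth_pos hy
    rw [hz0, depth_add_smul] at h1
    have h2 := P.depth_eq_zero (P.openEdge_subset_edge j hq₁)
    rw [depth_add_smul] at h2
    nlinarith
  have dp₁ := P.depth_eq_zero (P.openEdge_subset_edge i hp₁)
  have dz : P.depth i z = s * cross (P.leftVec i) d := by rw [hz0, depth_add_smul, dp₁, zero_add]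
  have dy : P.depth i y = s₀ * cross (P.leftVec i) d := by
    rw [hy0, depth_add_smul, P.depth_eq_zero (P.openEdge_subset_edge i hp₀), zero_add]
  -- Behind the edge `i`, the chord would cross the line of `i` inside the strip, hence at a
  -- boundary point. In front of it, `z` would lie inside a free chord of the strip. So `z` is on
  -- `i`.
  rcases lt_trichotomy s 0 with h | h | h
  · exfalso
    set τ := -s / (s₀ - s) with hτ
    have hden : 0 < s₀ - s := by linarith
    have hτ0 : 0 < τ := div_pos (by linarith) hden
    have hτ1 : τ < 1 := (div_lt_one hden).2 (by linarith)
    set u := z + τ • (y - z) with hu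
    have hui : u ∈ interior P.region := hyz.mem hτ0 hτ1
    have hdu : P.depth i u = 0 := by
      have e1 : cross (P.leftVec i) (y - z) = P.depth i y - P.depth i z := by
        rw [depth, depth, ← cross_sub_right]; congr 1; ring
      rw [hu, depth_add_smul, e1, dz, dy, hτ]
      field_simp; ring
    have huw : |dot ν (u - o)| < w := by
      have e : dot ν (u - o) = (1 - τ) * dot ν (z - o) + τ * dot ν (y - o) := by
        rw [hu, ← dot_smul_right, ← dot_smul_right, ← dot_add_right]
        congr 1
        simp only [smul_sub, sub_smul, one_smul]; ring
      rw [abs_lt] at *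
      rw [e]
      constructor <;> nlinarith
    obtain ⟨p, hp, q, hq, ht, -⟩ := strip _ huw
    have hup : u = p := by
      refine eq_of_dot_of_cross hν hdν hκ.ne' ?_ ?_
      · rw [← sub_sub_sub_cancel_right u p o, dot_sub_right, ht, sub_self]
      · have h2 := P.depth_eq_zero (P.openEdge_subset_edge i hp)
        rw [← sub_sub_sub_cancel_right u p (P.vertices i), cross_sub_right]
        rw [depth] at hdu h2
        rw [hdu, h2, sub_zero]
    exact P.notMem_interior_of_mem_openEdge hp (hup ▸ hui)
  · rw [hz0, h, zero_smul, add_zero]; exact hp₁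
  · exfalso
    refine P.notMem_interior_of_mem_edge hz ?_
    have := hf₁.mem (t := s / s₁) (by positivity) ((div_lt_one hs₁).2 hss)
    rw [add_sub_cancel_left, smul_smul, div_mul_cancel₀ _ hs₁.ne', ← hz0] at this
    exact this

/-- No trajectory that starts at a vertex has a neighbourhood of constant width, made of parallel
trajectories, that never meets a vertex again. -/
theorem no_strip {c : ℕ → Fin n} {x d ν : ℕ → ℂ} {w : ℝ} (hw : 0 < w) {k₀ : Fin n}
    (hx₀ : x 0 = P.vertices k₀) (hfree : ∀ k, P.FreeFlight (x k) (x (k + 1)))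
    (hx : ∀ k, x (k + 1) ∈ P.openEdge (c k)) (hd : ∀ k, dir (x k) (x (k + 1)) = d k)
    (hds : ∀ k, d (k + 1) = P.refl (c k) (d k)) (hν : ∀ k, ‖ν k‖ = 1)
    (hdν : ∀ k, dot (d k) (ν k) = 0) (hνs : ∀ k, ν (k + 1) = P.refl (c k) (ν k))
    (strip : ∀ k t, |t| < w → ∃ p ∈ P.openEdge (c k), ∃ q ∈ P.openEdge (c (k + 1)),
      dot (ν (k + 1)) (p - x (k + 1)) = t ∧
      ∃ s : ℝ, 0 < s ∧ q = p + s • d (k + 1) ∧ P.FreeFlight p q) : False := by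
  obtain ⟨D, hD, hdiam⟩ := P.exists_bound
  have hdn : ∀ k, ‖d k‖ = 1 := fun k => by rw [← hd k]; exact norm_dir (hfree k).1
  -- Half of the width `w` absorbs the initial offset; the other half absorbs the drift of at most
  -- `K + 1` flights of length at most `D`.
  obtain ⟨K, L, hKL, hcKL, hxKL, hdKL⟩ := exists_close_pair (c := c) (d := d)
    (x := fun k => x (k + 1)) P.region_compact
    (fun k => P.edge_subset_region _ (P.openEdge_subset_edge _ (hx k))) hdn (half_pos hw)
    (show 0 < w / (2 * D) by positivity)
  have hν0 : ∀ k, ν k ≠ 0 := fun k h => by have := hν k; rw [h] at this; simp at this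
  -- The drift per unit length of the earlier piece across the later strip; it is unchanged when
  -- both are traced back through the same reflections.
  set σ := dot (ν L) (d K) with hσ
  have hσle : |σ| ≤ ‖d K - d L‖ := by
    have : σ = dot (ν L) (d K - d L) := by
      rw [dot_sub_right, dot_comm (ν L) (d L), hdν, sub_zero]
    rw [this]
    have := abs_dot_le (ν L) (d K - d L)
    rwa [hν, one_mul] at this
  have hσD : ((K : ℝ) + 1) * (D * |σ|) < w / 2 := by
    have h1 : |σ| < w / (2 * D) / ((K : ℝ) + 1) := hσle.trans_lt hdKL
    rw [lt_div_iff₀ (by positivity), lt_div_iff₀ (by positivity)] at h1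
    linarith
  have hflight : ∀ k, x k = x (k + 1) - ‖x (k + 1) - x k‖ • d k := by
    intro k; rw [← hd, norm_smul_dir]; ring
  have hreg : ∀ k, x k ∈ P.region := fun k => (hfree k).left_mem_region
  -- the invariant of the backward induction
  have main : ∀ j ≤ K, c (K - j) = c (L - j) ∧ dot (ν (L - j)) (d (K - j)) = σ ∧
      |dot (ν (L - j)) (x (K - j + 1) - x (L - j + 1))| < w / 2 + j * (D * |σ|) := by
    intro j
    induction j with
    | zero =>
      intro _
      refine ⟨by simpa using hcKL, rfl, ?_⟩
      simp only [Nat.sub_zero, Nat.cast_zero, zero_mul, add_zero]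
      refine (abs_dot_le _ _).trans_lt ?_
      rw [hν, one_mul]; exact hxKL
    | succ j ih =>
      intro hj
      obtain ⟨h1, h2, h3⟩ := ih (by omega)
      obtain ⟨a, ha⟩ : ∃ a, K - j = a + 1 := ⟨K - j - 1, by omega⟩
      obtain ⟨b, hb⟩ : ∃ b, L - j = b + 1 := ⟨L - j - 1, by omega⟩
      rw [ha, hb] at h1 h2 h3
      rw [show K - (j + 1) = a by omega, show L - (j + 1) = b by omega]
      have e1 : dot (ν (b + 1)) (x (a + 1) - x (b + 1)) =
          dot (ν (b + 1)) (x (a + 1 + 1) - x (b + 1 + 1)) - ‖x (a + 1 + 1) - x (a + 1)‖ * σ := by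
        rw [hflight (a + 1), hflight (b + 1)]
        simp only [dot_sub_right, dot_smul_right]
        rw [← hflight (a + 1), h2, dot_comm (ν (b + 1)) (d (b + 1)), hdν]
        ring
      have hlen : ‖x (a + 1 + 1) - x (a + 1)‖ ≤ D := hdiam _ (hreg _) _ (hreg _)
      have hz : |dot (ν (b + 1)) (x (a + 1) - x (b + 1))| < w / 2 + (j + 1) * (D * |σ|) := by
        rw [e1]
        refine (abs_sub _ _).trans_lt ?_
        rw [abs_mul, abs_norm]
        have := mul_le_mul_of_nonneg_right hlen (abs_nonneg σ)
        linarith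
      have hjK : ((j : ℝ) + 1) * (D * |σ|) < w / 2 := by
        refine lt_of_le_of_lt (mul_le_mul_of_nonneg_right ?_ (by positivity)) hσD
        have : ((j + 1 : ℕ) : ℝ) ≤ K := by exact_mod_cast hj
        push_cast at this; linarith
      have hy : |dot (ν (b + 1)) (x (a + 1 + 1) - x (b + 1))| < w := by
        have e : dot (ν (b + 1)) (x (a + 1 + 1) - x (b + 1)) =
            dot (ν (b + 1)) (x (a + 1 + 1) - x (b + 1 + 1)) := by
          rw [hflight (b + 1)]
          simp only [dot_sub_right, dot_smul_right]
          rw [dot_comm (ν (b + 1)) (d (b + 1)), hdν]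
          ring
        rw [e]
        have : 0 ≤ D * |σ| := by positivity
        linarith
      -- The earlier flight ends on the far edge of the strip and does not leave the strip, so it
      -- also starts on the strip's near edge.
      have hmem := mem_of_strip (hν0 (b + 1)) (hdν (b + 1)) (strip b)
        (y := x (a + 1 + 1)) (z := x (a + 1)) (h1 ▸ hx (a + 1))
        (P.openEdge_subset_edge _ (hx a)) (hfree (a + 1)) hy (by linarith)
      have hc : c a = c b := P.eq_of_mem_openEdge (hx a) (P.openEdge_subset_edge _ hmem)
      have hνb : ν b = P.refl (c b) (ν (b + 1)) := by rw [hνs, refl_refl]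
      refine ⟨hc, ?_, ?_⟩
      · rw [← h2, hνs b, hds a, hc, dot_refl_refl]
      · rw [hνb, ← P.refl_sub_of_mem (P.openEdge_subset_edge _ (hc ▸ hx a))
          (P.openEdge_subset_edge _ (hx b)), dot_refl_refl]
        push_cast; exact hz
  obtain ⟨h1, h2, h3⟩ := main K le_rfl
  obtain ⟨b, hb⟩ : ∃ b, L - K = b + 1 := ⟨L - K - 1, by omega⟩
  rw [Nat.sub_self, hb] at h1 h2 h3
  rw [zero_add] at h3
  have e0 : dot (ν (b + 1)) (x 1 - x (b + 1)) = dot (ν (b + 1)) (x 1 - x (b + 1 + 1)) := by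
    rw [hflight (b + 1)]
    simp only [dot_sub_right, dot_smul_right]
    rw [dot_comm (ν (b + 1)) (d (b + 1)), hdν]
    ring
  have e1 : dot (ν (b + 1)) (x 0 - x (b + 1)) =
      dot (ν (b + 1)) (x 1 - x (b + 1)) - ‖x 1 - x 0‖ * σ := by
    rw [hflight 0]
    simp only [dot_sub_right, dot_smul_right]
    rw [h2, zero_add, ← hflight 0]
    ring
  have hlen : ‖x 1 - x 0‖ ≤ D := hdiam _ (hreg _) _ (hreg _)
  have hDσ : 0 ≤ D * |σ| := by positivity
  -- The last backward step reaches the vertex `x 0`, which would then be an inner point of an edge.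
  have hmem := mem_of_strip (hν0 (b + 1)) (hdν (b + 1)) (strip b) (y := x 1) (z := x 0)
    (k := k₀) (h1 ▸ hx 0) (hx₀ ▸ P.vertex_mem_edge k₀) (hfree 0) (by rw [e0]; linarith) (by
      rw [e1, e0]
      refine (abs_sub _ _).trans_lt ?_
      rw [abs_mul, abs_norm]
      have := mul_le_mul_of_nonneg_right hlen (abs_nonneg σ)
      linarith)
  rw [hx₀] at hmem
  exact P.vertex_notMem_openEdge _ _ hmem

end PolygonalTable

namespace PolygonalTable

/-! ### Flights out of a convex right-angled corner -/

theorem dot_mul_norm_sq (f g z : ℂ) :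
    dot g z * ‖f‖ ^ 2 = dot f g * dot f z + cross f g * cross f z := by
  rw [← dot_self]; simp only [dot, cross]; ring

theorem cross_sq_eq_one {f g : ℂ} (hf : ‖f‖ = 1) (hg : ‖g‖ = 1) (hfg : dot f g = 0) :
    cross f g ^ 2 = 1 := by
  have := dot_mul_norm_sq f g g
  rw [dot_self, hf, hg, hfg] at this
  linarith

theorem cross_eq_mul_dot {f g : ℂ} (hf : ‖f‖ = 1) (hg : ‖g‖ = 1) (hfg : dot f g = 0) (z : ℂ) :
    cross f z = cross f g * dot g z := by
  have h1 := dot_mul_norm_sq f g z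
  rw [hf, hfg] at h1
  linear_combination (-cross f z) * cross_sq_eq_one hf hg hfg - cross f g * h1

theorem orthonormal_decompose {f g : ℂ} (hf : ‖f‖ = 1) (hg : ‖g‖ = 1) (hfg : dot f g = 0) (z : ℂ) :
    z = dot f z • f + dot g z • g := by
  have hf0 : f ≠ 0 := by rintro rfl; simp at hf
  apply ext_of_dot_cross hf0
  · rw [dot_add_right, dot_smul_right, dot_smul_right, dot_self, hf, hfg]; ring
  · rw [cross_add_right, cross_smul_right, cross_smul_right, cross_self,
      cross_eq_mul_dot hf hg hfg z]; ring

theorem norm_sq_eq_of_orthonormal {f g : ℂ} (hf : ‖f‖ = 1) (hg : ‖g‖ = 1) (hfg : dot f g = 0)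
    (z : ℂ) : ‖z‖ ^ 2 = dot f z ^ 2 + dot g z ^ 2 := by
  have h1 := dot_sq_add_cross_sq f z
  have h2 := cross_sq_eq_one hf hg hfg
  have h3 := cross_eq_mul_dot hf hg hfg z
  rw [hf] at h1
  rw [h3] at h1
  linear_combination -h1 + dot g z ^ 2 * h2

variable {n : ℕ} {P : PolygonalTable n}

/-- The inner side of `A` is the side of `g`, since a short step from `A` in the direction `g` stays
in the quadrant contained in the table. -/
theorem Corner.exists_cross_leftVec {A B : Fin n} {v f g : ℂ} {a b r : ℝ}
    (h : P.Corner A B v f g a b r) (hfg : dot f g = 0)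
    (hin : ∀ z ∈ Metric.ball v r, 0 < dot f (z - v) → 0 < dot g (z - v) → z ∈ interior P.region) :
    ∃ κ : ℝ, 0 < κ ∧ ∀ z, cross (P.leftVec A) z = κ * dot g z := by
  have hr := h.pos
  obtain ⟨c, hc⟩ : ∃ c : ℝ, P.leftVec A = c • f := by
    obtain ⟨c, -, hc⟩ := h.vec_left
    rcases P.leftVec_eq_or A with h1 | h1
    · exact ⟨c, h1.trans hc⟩
    · exact ⟨-c, by rw [h1, hc, neg_smul]⟩
  have key : ∀ z, cross (P.leftVec A) z = (c * cross f g) * dot g z := by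
    intro z
    rw [hc, cross_smul_left, cross_eq_mul_dot h.norm_left h.norm_right hfg z]; ring
  refine ⟨_, ?_, key⟩
  have hy : v + (r / 2) • f ∈ P.openEdge A :=
    (h.mem_open_left _).2 ⟨r / 2, half_pos hr, by linarith [h.le_left], rfl⟩
  have := P.cross_leftVec_pos hy (half_pos hr) (u := g) (by
    intro t ht
    have hgf : dot g f = 0 := by rw [dot_comm, hfg]
    have e : v + (r / 2) • f + t • g - v = (r / 2) • f + t • g := by ring
    apply hin
    · rw [Metric.mem_ball, dist_eq_norm, e]
      refine (norm_add_le _ _).trans_lt ?_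
      rw [norm_smul, norm_smul, h.norm_left, h.norm_right, Real.norm_of_nonneg (half_pos hr).le,
        Real.norm_of_nonneg ht.1.le]
      linarith [ht.2]
    · rw [e, dot_add_right, dot_smul_right, dot_smul_right, hfg, dot_self, h.norm_left]
      linarith
    · rw [e, dot_add_right, dot_smul_right, dot_smul_right, hgf, dot_self, h.norm_right]
      linarith [ht.1])
  rwa [key, dot_self, h.norm_right, one_pow, mul_one] at this

theorem Corner.dot_pos {A B : Fin n} {v f g : ℂ} {a b r : ℝ}
    (h : P.Corner A B v f g a b r) (hfg : dot f g = 0)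
    (hin : ∀ z ∈ Metric.ball v r, 0 < dot f (z - v) → 0 < dot g (z - v) → z ∈ interior P.region)
    {p q : ℂ} (hp : p ∈ P.openEdge A) (hpq : P.FreeFlight p q) : 0 < dot g (q - p) := by
  obtain ⟨κ, hκ, hκ'⟩ := h.exists_cross_leftVec hfg hin
  have := hpq.cross_pos hp
  rw [hκ'] at this
  exact pos_of_mul_pos_right this hκ.le

/-- A third edge either has positive distance from `A` or meets it only at the far endpoint `v + a •
f`. In the second case it is a segment from that point, and its part above `A` has a fixed slope. -/
theorem Corner.exists_slope {A B j : Fin n} {v f g : ℂ} {a b r : ℝ}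
    (h : P.Corner A B v f g a b r) (hfg : dot f g = 0) (hjA : j ≠ A) (hjB : j ≠ B) :
    ∃ c > 0, ∀ q ∈ P.edge j, 0 ≤ dot f (q - v) → dot f (q - v) ≤ a → 0 < dot g (q - v) →
      c * (a - dot f (q - v)) ≤ dot g (q - v) := by
  have hr := h.pos
  have ha : 0 < a := hr.trans_le h.le_left
  have hgf : dot g f = 0 := by rw [dot_comm, hfg]
  by_cases hdis : Disjoint (P.edge A) (P.edge j)
  · obtain ⟨δ, hδ, hd⟩ := Metric.exists_pos_forall_lt_edist (P.isCompact_edge A)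
      (P.isCompact_edge j).isClosed hdis
    have hδ' : (0 : ℝ) < δ := hδ
    refine ⟨δ / a, by positivity, fun q hq h0 h1 h2 => ?_⟩
    have h3 := hd _ ((h.mem_left _).2 ⟨_, h0, h1, rfl⟩) q hq
    rw [edist_dist, ENNReal.lt_ofReal_iff_toReal_lt (by simp), dist_eq_norm] at h3
    have e : v + dot f (q - v) • f - q = -(dot g (q - v) • g) := by
      have := orthonormal_decompose h.norm_left h.norm_right hfg (q - v)
      linear_combination -this
    rw [e, norm_neg, norm_smul, h.norm_right, mul_one, Real.norm_of_nonneg h2.le] at h3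
    have h4 : (δ : ℝ) < dot g (q - v) := h3
    rw [div_mul_eq_mul_div, div_le_iff₀ ha]
    nlinarith
  · obtain ⟨z, hzA, hzj⟩ := Set.not_disjoint_iff.1 hdis
    obtain ⟨k, rfl⟩ := P.exists_vertex_of_mem_edges hjA.symm hzA hzj
    have hk : P.vertices k = v + a • f := by
      obtain ⟨s, hs0, hsa, hs⟩ := (h.mem_left _).1 hzA
      rcases hs0.eq_or_lt with rfl | hs0
      · rw [zero_smul, add_zero] at hs
        rcases h.eq_or_eq (P.vertices k) (by rw [hs]; exact Metric.mem_ball_self hr) j hzj with h | h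
        · exact absurd h hjA
        · exact absurd h hjB
      · rcases hsa.eq_or_lt with rfl | hsa
        · exact hs
        · exact absurd ((h.mem_open_left _).2 ⟨s, hs0, hsa, hs⟩) (P.vertex_notMem_openEdge k A)
    obtain ⟨e, l, he, hl, hm, -⟩ := exists_unit_direction hzj
    have coord : ∀ (w : ℂ) (s : ℝ), dot w (P.vertices k + s • e - v) = a * dot w f + s * dot w e := by
      intro w s
      rw [hk, show v + a • f + s • e - v = a • f + s • e by ring, dot_add_right, dot_smul_right,
        dot_smul_right]
    by_cases h1 : 0 < dot g e
    · by_cases h2 : 0 ≤ dot f e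
      · refine ⟨1, one_pos, fun q hq _ _ h0 => ?_⟩
        obtain ⟨s, hs0, hsl, rfl⟩ := (hm q).1 hq
        rw [coord, hgf] at h0
        rw [coord, coord, dot_self, h.norm_left, hgf]
        nlinarith
      · push Not at h2
        refine ⟨dot g e / (-dot f e), div_pos h1 (neg_pos.2 h2), fun q hq _ _ _ => ?_⟩
        obtain ⟨s, hs0, hsl, rfl⟩ := (hm q).1 hq
        rw [coord, coord, hgf, dot_self, h.norm_left, div_mul_eq_mul_div,
          div_le_iff₀ (neg_pos.2 h2)]
        apply le_of_eq; ring
    · refine ⟨1, one_pos, fun q hq _ _ h0 => ?_⟩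
      obtain ⟨s, hs0, hsl, rfl⟩ := (hm q).1 hq
      rw [coord, hgf] at h0
      nlinarith

/-- A flight from `A` that crosses the line of `B` does so at height at least `r`, as otherwise it
would meet `B`. A flight that ends before that line is bounded by `exists_slope`, and its endpoint
is at distance at least `r` from the corner because it lies on a third edge. -/
theorem Corner.exists_arm_bound {A B : Fin n} {v f g : ℂ} {a b r : ℝ}
    (h : P.Corner A B v f g a b r) (hfg : dot f g = 0)
    (hin : ∀ z ∈ Metric.ball v r, 0 < dot f (z - v) → 0 < dot g (z - v) → z ∈ interior P.region)
    {j : Fin n} (hjA : j ≠ A) (hjB : j ≠ B) : ∃ c > 0,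
    ∀ p ∈ P.openEdge A, ∀ q ∈ P.edge j, P.FreeFlight p q → 0 < dot f (p - q) →
      c * dot f (p - q) ≤ dot g (q - p) ∧
      r * dot f (p - q) ≤ dot f (p - v) * (dot f (p - q) + dot g (q - p)) := by
  have hr := h.pos
  have ha : 0 < a := hr.trans_le h.le_left
  have hgf : dot g f = 0 := by rw [dot_comm, hfg]
  obtain ⟨c, hc, hslope⟩ := h.exists_slope hfg hjA hjB
  refine ⟨min c (r / a), by positivity, fun p hp q hq hpq hX => ?_⟩
  have hY := h.dot_pos hfg hin hp hpq
  obtain ⟨α, hα, hαa, rfl⟩ := (h.mem_open_left p).1 hp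
  have eα : dot f (v + α • f - v) = α := by
    rw [add_sub_cancel_left, dot_smul_right, dot_self, h.norm_left]; ring
  rw [eα]
  set X := dot f (v + α • f - q) with hXdef
  set Y := dot g (q - (v + α • f)) with hYdef
  have hF : dot f (q - v) = α - X := by
    rw [hXdef, show q - v = (v + α • f - v) - (v + α • f - q) by ring, dot_sub_right, eα]
  have hG : dot g (q - v) = Y := by
    rw [hYdef, show q - (v + α • f) = (q - v) - α • f by ring, dot_sub_right _ _ (α • f),
      dot_smul_right, hgf]
    ring
  rcases le_or_gt α X with hαX | hαX
  · -- the flight crosses the line of `B`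
    have hcr : r ≤ α * Y / X := by
      by_contra! hlt
      have hB : v + (α * Y / X) • g ∈ P.openEdge B :=
        (h.mem_open_right _).2 ⟨_, by positivity, by linarith [h.le_right], rfl⟩
      have e : v + (α * Y / X) • g = v + α • f + (α / X) • (q - (v + α • f)) := by
        have h1 := orthonormal_decompose h.norm_left h.norm_right hfg (q - (v + α • f))
        rw [← hYdef] at h1
        have h2 : dot f (q - (v + α • f)) = -X := by
          rw [hXdef, ← dot_neg_right, neg_sub]
        rw [h2] at h1
        rw [h1, smul_add, smul_smul, smul_smul, show α / X * -X = -α by field_simp,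
          show α / X * Y = α * Y / X by ring, neg_smul]
        ring
      rcases hαX.eq_or_lt with heq | hlt'
      · rw [show α / X = 1 by rw [← heq]; exact div_self hα.ne', one_smul, add_sub_cancel] at e
        rw [e] at hB
        exact hjB (P.eq_of_mem_openEdge hB hq).symm
      · exact P.notMem_interior_of_mem_openEdge hB
          (e ▸ hpq.mem (by positivity) ((div_lt_one hX).2 hlt'))
    rw [le_div_iff₀ hX] at hcr
    constructor
    · have : min c (r / a) * X ≤ r / a * X := mul_le_mul_of_nonneg_right (min_le_right _ _) hX.le
      refine this.trans ?_
      rw [div_mul_eq_mul_div, div_le_iff₀ ha]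
      nlinarith
    · nlinarith
  · constructor
    · have h1 := hslope q hq (by rw [hF]; linarith) (by rw [hF]; linarith) (by rw [hG]; exact hY)
      rw [hF, hG] at h1
      have : min c (r / a) * X ≤ c * X := mul_le_mul_of_nonneg_right (min_le_left _ _) hX.le
      nlinarith
    · have hq' : r ≤ ‖q - v‖ := by
        by_contra! hlt
        rcases h.eq_or_eq q (by rwa [Metric.mem_ball, dist_eq_norm]) j hq with h | h
        · exact hjA h
        · exact hjB h
      have hn : ‖q - v‖ ≤ (α - X) + Y := by
        have h1 := norm_sq_eq_of_orthonormal h.norm_left h.norm_right hfg (q - v)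
        rw [hF, hG] at h1
        apply le_of_sq_le_sq _ (by linarith)
        nlinarith [mul_pos (sub_pos.2 hαX) hY]
      -- the endpoint `q` satisfies `Y ≥ r - (α - X)`
      nlinarith [mul_pos hα hX, mul_pos (sub_pos.2 hαX) hY]

end PolygonalTable

namespace PolygonalTable

open Filter Topology

variable {n : ℕ} {P : PolygonalTable n}

/-- A flight out of an edge of a convex right-angled corner whose continuation backwards hits
neither of the two sides is not too flat, and does not start too close to the corner. -/
theorem Corner.exists_dir_bound {A B : Fin n} {v f g : ℂ} {a b r : ℝ}
    (h : P.Corner A B v f g a b r) (hfg : dot f g = 0)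
    (hin : ∀ z ∈ Metric.ball v r, 0 < dot f (z - v) → 0 < dot g (z - v) → z ∈ interior P.region)
    {j : Fin n} (hjA : j ≠ A) (hjB : j ≠ B) : ∃ c > 0,
    ∀ p ∈ P.openEdge A, ∀ y, P.FreeFlight p y → ∀ q ∈ P.edge j, P.FreeFlight p q →
      dir p q = -P.refl A (dir p y) → 0 < dot g (dir p y) ∧ (0 < dot f (dir p y) →
        c * dot f (dir p y) ≤ dot g (dir p y) ∧
        r * dot f (dir p y) ≤ dot f (p - v) * (dot f (dir p y) + dot g (dir p y))) := by
  obtain ⟨c, hc, H⟩ := h.exists_arm_bound hfg hin hjA hjB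
  refine ⟨c, hc, fun p hp y hpy q hq hpq hd => ?_⟩
  obtain ⟨κ, hκ, hκ'⟩ := h.exists_cross_leftVec hfg hin
  set u := dir p y with hu
  have hpos : 0 < ‖q - p‖ := norm_pos_iff.2 (sub_ne_zero.2 hpq.1.symm)
  have hpos' : 0 < ‖y - p‖ := norm_pos_iff.2 (sub_ne_zero.2 hpy.1.symm)
  have hf : dot f (P.refl A u) = dot f u := by
    obtain ⟨s, hs, hs'⟩ := h.vec_left
    have h1 := P.dot_edgeVec_refl A u
    rw [hs', dot_smul_left, dot_smul_left] at h1
    exact mul_left_cancel₀ hs h1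
  have hg : dot g (P.refl A u) = -dot g u := by
    have h1 := P.cross_leftVec_refl A u
    rw [hκ', hκ'] at h1
    apply mul_left_cancel₀ hκ.ne'
    rw [h1]; ring
  have e : q - p = ‖q - p‖ • -P.refl A u := by rw [← hd, norm_smul_dir]
  have e1 : dot f (p - q) = ‖q - p‖ * dot f u := by
    rw [← neg_sub, e, dot_neg_right, dot_smul_right, dot_neg_right, hf, ← e]; ring
  have e2 : dot g (q - p) = ‖q - p‖ * dot g u := by
    rw [e, dot_smul_right, dot_neg_right, hg, ← e]; ring
  refine ⟨?_, fun hfu => ?_⟩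
  · have := h.dot_pos hfg hin hp hpq
    rw [e2] at this
    exact pos_of_mul_pos_right this hpos.le
  · obtain ⟨h1, h2⟩ := H p hp q hq hpq (by rw [e1]; positivity)
    rw [e1, e2] at h1 h2
    constructor
    · nlinarith
    · nlinarith

/-! ### Limits of pairs of trajectories -/

theorem tendsto_cross {ι : Type*} {F : Filter ι} {x y : ι → ℂ} {a b : ℂ}
    (hx : Tendsto x F (𝓝 a)) (hy : Tendsto y F (𝓝 b)) :
    Tendsto (fun i => cross (x i) (y i)) F (𝓝 (cross a b)) := by
  have : Continuous fun z : ℂ × ℂ => cross z.1 z.2 := by fun_prop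
  exact (this.tendsto (a, b)).comp (hx.prodMk_nhds hy)

theorem tendsto_dot {ι : Type*} {F : Filter ι} {x y : ι → ℂ} {a b : ℂ}
    (hx : Tendsto x F (𝓝 a)) (hy : Tendsto y F (𝓝 b)) :
    Tendsto (fun i => dot (x i) (y i)) F (𝓝 (dot a b)) := by
  have : Continuous fun z : ℂ × ℂ => dot z.1 z.2 := by fun_prop
  exact (this.tendsto (a, b)).comp (hx.prodMk_nhds hy)

theorem exists_smul_edgeVec {i : Fin n} {y z : ℂ} (hy : y ∈ P.edge i) (hz : z ∈ P.edge i) :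
    ∃ t : ℝ, z - y = t • P.edgeVec i := by
  obtain ⟨s, -, -, rfl⟩ := P.mem_edge.1 hy
  obtain ⟨t, -, -, rfl⟩ := P.mem_edge.1 hz
  exact ⟨t - s, by rw [sub_smul]; ring⟩

theorem mem_openSegment_of_dot {i : Fin n} {x y p : ℂ} (hx : x ∈ P.edge i) (hy : y ∈ P.edge i)
    (hp : p ∈ P.edge i)
    (h : 0 < dot (P.edgeVec i) (p - x) * dot (P.edgeVec i) (y - p)) : p ∈ openSegment ℝ x y := by
  obtain ⟨s, hs⟩ := exists_smul_edgeVec hx hp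
  obtain ⟨t, ht⟩ := exists_smul_edgeVec hp hy
  have he : 0 < dot (P.edgeVec i) (P.edgeVec i) := by
    rw [dot_self]; have := P.edgeVec_ne_zero i; positivity
  rw [hs, ht, dot_smul_right, dot_smul_right] at h
  have hst : 0 < s * t := by
    by_contra! hn
    nlinarith [mul_pos he he]
  have hne : s + t ≠ 0 := by
    intro h0
    have : t = -s := by linarith
    subst this
    nlinarith [sq_nonneg s]
  have hq : 0 < s / (s + t) ∧ s / (s + t) < 1 := by
    rcases lt_or_gt_of_ne (show s ≠ 0 by rintro rfl; simp at hst) with h1 | h1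
    · have h2 : t < 0 := by nlinarith
      exact ⟨div_pos_of_neg_of_neg h1 (by linarith),
        (div_lt_one_of_neg (by linarith)).2 (by linarith)⟩
    · have h2 : 0 < t := pos_of_mul_pos_right hst h1.le
      exact ⟨by positivity, (div_lt_one (by linarith)).2 (by linarith)⟩
  rw [openSegment_eq_image']
  refine ⟨s / (s + t), hq, ?_⟩
  have e : y - x = (s + t) • P.edgeVec i := by rw [add_smul, ← hs, ← ht]; ring
  simp only
  rw [e, smul_smul, div_mul_cancel₀ _ hne, ← hs]; ring

/-- A point strictly between two limit points is strictly between the approximating points. -/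
theorem eventually_mem_openSegment {ι : Type*} {F : Filter ι} {i : Fin n} {x y : ι → ℂ} {a b p : ℂ}
    (hx : Tendsto x F (𝓝 a)) (hy : Tendsto y F (𝓝 b)) (hxi : ∀ᶠ j in F, x j ∈ P.edge i)
    (hyi : ∀ᶠ j in F, y j ∈ P.edge i) (ha : a ∈ P.edge i) (hb : b ∈ P.edge i) (hab : a ≠ b)
    (hp : p ∈ openSegment ℝ a b) : ∀ᶠ j in F, p ∈ openSegment ℝ (x j) (y j) := by
  have hpi : p ∈ P.edge i := (P.convex_edge i).segment_subset ha hb (openSegment_subset_segment _ _ _ hp)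
  have hlim : Tendsto (fun j => dot (P.edgeVec i) (p - x j) * dot (P.edgeVec i) (y j - p)) F
      (𝓝 (dot (P.edgeVec i) (p - a) * dot (P.edgeVec i) (b - p))) :=
    (tendsto_dot tendsto_const_nhds (tendsto_const_nhds.sub hx)).mul
      (tendsto_dot tendsto_const_nhds (hy.sub tendsto_const_nhds))
  have hpos : 0 < dot (P.edgeVec i) (p - a) * dot (P.edgeVec i) (b - p) := by
    rw [openSegment_eq_image'] at hp
    obtain ⟨t, ⟨h0, h1⟩, rfl⟩ := hp
    obtain ⟨s, hs⟩ := exists_smul_edgeVec ha hb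
    have hs0 : s ≠ 0 := by
      rintro rfl
      rw [zero_smul, sub_eq_zero] at hs
      exact hab hs.symm
    have he : 0 < dot (P.edgeVec i) (P.edgeVec i) := by
      rw [dot_self]; have := P.edgeVec_ne_zero i; positivity
    have e1 : a + t • (b - a) - a = t • (b - a) := by ring
    have e2 : b - (a + t • (b - a)) = (1 - t) • (b - a) := by
      rw [sub_smul, one_smul]; ring
    simp only
    rw [e1, e2, hs]
    simp only [dot_smul_right]
    have : 0 < s ^ 2 := by positivity
    have h2 : 0 < t * (1 - t) := mul_pos h0 (by linarith)
    have := mul_pos (mul_pos this h2) (mul_pos he he)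
    linarith
  filter_upwards [hlim.eventually (lt_mem_nhds hpos), hxi, hyi] with j h1 h2 h3
  exact mem_openSegment_of_dot h2 h3 hpi h1

theorem mem_openEdge_of_openSegment {i : Fin n} {x y p : ℂ} (hx : x ∈ P.edge i) (hy : y ∈ P.edge i)
    (hxy : x ≠ y) (hp : p ∈ openSegment ℝ x y) : p ∈ P.openEdge i := by
  obtain ⟨s, hs0, hs1, rfl⟩ := P.mem_edge.1 hx
  obtain ⟨t, ht0, ht1, rfl⟩ := P.mem_edge.1 hy
  obtain ⟨l, m, hl, hm, hlm, rfl⟩ := hp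
  have hst : s ≠ t := fun h => hxy (by rw [h])
  have hm' : m = 1 - l := by linarith
  subst hm'
  refine P.mem_openEdge.2 ⟨l * s + (1 - l) * t, ?_, ?_, ?_⟩
  · rcases lt_or_gt_of_ne hst with h | h <;> nlinarith
  · rcases lt_or_gt_of_ne hst with h | h <;> nlinarith
  · simp only [smul_add, smul_smul, add_smul, sub_smul, one_smul, sub_mul]
    simp; ring

section Limit

variable {D : ℕ → Fin n} {X Y : ℕ → ℕ → ℂ} {a b : ℕ → ℂ} {d₀ ν₀ : ℂ} {F : Filter ℕ}

/-- A single ultrafilter makes all hits converge simultaneously, with no diagonal subsequence. -/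
theorem exists_limit (F : Ultrafilter ℕ) (hF : (F : Filter ℕ) ≤ atTop)
    (hX : ∀ N, P.Follows D N (X N)) :
    ∃ a : ℕ → ℂ, ∀ k, Tendsto (fun N => X N k) F (𝓝 (a k)) := by
  have : ∀ k, ∃ a, Tendsto (fun N => X N k) F (𝓝 a) := by
    intro k
    have hmem : ∀ᶠ N in (F : Filter ℕ), X N k ∈ P.region := by
      filter_upwards [hF (eventually_gt_atTop k)] with N hN
      exact ((hX N) k hN).1.left_mem_region
    obtain ⟨a, -, ha⟩ := P.region_compact.ultrafilter_le_nhds (F.map fun N => X N k)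
      (le_principal_iff.2 hmem)
    exact ⟨a, ha⟩
  choose a ha using this
  exact ⟨a, ha⟩

/-- The linear part of the unfolding, inverted. -/
noncomputable def unframe (P : PolygonalTable n) (D : ℕ → Fin n) (z : ℂ) (k : ℕ) : ℂ :=
  (P.frame D k).symm z

theorem unframe_zero (z : ℂ) : P.unframe D z 0 = z := rfl

theorem unframe_succ (z : ℂ) (k : ℕ) :
    P.unframe D z (k + 1) = P.refl (D k) (P.unframe D z k) := by
  apply (P.frame D (k + 1)).injective
  rw [P.frame_succ D k (P.refl _ _), refl_refl, unframe, unframe,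
    LinearIsometryEquiv.apply_symm_apply, LinearIsometryEquiv.apply_symm_apply]

theorem norm_unframe (z : ℂ) (k : ℕ) : ‖P.unframe D z k‖ = ‖z‖ := by
  rw [unframe, LinearIsometryEquiv.norm_map]

theorem dot_unframe (y z : ℂ) (k : ℕ) : dot (P.unframe D y k) (P.unframe D z k) = dot y z := by
  induction k with
  | zero => rfl
  | succ k ih => rw [unframe_succ, unframe_succ, dot_refl_refl, ih]

/-- With a fixed code, the `k`-th direction is the image of the first under a fixed isometry. -/
theorem tendsto_dir (hF : F ≤ atTop) (hX : ∀ N, P.Follows D N (X N))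
    (hd : Tendsto (fun N => dir (X N 0) (X N 1)) F (𝓝 d₀)) (k : ℕ) :
    Tendsto (fun N => dir (X N k) (X N (k + 1))) F (𝓝 (P.unframe D d₀ k)) := by
  have h1 : Tendsto (fun N => (P.frame D k).symm (dir (X N 0) (X N 1))) F
      (𝓝 (P.unframe D d₀ k)) :=
    ((P.frame D k).symm.continuous.tendsto d₀).comp hd
  refine h1.congr' ?_
  filter_upwards [hF (eventually_gt_atTop k)] with N hN
  rw [← (hX N).frame_dir hN, LinearIsometryEquiv.symm_apply_apply]

/-- Consecutive limit points may coincide at a vertex, so the limit flight is described by a length,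
possibly zero, along the limit direction. -/
theorem limit_succ [NeBot F] (hF : F ≤ atTop) (hX : ∀ N, P.Follows D N (X N))
    (ha : ∀ k, Tendsto (fun N => X N k) F (𝓝 (a k)))
    (hd : Tendsto (fun N => dir (X N 0) (X N 1)) F (𝓝 d₀)) (k : ℕ) :
    a (k + 1) = a k + ‖a (k + 1) - a k‖ • P.unframe D d₀ k := by
  have h1 : Tendsto (fun N => X N k + ‖X N (k + 1) - X N k‖ • dir (X N k) (X N (k + 1))) F
      (𝓝 (a k + ‖a (k + 1) - a k‖ • P.unframe D d₀ k)) :=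
    (ha k).add (((ha (k + 1)).sub (ha k)).norm.smul (tendsto_dir hF hX hd k))
  refine tendsto_nhds_unique (ha (k + 1)) (h1.congr fun N => ?_)
  rw [norm_smul_dir]; ring

theorem eventually_mem (hF : F ≤ atTop) (hX : ∀ N, P.Follows D N (X N)) (k : ℕ) :
    ∀ᶠ N in F, X N (k + 1) ∈ P.openEdge (D k) := by
  filter_upwards [hF (eventually_gt_atTop k)] with N hN
  exact (hX N).mem hN

theorem limit_mem [NeBot F] (hF : F ≤ atTop) (hX : ∀ N, P.Follows D N (X N))
    (ha : ∀ k, Tendsto (fun N => X N k) F (𝓝 (a k))) (k : ℕ) : a (k + 1) ∈ P.edge (D k) :=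
  (P.isCompact_edge _).isClosed.mem_of_tendsto (ha (k + 1))
    ((eventually_mem hF hX k).mono fun _ h => P.openEdge_subset_edge _ h)

/-- Flights move along the common direction, and the reflection in the common edge fixes the
difference of two hits, so the transverse distance is conserved. -/
theorem offset_eq (hdν : dot d₀ ν₀ = 0) (ha : ∀ k, a (k + 1) ∈ P.edge (D k))
    (hb : ∀ k, b (k + 1) ∈ P.edge (D k))
    (hda : ∀ k, a (k + 1) = a k + ‖a (k + 1) - a k‖ • P.unframe D d₀ k)
    (hdb : ∀ k, b (k + 1) = b k + ‖b (k + 1) - b k‖ • P.unframe D d₀ k) (k : ℕ) :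
    dot (P.unframe D ν₀ k) (a k - b k) = dot ν₀ (a 0 - b 0) ∧
    dot (P.unframe D ν₀ k) (a (k + 1) - b (k + 1)) = dot ν₀ (a 0 - b 0) := by
  have step : ∀ k, dot (P.unframe D ν₀ k) (a (k + 1) - b (k + 1)) =
      dot (P.unframe D ν₀ k) (a k - b k) := by
    intro k
    have h0 : dot (P.unframe D ν₀ k) (P.unframe D d₀ k) = 0 := by
      rw [dot_unframe, dot_comm, hdν]
    rw [hda k, hdb k]
    simp only [dot_sub_right, dot_add_right, dot_smul_right, h0]
    ring
  have main : ∀ k, dot (P.unframe D ν₀ k) (a k - b k) = dot ν₀ (a 0 - b 0) := by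
    intro k
    induction k with
    | zero => rfl
    | succ k ih =>
      rw [unframe_succ, ← P.refl_sub_of_mem (ha k) (hb k), dot_refl_refl, step, ih]
  exact ⟨main k, (step k).trans (main k)⟩

end Limit

end PolygonalTable

/-! ### Flights between two limit trajectories -/

namespace PolygonalTable

open Filter Topology

variable {n : ℕ} {P : PolygonalTable n}

/-- A flight out of a convex right-angled corner, between two flights out of its two sides that end
on the same edge. -/
theorem Corner.freeFlight_of_vertex {A B j : Fin n} {v f g : ℂ} {a b r : ℝ}
    (h : P.Corner A B v f g a b r) (hfg : dot f g = 0)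
    (hin : ∀ z ∈ Metric.ball v r, 0 < dot f (z - v) → 0 < dot g (z - v) → z ∈ interior P.region)
    {x y x' y' d : ℂ} {l τ : ℝ} (hx : x ∈ P.openEdge A) (hy : y ∈ P.openEdge B)
    (hx' : x' ∈ P.openEdge j) (hy' : y' ∈ P.openEdge j) (fx : P.FreeFlight x x')
    (fy : P.FreeFlight y y') (hd : ‖d‖ = 1) (hdf : 0 < dot f d) (hdg : 0 < dot g d) (hl : 0 < l)
    (hz : v + l • d ∈ P.openEdge j) (hj : 0 < P.depth j v)
    (h₁ : 0 < cross ((-τ) • (x' - x)) (v - x)) (h₂ : 0 < cross ((-τ) • (x' - x)) (v + l • d - x))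
    (h₃ : 0 < cross ((-τ) • (x' - x)) (y' - x)) (h₄ : 0 < cross (τ • (y' - y)) (v - y))
    (h₅ : 0 < cross (τ • (y' - y)) (v + l • d - y)) (h₆ : 0 < cross (τ • (y' - y)) (x' - y)) :
    P.FreeFlight v (v + l • d) := by
  have hr := h.pos
  have hgf : dot g f = 0 := by rw [dot_comm, hfg]
  obtain ⟨κ, hκ, hA⟩ := h.exists_cross_leftVec hfg hin
  obtain ⟨κ', hκ', hB⟩ := h.symm.exists_cross_leftVec hgf (fun z hz h1 h2 => hin z hz h2 h1)
  have hxy : x' ≠ y' := by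
    rintro rfl
    rw [cross_smul_left, cross_self, mul_zero] at h₃
    exact h₃.false
  have hne : v ≠ v + l • d := by
    intro he
    have : l • d = 0 := by linear_combination -he
    rcases smul_eq_zero.1 this with h0 | h0
    · exact hl.ne' h0
    · rw [h0, norm_zero] at hd; exact zero_ne_one hd
  -- The cell is the pentagon bounded by the two sides at `v`, the two given flights and the edge
  -- `j`; the flights have opposite orientations as seen from inside, whence the signs of `τ`.
  set p : Fin 5 → ℂ := ![P.leftVec A, P.leftVec B, P.leftVec j, (-τ) • (x' - x), τ • (y' - y)]
    with hp
  set q : Fin 5 → ℂ := ![v, v, P.vertices j, x, y] with hq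
  have pos : ∀ s, 0 < s → s < l → ∀ i, 0 < cross (p i) (v + s • d - q i) := by
    intro s hs hsl i
    have hm : v + s • d ∈ openSegment ℝ v (v + l • d) := by
      rw [openSegment_eq_image']
      refine ⟨s / l, ⟨by positivity, (div_lt_one hl).2 hsl⟩, ?_⟩
      simp only
      rw [add_sub_cancel_left, smul_smul, div_mul_cancel₀ _ hl.ne']
    fin_cases i
    · show 0 < cross (P.leftVec A) (v + s • d - v)
      rw [hA, add_sub_cancel_left, dot_smul_right]; positivity
    · show 0 < cross (P.leftVec B) (v + s • d - v)
      rw [hB, add_sub_cancel_left, dot_smul_right]; positivity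
    · exact cross_pos_of_mem_openSegment hm hj.le
        (P.depth_eq_zero (P.openEdge_subset_edge _ hz)).ge (Or.inl hj)
    · exact cross_pos_of_mem_openSegment hm h₁.le h₂.le (Or.inl h₁)
    · exact cross_pos_of_mem_openSegment hm h₄.le h₅.le (Or.inl h₄)
  -- On a side of the corner, the half-plane of the flight leaving it at `x` cuts off everything
  -- beyond `x`.
  have side : ∀ {x x' f : ℂ} {t α : ℝ}, 0 < α → x = v + α • f →
      0 < cross (t • (x' - x)) (v - x) → ∀ s : ℝ, 0 ≤ cross (t • (x' - x)) (v + s • f - x) →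
      s ≤ α := by
    intro x x' f t α hα hx h0 s hs
    have e1 : v - x = (-α) • f := by rw [hx, neg_smul]; ring
    have e2 : v + s • f - x = (s - α) • f := by rw [hx, sub_smul]; ring
    rw [e1, cross_smul_right] at h0
    rw [e2, cross_smul_right] at hs
    by_contra! hlt
    nlinarith
  obtain ⟨α, hα, hαa, hxα⟩ := (h.mem_open_left x).1 hx
  obtain ⟨β, hβ, hβb, hyβ⟩ := (h.mem_open_right y).1 hy
  have dotA : ∀ (s : ℝ), dot g (v + s • f - v) = 0 := fun s => by
    rw [add_sub_cancel_left, dot_smul_right, hgf, mul_zero]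
  have dotB : ∀ (s : ℝ), dot f (v + s • g - v) = 0 := fun s => by
    rw [add_sub_cancel_left, dot_smul_right, hfg, mul_zero]
  have gx' : 0 < cross (P.leftVec A) (x' - v) := by
    rw [hA]
    have h1 := h.dot_pos hfg hin hx fx
    have h2 := dotA α
    rw [show x' - v = (x' - x) + (x - v) by ring, dot_add_right, hxα, h2, ← hxα]
    positivity
  have fy' : 0 < cross (P.leftVec B) (y' - v) := by
    rw [hB]
    have h1 := h.symm.dot_pos hgf (fun z hz h1 h2 => hin z hz h2 h1) hy fy
    have h2 := dotB β
    rw [show y' - v = (y' - y) + (y - v) by ring, dot_add_right, hyβ, h2, ← hyβ]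
    positivity
  -- The interior point required by the cell criterion is taken on the ray itself, close enough to
  -- `v` to lie in the local quadrant.
  have sub := P.halfplanes_subset_interior p q {A, B, j} ⟨A, by simp⟩ ?_ ?_
    (m := v + (min (r / 2) (l / 2)) • d) ?_ (fun i => (pos _ ?_ ?_ i).le)
    (w := v + (l / 2) • d) (pos _ (by positivity) (by linarith))
  · refine freeFlight_of_forall hne fun t h0 h1 => sub fun i => ?_
    rw [add_sub_cancel_left, smul_smul]
    exact pos _ (by positivity) (by nlinarith) i
  · rintro k (rfl | rfl | rfl)
    · refine ⟨0, fun z hz => le_of_eq ?_⟩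
      obtain ⟨s, -, -, rfl⟩ := (h.mem_left z).1 hz
      show cross (P.leftVec k) (v + s • f - v) = 0
      rw [hA, dotA, mul_zero]
    · refine ⟨1, fun z hz => le_of_eq ?_⟩
      obtain ⟨s, -, -, rfl⟩ := (h.mem_right z).1 hz
      show cross (P.leftVec k) (v + s • g - v) = 0
      rw [hB, dotB, mul_zero]
    · exact ⟨2, fun z hz => (P.depth_eq_zero hz).le⟩
  · rintro z hz ⟨i, hi⟩ k hk
    have z0 : 0 ≤ cross (P.leftVec A) (z - v) := hz 0
    have z1 : 0 ≤ cross (P.leftVec B) (z - v) := hz 1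
    have z2 : 0 ≤ cross (P.leftVec j) (z - P.vertices j) := hz 2
    have z3 : 0 ≤ cross ((-τ) • (x' - x)) (z - x) := hz 3
    have z4 : 0 ≤ cross (τ • (y' - y)) (z - y) := hz 4
    have zf : 0 ≤ dot f (z - v) := by rw [hB] at z1; exact nonneg_of_mul_nonneg_right z1 hκ'
    have zg : 0 ≤ dot g (z - v) := by rw [hA] at z0; exact nonneg_of_mul_nonneg_right z0 hκ
    have zdec := orthonormal_decompose h.norm_left h.norm_right hfg (z - v)
    have hv : z = v → k ∈ ({A, B, j} : Set (Fin n)) := by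
      rintro rfl
      rcases h.eq_or_eq _ (Metric.mem_ball_self hr) k hk with h | h <;> simp [h]
    have hτ : τ ≠ 0 := by
      rintro rfl
      rw [cross_smul_left, zero_mul] at h₄
      exact h₄.false
    fin_cases i
    · have hi' : cross (P.leftVec A) (z - v) = 0 := hi
      rw [hA] at hi'
      have hg0 : dot g (z - v) = 0 := (mul_eq_zero.1 hi').resolve_left hκ.ne'
      have ez : z = v + dot f (z - v) • f := by
        rw [hg0, zero_smul, add_zero] at zdec
        linear_combination zdec
      rcases zf.eq_or_lt with h0 | h0
      · exact hv (by rw [← h0, zero_smul, add_zero] at ez; exact ez)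
      · have := side hα hxα h₁ (dot f (z - v)) (by rw [← ez]; exact z3)
        have := P.eq_of_mem_openEdge ((h.mem_open_left z).2 ⟨_, h0, by linarith, ez⟩) hk
        simp [this]
    · have hi' : cross (P.leftVec B) (z - v) = 0 := hi
      rw [hB] at hi'
      have hf0 : dot f (z - v) = 0 := (mul_eq_zero.1 hi').resolve_left hκ'.ne'
      have ez : z = v + dot g (z - v) • g := by
        rw [hf0, zero_smul, zero_add] at zdec
        linear_combination zdec
      rcases zg.eq_or_lt with h0 | h0
      · exact hv (by rw [← h0, zero_smul, add_zero] at ez; exact ez)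
      · have := side hβ hyβ h₄ (dot g (z - v)) (by rw [← ez]; exact z4)
        have := P.eq_of_mem_openEdge ((h.mem_open_right z).2 ⟨_, h0, by linarith, ez⟩) hk
        simp [this]
    · have hi' : cross (P.leftVec j) (z - P.vertices j) = 0 := hi
      have hx0 : cross (P.leftVec j) (x' - P.vertices j) = 0 :=
        P.depth_eq_zero (P.openEdge_subset_edge _ hx')
      have hy0 := cross_leftVec_sub (P.openEdge_subset_edge _ hy') (P.openEdge_subset_edge _ hx')
      have hzx : cross (P.leftVec j) (z - x') = 0 := by
        rw [← sub_sub_sub_cancel_right z x' (P.vertices j), cross_sub_right, hi', hx0, sub_zero]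
      obtain ⟨s, hs⟩ := exists_smul_of_cross_eq_zero (P.leftVec_ne_zero j) hy0
      obtain ⟨t, ht⟩ := exists_smul_of_cross_eq_zero (P.leftVec_ne_zero j) hzx
      have hseg : z ∈ segment ℝ x' y' := mem_segment_of_cross hxy
        (by rw [hs, ht, cross_smul_left, cross_smul_right, cross_self]; ring)
        (by rw [cross_smul_left, cross_self, mul_zero]) h₃ z3
        (by rw [cross_smul_left, cross_self, mul_zero]) h₆ z4
      have := P.eq_of_mem_openEdge ((convex_openSegment _ _).segment_subset hx' hy' hseg) hk
      simp [this]
    · have hi' : cross ((-τ) • (x' - x)) (z - x) = 0 := hi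
      rw [cross_smul_left] at hi'
      have hseg : z ∈ segment ℝ x x' := mem_segment_of_cross fx.1
        ((mul_eq_zero.1 hi').resolve_left (neg_ne_zero.2 hτ))
        (by rw [hA, hxα, dotA, mul_zero]) gx' z0
        (P.depth_eq_zero (P.openEdge_subset_edge _ hx')) (fx.symm.depth_pos hx') z2
      rcases fx.edge_of_mem_segment hx hx' hseg hk with h | h <;> simp [h]
    · have hi' : cross (τ • (y' - y)) (z - y) = 0 := hi
      rw [cross_smul_left] at hi'
      have hseg : z ∈ segment ℝ y y' := mem_segment_of_cross fy.1
        ((mul_eq_zero.1 hi').resolve_left hτ)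
        (by rw [hB, hyβ, dotB, mul_zero]) fy' z1
        (P.depth_eq_zero (P.openEdge_subset_edge _ hy')) (fy.symm.depth_pos hy') z2
      rcases fy.edge_of_mem_segment hy hy' hseg hk with h | h <;> simp [h]
  · have hs : 0 < min (r / 2) (l / 2) := lt_min (by positivity) (by positivity)
    apply hin
    · rw [Metric.mem_ball, dist_eq_norm, add_sub_cancel_left, norm_smul, hd, mul_one,
        Real.norm_of_nonneg hs.le]
      linarith [min_le_left (r / 2) (l / 2)]
    · rw [add_sub_cancel_left, dot_smul_right]; positivity
    · rw [add_sub_cancel_left, dot_smul_right]; positivity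
  · exact lt_min (by positivity) (by positivity)
  · linarith [min_le_right (r / 2) (l / 2)]

/-- Two sequences of longer and longer trajectories with the same code, converging to parallel
trajectories at a positive distance. -/
structure LimitPair (P : PolygonalTable n) (D : ℕ → Fin n) (F : Filter ℕ) (X Y : ℕ → ℕ → ℂ)
    (a b : ℕ → ℂ) (d₀ ν₀ : ℂ) : Prop where
  neBot : NeBot F
  le : F ≤ atTop
  left : ∀ N, P.Follows D N (X N)
  right : ∀ N, P.Follows D N (Y N)
  tendsto_left : ∀ k, Tendsto (fun N => X N k) F (𝓝 (a k))
  tendsto_right : ∀ k, Tendsto (fun N => Y N k) F (𝓝 (b k))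
  dir_left : Tendsto (fun N => dir (X N 0) (X N 1)) F (𝓝 d₀)
  dir_right : Tendsto (fun N => dir (Y N 0) (Y N 1)) F (𝓝 d₀)
  norm_dir : ‖d₀‖ = 1
  norm_normal : ‖ν₀‖ = 1
  dot_eq_zero : dot d₀ ν₀ = 0
  pos : 0 < dot ν₀ (a 0 - b 0)

namespace LimitPair

variable {D : ℕ → Fin n} {F : Filter ℕ} {X Y : ℕ → ℕ → ℂ} {a b : ℕ → ℂ} {d₀ ν₀ : ℂ}

/-- The points on the parallels between the two limit trajectories. -/
noncomputable def mid (a b : ℕ → ℂ) (s : ℝ) (k : ℕ) : ℂ := b k + s • (a k - b k)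

theorem mid_sub (s t : ℝ) (k : ℕ) : mid a b s k - mid a b t k = (s - t) • (a k - b k) := by
  rw [mid, mid, sub_smul]; ring

theorem mid_mem_openSegment {s : ℝ} (h0 : 0 < s) (h1 : s < 1) (k : ℕ) :
    mid a b s k ∈ openSegment ℝ (a k) (b k) := by
  rw [openSegment_symm, openSegment_eq_image']
  exact ⟨s, ⟨h0, h1⟩, rfl⟩

theorem left_mem (h : LimitPair P D F X Y a b d₀ ν₀) (k : ℕ) : a (k + 1) ∈ P.edge (D k) :=
  haveI := h.neBot
  limit_mem h.le h.left h.tendsto_left k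

theorem right_mem (h : LimitPair P D F X Y a b d₀ ν₀) (k : ℕ) : b (k + 1) ∈ P.edge (D k) :=
  haveI := h.neBot
  limit_mem h.le h.right h.tendsto_right k

theorem left_succ (h : LimitPair P D F X Y a b d₀ ν₀) (k : ℕ) :
    a (k + 1) = a k + ‖a (k + 1) - a k‖ • P.unframe D d₀ k :=
  haveI := h.neBot
  limit_succ h.le h.left h.tendsto_left h.dir_left k

theorem right_succ (h : LimitPair P D F X Y a b d₀ ν₀) (k : ℕ) :
    b (k + 1) = b k + ‖b (k + 1) - b k‖ • P.unframe D d₀ k :=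
  haveI := h.neBot
  limit_succ h.le h.right h.tendsto_right h.dir_right k

theorem offset (h : LimitPair P D F X Y a b d₀ ν₀) (k : ℕ) :
    dot (P.unframe D ν₀ k) (a k - b k) = dot ν₀ (a 0 - b 0) ∧
    dot (P.unframe D ν₀ k) (a (k + 1) - b (k + 1)) = dot ν₀ (a 0 - b 0) :=
  offset_eq h.dot_eq_zero h.left_mem h.right_mem h.left_succ h.right_succ k

theorem ne (h : LimitPair P D F X Y a b d₀ ν₀) (k : ℕ) : a k ≠ b k := by
  intro he
  have h1 := (h.offset k).1
  rw [he, sub_self] at h1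
  have h2 := h.pos
  rw [← h1] at h2
  simp [dot] at h2

/-- The limit points may be vertices, but a point strictly between two distinct points of an edge is
not. -/
theorem mid_mem (h : LimitPair P D F X Y a b d₀ ν₀) {s : ℝ} (h0 : 0 < s) (h1 : s < 1) (k : ℕ) :
    mid a b s (k + 1) ∈ P.openEdge (D k) :=
  mem_openEdge_of_openSegment (h.left_mem k) (h.right_mem k) (h.ne _) (mid_mem_openSegment h0 h1 _)

theorem mid_succ (h : LimitPair P D F X Y a b d₀ ν₀) (s : ℝ) (k : ℕ) :
    mid a b s (k + 1) = mid a b s k +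
      ((1 - s) * ‖b (k + 1) - b k‖ + s * ‖a (k + 1) - a k‖) • P.unframe D d₀ k := by
  have h1 := h.left_succ k
  have h2 := h.right_succ k
  generalize ‖a (k + 1) - a k‖ = l at *
  generalize ‖b (k + 1) - b k‖ = m at *
  rw [mid, mid, h1, h2]
  simp only [smul_add, smul_sub, add_smul, sub_smul, smul_smul, sub_mul, one_mul]
  ring

theorem code_ne (h : LimitPair P D F X Y a b d₀ ν₀) (k : ℕ) : D k ≠ D (k + 1) :=
  (h.left (k + 2)).ne_succ (by omega)

theorem mid_ne (h : LimitPair P D F X Y a b d₀ ν₀) {s : ℝ} (h0 : 0 < s) (h1 : s < 1) (k : ℕ) :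
    mid a b s (k + 1) ≠ mid a b s (k + 2) := by
  intro he
  have h2 := h.mid_mem h0 h1 k
  rw [he] at h2
  exact h.code_ne k (P.eq_of_mem_openEdge h2 (P.openEdge_subset_edge _ (h.mid_mem h0 h1 (k + 1))))

theorem dist_pos (h : LimitPair P D F X Y a b d₀ ν₀) {s : ℝ} (h0 : 0 < s) (h1 : s < 1) (k : ℕ) :
    0 < (1 - s) * ‖b (k + 2) - b (k + 1)‖ + s * ‖a (k + 2) - a (k + 1)‖ := by
  have h2 := mul_nonneg (sub_nonneg.2 h1.le) (norm_nonneg (b (k + 2) - b (k + 1)))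
  have h3 := mul_nonneg h0.le (norm_nonneg (a (k + 2) - a (k + 1)))
  refine (add_nonneg h2 h3).lt_of_ne fun he => h.mid_ne h0 h1 k ?_
  rw [h.mid_succ s (k + 1), ← he, zero_smul, add_zero]

theorem cross_unframe (h : LimitPair P D F X Y a b d₀ ν₀) (k : ℕ) (z : ℂ) :
    cross (P.unframe D d₀ k) z =
      cross (P.unframe D d₀ k) (P.unframe D ν₀ k) * dot (P.unframe D ν₀ k) z :=
  cross_eq_mul_dot (by rw [norm_unframe, h.norm_dir]) (by rw [norm_unframe, h.norm_normal])
    (by rw [dot_unframe, h.dot_eq_zero]) z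

theorem cross_sq (h : LimitPair P D F X Y a b d₀ ν₀) (k : ℕ) :
    cross (P.unframe D d₀ k) (P.unframe D ν₀ k) ^ 2 = 1 :=
  cross_sq_eq_one (by rw [norm_unframe, h.norm_dir]) (by rw [norm_unframe, h.norm_normal])
    (by rw [dot_unframe, h.dot_eq_zero])

/-- Approximate flight directions detect the side of a limit trajectory. -/
theorem eventually_pos {k : ℕ} {x x' y : ℕ → ℂ} {c z : ℂ} {t : ℝ}
    (h : LimitPair P D F X Y a b d₀ ν₀) (hx : Tendsto x F (𝓝 c)) (hy : Tendsto y F (𝓝 z))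
    (hne : ∀ᶠ N in F, x N ≠ x' N)
    (hd : Tendsto (fun N => dir (x N) (x' N)) F (𝓝 (P.unframe D d₀ k)))
    (hpos : 0 < t * dot (P.unframe D ν₀ k) (z - c)) :
    ∀ᶠ N in F, 0 < cross ((t * cross (P.unframe D d₀ k) (P.unframe D ν₀ k)) • (x' N - x N))
      (y N - x N) := by
  have hlim := (tendsto_cross hd (hy.sub hx)).const_mul
    (t * cross (P.unframe D d₀ k) (P.unframe D ν₀ k))
  have e : t * cross (P.unframe D d₀ k) (P.unframe D ν₀ k) * cross (P.unframe D d₀ k) (z - c) =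
      t * dot (P.unframe D ν₀ k) (z - c) := by
    rw [h.cross_unframe k (z - c)]
    linear_combination t * dot (P.unframe D ν₀ k) (z - c) * h.cross_sq k
  rw [e] at hlim
  filter_upwards [hlim.eventually (lt_mem_nhds hpos), hne] with N h1 h2
  have h3 : 0 < ‖x' N - x N‖ := norm_pos_iff.2 (sub_ne_zero.2 h2.symm)
  rw [← norm_smul_dir (x N) (x' N), cross_smul_left, cross_smul_left]
  calc (0 : ℝ) < ‖x' N - x N‖ * _ := mul_pos h3 h1
    _ = _ := by ring

theorem eventually_freeFlight_left (h : LimitPair P D F X Y a b d₀ ν₀) (k : ℕ) :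
    ∀ᶠ N in F, P.FreeFlight (X N k) (X N (k + 1)) := by
  filter_upwards [h.le (eventually_gt_atTop k)] with N hN
  exact (h.left N k hN).1

theorem eventually_freeFlight_right (h : LimitPair P D F X Y a b d₀ ν₀) (k : ℕ) :
    ∀ᶠ N in F, P.FreeFlight (Y N k) (Y N (k + 1)) := by
  filter_upwards [h.le (eventually_gt_atTop k)] with N hN
  exact (h.right N k hN).1

/-- The limit flights may touch the boundary, so they cannot bound a cell. For large `N` the
approximating flights are free, and the positive transverse offset puts the middle chord strictly
between them; `freeFlight_of_between` applies. -/
theorem freeFlight_mid (h : LimitPair P D F X Y a b d₀ ν₀) {s : ℝ} (h0 : 0 < s) (h1 : s < 1)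
    (k : ℕ) : P.FreeFlight (mid a b s (k + 1)) (mid a b s (k + 2)) := by
  have := h.neBot
  set d := P.unframe D d₀ (k + 1) with hd
  set ν := P.unframe D ν₀ (k + 1) with hν
  have o1 := (h.offset (k + 1)).1
  have o2 := (h.offset (k + 1)).2
  rw [← hν] at o1 o2
  have hω := h.pos
  have hdν : dot ν d = 0 := by rw [hd, hν, dot_unframe, dot_comm, h.dot_eq_zero]
  have o3 : dot ν (b (k + 2) - a (k + 1)) = -dot ν₀ (a 0 - b 0) := by
    rw [show b (k + 2) = _ from h.right_succ (k + 1), ← hd,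
      show ∀ t : ℂ, b (k + 1) + t - a (k + 1) = t - (a (k + 1) - b (k + 1)) by intro t; ring,
      dot_sub_right, dot_smul_right, hdν, o1]; ring
  have o4 : dot ν (a (k + 2) - b (k + 1)) = dot ν₀ (a 0 - b 0) := by
    rw [show a (k + 2) = _ from h.left_succ (k + 1), ← hd,
      show ∀ t : ℂ, a (k + 1) + t - b (k + 1) = t + (a (k + 1) - b (k + 1)) by intro t; ring,
      dot_add_right, dot_smul_right, hdν, o1]; ring
  have neX := (h.eventually_freeFlight_left (k + 1)).mono fun N hN => hN.1
  have neY := (h.eventually_freeFlight_right (k + 1)).mono fun N hN => hN.1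
  have dX := tendsto_dir h.le h.left h.dir_left (k + 1)
  have dY := tendsto_dir h.le h.right h.dir_right (k + 1)
  have e1 := h.eventually_pos (t := -1) (h.tendsto_left (k + 1)) (h.tendsto_right (k + 1)) neX dX
    (by rw [← hν, ← neg_sub, dot_neg_right, o1]; linarith)
  have e2 := h.eventually_pos (t := -1) (h.tendsto_left (k + 1)) (h.tendsto_right (k + 2)) neX dX
    (by rw [← hν, o3]; linarith)
  have e3 := h.eventually_pos (t := 1) (h.tendsto_right (k + 1)) (h.tendsto_left (k + 1)) neY dY
    (by rw [← hν, o1]; linarith)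
  have e4 := h.eventually_pos (t := 1) (h.tendsto_right (k + 1)) (h.tendsto_left (k + 2)) neY dY
    (by rw [← hν, o4]; linarith)
  have s1 := eventually_mem_openSegment (h.tendsto_left (k + 1)) (h.tendsto_right (k + 1))
    ((eventually_mem h.le h.left k).mono fun _ h => P.openEdge_subset_edge _ h)
    ((eventually_mem h.le h.right k).mono fun _ h => P.openEdge_subset_edge _ h)
    (h.left_mem k) (h.right_mem k) (h.ne _) (mid_mem_openSegment h0 h1 (k + 1))
  have s2 := eventually_mem_openSegment (h.tendsto_left (k + 2)) (h.tendsto_right (k + 2))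
    ((eventually_mem h.le h.left (k + 1)).mono fun _ h => P.openEdge_subset_edge _ h)
    ((eventually_mem h.le h.right (k + 1)).mono fun _ h => P.openEdge_subset_edge _ h)
    (h.left_mem (k + 1)) (h.right_mem (k + 1)) (h.ne _) (mid_mem_openSegment h0 h1 (k + 2))
  obtain ⟨N, ⟨⟨e1, e2, e3, e4⟩, s1, s2⟩, ⟨m1, m2, m3, m4⟩, f1, f2⟩ :=
    (((e1.and (e2.and (e3.and e4))).and (s1.and s2)).and
      (((eventually_mem h.le h.left k).and ((eventually_mem h.le h.right k).and
        ((eventually_mem h.le h.left (k + 1)).and (eventually_mem h.le h.right (k + 1))))).and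
      ((h.eventually_freeFlight_left (k + 1)).and (h.eventually_freeFlight_right (k + 1))))).exists
  rw [cross_smul_left] at e1 e2 e3 e4
  exact P.freeFlight_of_between m1 m2 m3 m4 f1 f2 (σ := -1 * cross d ν) e1 e2 (by linarith)
    (by linarith) s1 s2

end LimitPair

end PolygonalTable

/-! ### Exclusion of the convex right angle -/

namespace PolygonalTable

open Filter Topology

variable {n : ℕ} {P : PolygonalTable n}

theorem Corner.edge_coordinate {A B : Fin n} {v f g : ℂ} {a b r : ℝ}
    (h : P.Corner A B v f g a b r) {x : ℂ} (hx : x ∈ P.edge A) : x = v + dot f (x - v) • f := by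
  obtain ⟨s, -, -, rfl⟩ := (h.mem_left x).1 hx
  rw [add_sub_cancel_left, dot_smul_right, dot_self, h.norm_left]; simp

/-- A strip of parallel trajectories around a ray from the vertex would exist if the corner was
a convex right angle and both sides emitted trajectories with arbitrarily long common codes. -/
theorem LimitPair.false_of_convex {A B : Fin n} {v f g : ℂ} {a' b' r : ℝ}
    (h : P.Corner A B v f g a' b' r) (hfg : dot f g = 0)
    (hin : ∀ z ∈ Metric.ball v r, 0 < dot f (z - v) → 0 < dot g (z - v) → z ∈ interior P.region)
    {D : ℕ → Fin n} {F : Filter ℕ} {X Y : ℕ → ℕ → ℂ} {a b : ℕ → ℂ} {d₀ ν₀ : ℂ}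
    (hL : LimitPair P D F X Y a b d₀ ν₀) (hν : ν₀ = dot g d₀ • f - dot f d₀ • g)
    (hX : ∀ N, X N 0 ∈ P.openEdge A) (hY : ∀ N, Y N 0 ∈ P.openEdge B)
    (hf : 0 < dot f d₀) (hg : 0 < dot g d₀) (hα : 0 < dot f (a 0 - v)) (hβ : 0 < dot g (b 0 - v)) :
    False := by
  have := hL.neBot
  have hgf : dot g f = 0 := by rw [dot_comm, hfg]
  have ha₀ : a 0 = v + dot f (a 0 - v) • f := h.edge_coordinate
    ((P.isCompact_edge _).isClosed.mem_of_tendsto (hL.tendsto_left 0)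
      (Eventually.of_forall fun N => P.openEdge_subset_edge _ (hX N)))
  have hb₀ : b 0 = v + dot g (b 0 - v) • g := h.symm.edge_coordinate
    ((P.isCompact_edge _).isClosed.mem_of_tendsto (hL.tendsto_right 0)
      (Eventually.of_forall fun N => P.openEdge_subset_edge _ (hY N)))
  set α := dot f (a 0 - v) with hαdef
  set β := dot g (b 0 - v) with hβdef
  set df := dot f d₀ with hdf
  set dg := dot g d₀ with hdg
  have hd₀ : d₀ = df • f + dg • g := orthonormal_decompose h.norm_left h.norm_right hfg d₀
  have νf : dot ν₀ f = dg := by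
    rw [hν, dot_sub_left, dot_smul_left, dot_smul_left, dot_self, h.norm_left, hgf]; ring
  have νg : dot ν₀ g = -df := by
    rw [hν, dot_sub_left, dot_smul_left, dot_smul_left, dot_self, h.norm_right, hfg]; ring
  have νd : dot ν₀ d₀ = 0 := by rw [dot_comm, hL.dot_eq_zero]
  have νa : dot ν₀ (a 0 - v) = α * dg := by
    rw [ha₀, add_sub_cancel_left, dot_smul_right, νf]
  have νb : dot ν₀ (b 0 - v) = -(β * df) := by
    rw [hb₀, add_sub_cancel_left, dot_smul_right, νg]; ring
  set ω := α * dg + β * df with hω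
  have hω0 : 0 < ω := by positivity
  have hωeq : dot ν₀ (a 0 - b 0) = ω := by
    rw [← sub_sub_sub_cancel_right _ _ v, dot_sub_right, νa, νb]; ring
  -- Across the common direction, `a 0` and `b 0` have coordinates `α * dg` and `-(β * df)` relative
  -- to `v`; this weight gives coordinate zero, the parallel through `v`.
  set lam := β * df / ω with hlam
  have hlam0 : 0 < lam := by positivity
  have hlam1 : lam < 1 := by
    rw [div_lt_one hω0, hω]
    have : 0 < α * dg := by positivity
    linarith
  set l := α * β / ω + ((1 - lam) * ‖b 1 - b 0‖ + lam * ‖a 1 - a 0‖) with hl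
  have hl0 : 0 < l := by
    have := mul_nonneg (sub_nonneg.2 hlam1.le) (norm_nonneg (b 1 - b 0))
    positivity
  have hx₁ : LimitPair.mid a b lam 1 = v + l • d₀ := by
    have e : LimitPair.mid a b lam 0 = v + (α * β / ω) • d₀ := by
      have e1 : lam * α = α * β / ω * df := by rw [hlam]; ring
      have e2 : (1 - lam) * β = α * β / ω * dg := by
        rw [hlam]; field_simp; rw [hω]; ring
      rw [LimitPair.mid, ha₀, hb₀, hd₀, smul_add, smul_smul, smul_smul, ← e1, ← e2]
      simp only [smul_sub, smul_add, smul_smul, sub_mul, sub_smul, one_mul]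
      ring
    rw [hL.mid_succ lam 0, e, unframe_zero, hl, add_assoc, ← add_smul]
  have hz : v + l • d₀ ∈ P.openEdge (D 0) := hx₁ ▸ hL.mid_mem hlam0 hlam1 0
  have νx₁ : dot ν₀ (v + l • d₀ - v) = 0 := by
    rw [add_sub_cancel_left, dot_smul_right, νd, mul_zero]
  have dX := hL.eventually_freeFlight_left 0
  have dY := hL.eventually_freeFlight_right 0
  have mX := eventually_mem hL.le hL.left 0
  have mY := eventually_mem hL.le hL.right 0
  have hcr : cross (P.leftVec (D 0)) d₀ < 0 := by
    have hle : cross (P.leftVec (D 0)) d₀ ≤ 0 := by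
      refine le_of_tendsto (tendsto_cross tendsto_const_nhds hL.dir_left) ?_
      filter_upwards [dX, mX] with N h1 h2
      have h3 := h1.symm.cross_pos h2
      rw [← neg_sub, ← norm_smul_dir, cross_neg_right, cross_smul_right] at h3
      have := norm_nonneg (X N (0 + 1) - X N 0)
      by_contra! hc
      have := mul_nonneg this hc.le
      linarith
    -- A limit direction parallel to the first edge would leave no transverse distance between `a 1`
    -- and `b 1`, which both lie on that edge.
    refine hle.lt_of_ne fun h0 => ?_
    obtain ⟨t, ht⟩ := exists_smul_of_cross_eq_zero (P.leftVec_ne_zero (D 0)) h0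
    obtain ⟨s, hs⟩ := exists_smul_of_cross_eq_zero (P.leftVec_ne_zero (D 0))
      (cross_leftVec_sub (hL.left_mem 0) (hL.right_mem 0))
    have h1 : dot ν₀ (a 1 - b 1) = ω := (hL.offset 0).2.trans hωeq
    rw [ht, dot_smul_right] at νd
    rw [show a 1 - b 1 = _ from hs, dot_smul_right] at h1
    rcases mul_eq_zero.1 νd with h2 | h2
    · have := hL.norm_dir
      rw [ht, h2, zero_smul, norm_zero] at this
      exact zero_ne_one this
    · rw [h2, mul_zero] at h1
      exact hω0.ne h1
  have hj : 0 < P.depth (D 0) v := by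
    have h1 := P.depth_eq_zero (P.openEdge_subset_edge _ hz)
    rw [depth_add_smul] at h1
    nlinarith
  have hfirst : P.FreeFlight v (v + l • d₀) := by
    have νa' : dot ν₀ (v - a 0) = -(α * dg) := by rw [← neg_sub, dot_neg_right, νa]
    have νb' : dot ν₀ (v - b 0) = β * df := by rw [← neg_sub, dot_neg_right, νb]; ring
    have ha1 : a 1 - b 0 = (a 0 - b 0) + ‖a 1 - a 0‖ • d₀ := by
      have h1 : a 1 = a 0 + ‖a 1 - a 0‖ • d₀ := hL.left_succ 0
      linear_combination h1
    have hb1 : b 1 - a 0 = ‖b 1 - b 0‖ • d₀ - (a 0 - b 0) := by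
      have h1 : b 1 = b 0 + ‖b 1 - b 0‖ • d₀ := hL.right_succ 0
      linear_combination h1
    have neX := dX.mono fun N hN => hN.1
    have neY := dY.mono fun N hN => hN.1
    have tX := hL.tendsto_left 0
    have tY := hL.tendsto_right 0
    have p1 : 0 < α * dg := by positivity
    have p2 : 0 < β * df := by positivity
    have e1 := hL.eventually_pos (k := 0) (t := -1) tX (tendsto_const_nhds (x := v)) neX hL.dir_left
      (by rw [unframe_zero, νa']; linarith)
    have e2 := hL.eventually_pos (k := 0) (t := -1) tX (tendsto_const_nhds (x := v + l • d₀)) neX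
      hL.dir_left (by
        rw [unframe_zero, ← sub_sub_sub_cancel_right _ _ v, dot_sub_right, νx₁, νa]; linarith)
    have e3 := hL.eventually_pos (k := 0) (t := -1) tX (hL.tendsto_right 1) neX hL.dir_left
      (by rw [unframe_zero, hb1, dot_sub_right, dot_smul_right, νd, hωeq]; linarith)
    have e4 := hL.eventually_pos (k := 0) (t := 1) tY (tendsto_const_nhds (x := v)) neY hL.dir_right
      (by rw [unframe_zero, νb']; linarith)
    have e5 := hL.eventually_pos (k := 0) (t := 1) tY (tendsto_const_nhds (x := v + l • d₀)) neY
      hL.dir_right (by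
        rw [unframe_zero, ← sub_sub_sub_cancel_right _ _ v, dot_sub_right, νx₁, νb]; linarith)
    have e6 := hL.eventually_pos (k := 0) (t := 1) tY (hL.tendsto_left 1) neY hL.dir_right
      (by rw [unframe_zero, ha1, dot_add_right, dot_smul_right, νd, hωeq]; linarith)
    rw [neg_one_mul] at e1 e2 e3
    rw [one_mul] at e4 e5 e6
    obtain ⟨N, ⟨e1, e2, e3⟩, ⟨e4, e5, e6⟩, ⟨f1, f2⟩, m1, m2⟩ :=
      ((e1.and (e2.and e3)).and ((e4.and (e5.and e6)).and ((dX.and dY).and (mX.and mY)))).exists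
    exact h.freeFlight_of_vertex hfg hin (hX N) (hY N) m1 m2 f1 f2 hL.norm_dir hf hg hl0 hz hj
      e1 e2 e3 e4 e5 e6
  obtain ⟨k₀, hk₀⟩ := h.vertex
  -- The ray starts at `v` instead of the point of the parallel on the segment from `a 0` to `b 0`;
  -- from the first hit on it is the middle trajectory.
  set x : ℕ → ℂ := fun k => Nat.rec (motive := fun _ => ℂ) v
    (fun k _ => LimitPair.mid a b lam (k + 1)) k with hx
  have hun : ∀ k, ‖P.unframe D d₀ k‖ = 1 := fun k => by rw [norm_unframe, hL.norm_dir]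
  -- A transverse shift by `t` changes the weight by `t / ω`, and within this width the weight stays
  -- in `(0, 1)`.
  refine no_strip (P := P) (c := D) (x := x) (d := P.unframe D d₀) (ν := P.unframe D ν₀)
    (w := ω * min lam (1 - lam)) (mul_pos hω0 (lt_min hlam0 (by linarith))) (k₀ := k₀) hk₀ ?_
    (fun k => hL.mid_mem hlam0 hlam1 k) ?_ (fun k => unframe_succ _ k)
    (fun k => by rw [norm_unframe, hL.norm_normal])
    (fun k => by rw [dot_unframe, hL.dot_eq_zero]) (fun k => unframe_succ _ k) ?_
  · rintro (_ | k)
    · show P.FreeFlight v (LimitPair.mid a b lam 1)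
      rw [hx₁]; exact hfirst
    · exact hL.freeFlight_mid hlam0 hlam1 k
  · rintro (_ | k)
    · show dir v (LimitPair.mid a b lam 1) = d₀
      rw [hx₁]; exact dir_add_smul hL.norm_dir hl0
    · show dir (LimitPair.mid a b lam (k + 1)) (LimitPair.mid a b lam (k + 2)) = _
      rw [hL.mid_succ lam (k + 1)]
      exact dir_add_smul (hun _) (hL.dist_pos hlam0 hlam1 k)
  · intro k t ht
    have h1 : |t / ω| < min lam (1 - lam) := by
      rw [abs_div, abs_of_pos hω0, div_lt_iff₀ hω0]; linarith
    obtain ⟨h2, h3⟩ := abs_lt.1 h1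
    have h4 : 0 < lam + t / ω := by linarith [min_le_left lam (1 - lam)]
    have h5 : lam + t / ω < 1 := by linarith [min_le_right lam (1 - lam)]
    refine ⟨_, hL.mid_mem h4 h5 k, _, hL.mid_mem h4 h5 (k + 1), ?_, _, hL.dist_pos h4 h5 k,
      hL.mid_succ _ (k + 1), hL.freeFlight_mid h4 h5 k⟩
    show dot _ (_ - LimitPair.mid a b lam (k + 1)) = t
    rw [LimitPair.mid_sub, dot_smul_right, (hL.offset (k + 1)).1, hωeq]
    field_simp; ring

/-- A convex right-angled corner has no pair of words that continue in the same way. -/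
theorem Corner.false_of_convex {A B : Fin n} {v f g : ℂ} {a' b' r : ℝ}
    (h : P.Corner A B v f g a' b' r) (hfg : dot f g = 0)
    (hin : ∀ z ∈ Metric.ball v r, 0 < dot f (z - v) → 0 < dot g (z - v) → z ∈ interior P.region)
    {D s t : ℕ → Fin n} (hsA : s 0 ≠ A) (hsB : s 0 ≠ B) (htA : t 0 ≠ A) (htB : t 0 ≠ B)
    (hs : ∀ N, centralWord s [B] D N ∈ P.bounceLanguage)
    (ht : ∀ N, centralWord D [A] t N ∈ P.bounceLanguage) : False := by
  have hgf : dot g f = 0 := by rw [dot_comm, hfg]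
  have hin' : ∀ z ∈ Metric.ball v r, 0 < dot g (z - v) → 0 < dot f (z - v) →
    z ∈ interior P.region := fun z hz h1 h2 => hin z hz h2 h1
  obtain ⟨cA, hcA, HA⟩ := h.exists_dir_bound hfg hin htA htB
  obtain ⟨cB, hcB, HB⟩ := h.symm.exists_dir_bound hgf hin' hsB hsA
  choose X X' hX hX' hXA hXX hXd using fun N => exists_follows_of_singleton ht (N + 1)
  choose Y' Y hY' hY hYB hYY hYd using fun N => exists_follows_of_singleton hs (N + 1)
  -- The backward arm of the bounce on `A` first hits `t 0`, a third edge, so the bounds for flights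
  -- out of a convex corner apply.
  have bA : ∀ N, 0 < dot g (dir (X N 0) (X N 1)) ∧ (0 < dot f (dir (X N 0) (X N 1)) →
        cA * dot f (dir (X N 0) (X N 1)) ≤ dot g (dir (X N 0) (X N 1)) ∧
        r * dot f (dir (X N 0) (X N 1)) ≤ dot f (X N 0 - v) *
          (dot f (dir (X N 0) (X N 1)) + dot g (dir (X N 0) (X N 1)))) := by
    intro N
    have h1 := hX' N 0 (by omega)
    refine HA _ (hXA N) _ (hX N 0 (by omega)).1 _ (P.openEdge_subset_edge _ h1.2.1)
      (hXX N ▸ h1.1) ?_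
    rw [hXd, map_neg, refl_refl, neg_neg, hXX]
  have bB : ∀ N, 0 < dot f (dir (Y N 0) (Y N 1)) ∧ (0 < dot g (dir (Y N 0) (Y N 1)) →
        cB * dot g (dir (Y N 0) (Y N 1)) ≤ dot f (dir (Y N 0) (Y N 1)) ∧
        r * dot g (dir (Y N 0) (Y N 1)) ≤ dot g (Y N 0 - v) *
          (dot g (dir (Y N 0) (Y N 1)) + dot f (dir (Y N 0) (Y N 1)))) := by
    intro N
    have h1 := hY' N 0 (by omega)
    refine HB _ (hYY N ▸ hYB N) _ (hY N 0 (by omega)).1 _ (P.openEdge_subset_edge _ h1.2.1)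
      (hYY N ▸ h1.1) ?_
    rw [← hYd, hYY]
  have fX : ∀ N, P.Follows D N (X N) := fun N => (hX N).mono (Nat.le_succ N)
  have fY : ∀ N, P.Follows D N (Y N) := fun N => (hY N).mono (Nat.le_succ N)
  set F : Filter ℕ := (hyperfilter ℕ : Filter ℕ) with hF
  have hle : F ≤ atTop := Nat.hyperfilter_le_atTop
  obtain ⟨a, ha⟩ := exists_limit (hyperfilter ℕ) hle fX
  obtain ⟨b, hb⟩ := exists_limit (hyperfilter ℕ) hle fY
  obtain ⟨d₀, hd₀, hdX⟩ := (isCompact_sphere (0 : ℂ) 1).ultrafilter_le_nhds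
    ((hyperfilter ℕ).map fun N => dir (X N 0) (X N 1)) (le_principal_iff.2
      (Eventually.of_forall fun N => by simpa using norm_dir (hX N 0 (by omega)).1.1 :
        ∀ᶠ N in F, dir (X N 0) (X N 1) ∈ Metric.sphere (0 : ℂ) 1))
  replace hdX : Tendsto (fun N => dir (X N 0) (X N 1)) F (𝓝 d₀) := hdX
  have hdY : Tendsto (fun N => dir (Y N 0) (Y N 1)) F (𝓝 d₀) := by
    have h0 : Tendsto (fun N => dir (Y N 0) (Y N 1) - dir (X N 0) (X N 1)) atTop (𝓝 0) := by
      rw [Metric.tendsto_atTop]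
      intro ε hε
      obtain ⟨N₀, hN₀⟩ := P.exists_direction_bound hε
      refine ⟨N₀, fun N hN => ?_⟩
      rw [dist_zero_right]
      exact hN₀ D _ _ ((fY N).mono hN) ((fX N).mono hN)
    have := (h0.mono_left hle).add hdX
    simpa using this
  have hn : ‖d₀‖ = 1 := by simpa using hd₀
  have tXf := tendsto_dot (tendsto_const_nhds (x := f)) hdX
  have tXg := tendsto_dot (tendsto_const_nhds (x := g)) hdX
  have tYf := tendsto_dot (tendsto_const_nhds (x := f)) hdY
  have tYg := tendsto_dot (tendsto_const_nhds (x := g)) hdY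
  have tX0 := tendsto_dot (tendsto_const_nhds (x := f)) ((ha 0).sub (tendsto_const_nhds (x := v)))
  have tY0 := tendsto_dot (tendsto_const_nhds (x := g)) ((hb 0).sub (tendsto_const_nhds (x := v)))
  have hg0 : 0 ≤ dot g d₀ := ge_of_tendsto' tXg fun N => (bA N).1.le
  have hf0 : 0 ≤ dot f d₀ := ge_of_tendsto' tYf fun N => (bB N).1.le
  have LA : 0 < dot f d₀ → cA * dot f d₀ ≤ dot g d₀ ∧
      r * dot f d₀ ≤ dot f (a 0 - v) * (dot f d₀ + dot g d₀) := by
    intro hpos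
    have ev := tXf.eventually (lt_mem_nhds hpos)
    exact ⟨le_of_tendsto_of_tendsto (tXf.const_mul cA) tXg (ev.mono fun N hN => ((bA N).2 hN).1),
      le_of_tendsto_of_tendsto (tXf.const_mul r) (tX0.mul (tXf.add tXg))
        (ev.mono fun N hN => ((bA N).2 hN).2)⟩
  have LB : 0 < dot g d₀ → cB * dot g d₀ ≤ dot f d₀ ∧
      r * dot g d₀ ≤ dot g (b 0 - v) * (dot g d₀ + dot f d₀) := by
    intro hpos
    have ev := tYg.eventually (lt_mem_nhds hpos)
    exact ⟨le_of_tendsto_of_tendsto (tYg.const_mul cB) tYf (ev.mono fun N hN => ((bB N).2 hN).1),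
      le_of_tendsto_of_tendsto (tYg.const_mul r) (tY0.mul (tYg.add tYf))
        (ev.mono fun N hN => ((bB N).2 hN).2)⟩
  have hsq := norm_sq_eq_of_orthonormal h.norm_left h.norm_right hfg d₀
  rw [hn] at hsq
  -- The limit is a unit vector with nonnegative coordinates; one is positive, and the slope bound
  -- forces the other to be positive.
  have hfg0 : 0 < dot f d₀ ∧ 0 < dot g d₀ := by
    rcases hf0.eq_or_lt with h1 | h1
    · rcases hg0.eq_or_lt with h2 | h2
      · rw [← h1, ← h2] at hsq; norm_num at hsq
      · have := (LB h2).1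
        have := mul_pos hcB h2
        linarith
    · have := (LA h1).1
      have := mul_pos hcA h1
      exact ⟨h1, by linarith⟩
  obtain ⟨hf1, hg1⟩ := hfg0
  -- The second bound survives in the limit and keeps the starting points away from the corner.
  have hα : 0 < dot f (a 0 - v) := by
    have h1 := (LA hf1).2
    have h2 := mul_pos h.pos hf1
    exact pos_of_mul_pos_left (h2.trans_le h1) (by positivity)
  have hβ : 0 < dot g (b 0 - v) := by
    have h1 := (LB hg1).2
    have h2 := mul_pos h.pos hg1
    exact pos_of_mul_pos_left (h2.trans_le h1) (by positivity)
  set ν₀ := dot g d₀ • f - dot f d₀ • g with hν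
  have νf : dot f ν₀ = dot g d₀ := by
    rw [hν, dot_sub_right, dot_smul_right, dot_smul_right, dot_self, h.norm_left, hfg]; ring
  have νg : dot g ν₀ = -dot f d₀ := by
    rw [hν, dot_sub_right, dot_smul_right, dot_smul_right, dot_self, h.norm_right, hgf]; ring
  have memA : a 0 ∈ P.edge A := (P.isCompact_edge _).isClosed.mem_of_tendsto (ha 0)
    (Eventually.of_forall fun N => P.openEdge_subset_edge _ (hXA N))
  have hYB' : ∀ N, Y N 0 ∈ P.openEdge B := fun N => hYY N ▸ hYB N
  have memB : b 0 ∈ P.edge B := (P.isCompact_edge _).isClosed.mem_of_tendsto (hb 0)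
    (Eventually.of_forall fun N => P.openEdge_subset_edge _ (hYB' N))
  refine LimitPair.false_of_convex (X := X) (Y := Y) (a := a) (b := b) (d₀ := d₀) (ν₀ := ν₀)
    (D := D) (F := F) h hfg hin
    ⟨inferInstance, hle, fX, fY, ha, hb, hdX, hdY, hn, ?_, ?_, ?_⟩ hν hXA hYB' hf1 hg1 hα hβ
  · have := norm_sq_eq_of_orthonormal h.norm_left h.norm_right hfg ν₀
    rw [νf, νg] at this
    have h1 : ‖ν₀‖ ^ 2 = 1 := by rw [this]; linarith
    nlinarith [norm_nonneg ν₀]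
  · rw [hν, dot_sub_right, dot_smul_right, dot_smul_right, dot_comm d₀ f, dot_comm d₀ g]; ring
  · rw [← sub_sub_sub_cancel_right _ _ v, dot_sub_right, sub_pos]
    have e1 := h.edge_coordinate memA
    have e2 := h.symm.edge_coordinate memB
    have e1' : a 0 - v = dot f (a 0 - v) • f := by linear_combination e1
    have e2' : b 0 - v = dot g (b 0 - v) • g := by linear_combination e2
    rw [e1', e2', dot_smul_right, dot_smul_right, dot_comm ν₀ f, dot_comm ν₀ g, νf, νg]
    have := mul_pos hα hg1
    have := mul_pos hβ hf1
    linarith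

/-- The words determine the angle. -/
theorem hasInteriorAngle_of_words {A B : Fin n} (hAB : P.Adjacent A B)
    (hπ : ¬ P.HasInteriorAngle A B π) {h₁ t₁ h₂ t₂ h₃ t₃ : ℕ → Fin n}
    (hs : t₁ 0 ≠ A ∧ t₁ 0 ≠ B) (ht : t₂ 0 ≠ A ∧ t₂ 0 ≠ B)
    (w₁ : ∀ N, centralWord h₁ [] t₁ N ∈ P.bounceLanguage)
    (w₂ : ∀ N, centralWord t₁ [B] h₂ N ∈ P.bounceLanguage)
    (w₃ : ∀ N, centralWord h₂ [A] t₂ N ∈ P.bounceLanguage)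
    (w₄ : ∀ N, centralWord t₂ [] h₃ N ∈ P.bounceLanguage)
    (w₅ : ∀ N, centralWord h₃ [B] t₃ N ∈ P.bounceLanguage)
    (w₆ : ∀ N, centralWord t₃ [A] h₁ N ∈ P.bounceLanguage) :
    P.HasInteriorAngle A B (3 * π / 2) := by
  obtain ⟨v, f, g, a, b, r, h⟩ := hAB.exists_corner
  obtain ⟨c, hc, hc'⟩ := h.vec_left
  obtain ⟨e, he, he'⟩ := h.vec_right
  have hfg : dot f g = 0 := by
    rcases P.dot_or_cross_eq_zero w₁ w₂ w₃ w₄ w₅ w₆ with h0 | h0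
    · rw [hc', he', dot_smul_left, dot_smul_right] at h0
      exact ((mul_eq_zero.1 ((mul_eq_zero.1 h0).resolve_left hc)).resolve_left he)
    · rw [hc', he', cross_smul_left, cross_smul_right] at h0
      exact absurd ((mul_eq_zero.1 ((mul_eq_zero.1 h0).resolve_left hc)).resolve_left he)
        (h.cross_ne_zero hπ)
  rcases h.quadrant_or hfg with hin | hin
  · exact (h.false_of_convex hfg hin hs.1 hs.2 ht.1 ht.2 w₂ w₃).elim
  · exact h.hasInteriorAngle hfg hin

end PolygonalTable

namespace PolygonalTable

open Filter Topology

variable {n : ℕ} (P : PolygonalTable n)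

/-! ### Existence of trajectories -/

/-- `y` is a nonsingular forward trajectory with hits `c`, based at `y 0`. -/
def IsForward (c : ℕ → Fin n) (y : ℕ → ℂ) : Prop :=
  ∀ k, P.FreeFlight (y k) (y (k + 1)) ∧ P.Bounce (c k) (y k) (y (k + 1)) (y (k + 2))

/-- The affine reflections in the lines of the edges `l`, composed. -/
noncomputable def unfold : List (Fin n) → ℂ → ℂ
  | [], z => z
  | i :: l, z => P.vertices i + P.refl i (unfold l z - P.vertices i)

/-- From `x`, a ball can start in the unit direction `u`, and it never meets a vertex. -/
def NonsingularFrom (x u : ℂ) : Prop :=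
  ‖u‖ = 1 ∧ (∃ r > 0, ∀ t ∈ Set.Ioo (0 : ℝ) r, x + t • u ∈ interior P.region) ∧
    ∀ (l : List (Fin n)) (k : Fin n) (s : ℝ), 0 < s → P.unfold l (P.vertices k) ≠ x + s • u

variable {P}

/-- The next point of the boundary in a given direction. -/
theorem exists_hit {x u : ℂ} (hu : ‖u‖ = 1) {r : ℝ} (hr : 0 < r)
    (h : ∀ t ∈ Set.Ioo (0 : ℝ) r, x + t • u ∈ interior P.region) :
    ∃ t : ℝ, 0 < t ∧ P.FreeFlight x (x + t • u) ∧ ∃ i, x + t • u ∈ P.edge i := by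
  obtain ⟨D, hD, hd⟩ := P.exists_bound
  -- Times below `r / 2` are left out because the starting point itself may lie on the boundary.
  set S : Set ℝ := {t | r / 2 ≤ t ∧ x + t • u ∉ interior P.region} with hS
  have hcl : IsClosed S := by
    have hc : Continuous fun t : ℝ => x + t • u := by fun_prop
    exact isClosed_Ici.inter (isOpen_interior.isClosed_compl.preimage hc)
  have hb : BddBelow S := ⟨r / 2, fun t ht => ht.1⟩
  have hne : S.Nonempty := by
    refine ⟨r / 2 + D + 1, by linarith, fun hmem => ?_⟩
    have h1 := hd _ (interior_subset hmem) _ (interior_subset (h (r / 2) ⟨by linarith, by linarith⟩))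
    rw [show x + (r / 2 + D + 1) • u - (x + (r / 2) • u) = (D + 1) • u by
      rw [add_smul, add_smul, add_smul]; ring, norm_smul, hu, mul_one,
      Real.norm_of_nonneg (by linarith)] at h1
    linarith
  obtain ⟨h1, h2⟩ := hcl.csInf_mem hne hb
  set t := sInf S with ht
  have ht0 : 0 < t := by linarith
  have hne' : x ≠ x + t • u := by
    intro he
    have : t • u = 0 := by linear_combination -he
    rcases smul_eq_zero.1 this with h0 | h0
    · exact ht0.ne' h0
    · rw [h0, norm_zero] at hu; exact zero_ne_one hu
  have hff : P.FreeFlight x (x + t • u) := by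
    refine freeFlight_of_forall hne' fun s hs0 hs1 => ?_
    rw [add_sub_cancel_left, smul_smul]
    have hst : s * t < t := by nlinarith
    rcases lt_or_ge (s * t) r with h3 | h3
    · exact h _ ⟨by positivity, h3⟩
    · by_contra hc
      exact absurd (csInf_le hb ⟨by linarith, hc⟩) (not_le.2 hst)
  refine ⟨t, ht0, hff, ?_⟩
  rcases P.mem_frontier_or_interior hff.symm.left_mem_region with h3 | h3
  · exact h3
  · exact absurd h3 h2

theorem cross_leftVec_neg {i : Fin n} {x u : ℂ} {t : ℝ} (ht : 0 < t)
    (h : P.FreeFlight x (x + t • u)) (hi : x + t • u ∈ P.openEdge i) :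
    cross (P.leftVec i) u < 0 := by
  have := h.symm.cross_pos hi
  rw [sub_add_cancel_left, cross_neg_right, cross_smul_right] at this
  nlinarith

/-- A vertex on the reflected ray, or one of its images, unfolds in the edge just hit to an image of
a vertex on the original ray, with one more reflection in the list. -/
theorem NonsingularFrom.step {x u : ℂ} (h : P.NonsingularFrom x u) :
    ∃ (i : Fin n) (t : ℝ), 0 < t ∧ P.FreeFlight x (x + t • u) ∧ x + t • u ∈ P.openEdge i ∧
      P.NonsingularFrom (x + t • u) (P.refl i u) := by
  obtain ⟨hu, ⟨r, hr, hgerm⟩, hns⟩ := h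
  obtain ⟨t, ht, hff, i, hi⟩ := exists_hit hu hr hgerm
  have hio : x + t • u ∈ P.openEdge i := by
    rcases P.mem_edge_cases hi with h1 | h1 | h1
    · exact absurd h1.symm (hns [] _ t ht)
    · exact absurd h1.symm (hns [] _ t ht)
    · exact h1
  have hcr := cross_leftVec_neg ht hff hio
  refine ⟨i, t, ht, hff, hio, by rw [LinearIsometryEquiv.norm_map, hu], ?_, ?_⟩
  · obtain ⟨ρ, hρ, hd⟩ := P.exists_ball_depth hio
    refine ⟨ρ, hρ, fun s hs => (hd _ ?_).1 ?_⟩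
    · rw [Metric.mem_ball, dist_eq_norm, add_sub_cancel_left, norm_smul,
        LinearIsometryEquiv.norm_map, hu, mul_one, Real.norm_of_nonneg hs.1.le]
      exact hs.2
    · rw [depth_add_smul, P.depth_eq_zero hi, zero_add, cross_leftVec_refl]
      exact mul_pos hs.1 (by linarith)
  · intro l k s hs he
    refine hns (i :: l) k (t + s) (by positivity) ?_
    have h1 : P.refl i (x + t • u - P.vertices i) = x + t • u - P.vertices i :=
      P.refl_sub_of_mem hi (P.vertex_mem_edge i)
    rw [unfold, he, show x + t • u + s • P.refl i u - P.vertices i =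
      (x + t • u - P.vertices i) + s • P.refl i u by ring, map_add, h1, map_smul, refl_refl,
      add_smul]
    ring

theorem NonsingularFrom.exists_isForward {x u : ℂ} (h : P.NonsingularFrom x u) :
    ∃ (c : ℕ → Fin n) (y : ℕ → ℂ), P.IsForward c y ∧ y 0 = x ∧ dir (y 0) (y 1) = u := by
  have : Nonempty (Fin n) := ⟨h.step.choose⟩
  choose! I T hT hff hio hns using fun (p : ℂ × ℂ) (hp : P.NonsingularFrom p.1 p.2) => hp.step
  set S : ℕ → ℂ × ℂ := fun k => (fun p : ℂ × ℂ => (p.1 + T p • p.2, P.refl (I p) p.2))^[k] (x, u)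
    with hS
  have hS0 : S 0 = (x, u) := rfl
  have hSs : ∀ k, S (k + 1) = ((S k).1 + T (S k) • (S k).2, P.refl (I (S k)) (S k).2) := by
    intro k
    simp only [hS, Function.iterate_succ_apply']
  have hgood : ∀ k, P.NonsingularFrom (S k).1 (S k).2 := by
    intro k
    induction k with
    | zero => exact h
    | succ k ih => rw [hSs]; exact hns _ ih
  have hp : ∀ k, (S (k + 1)).1 = (S k).1 + T (S k) • (S k).2 := fun k => by rw [hSs]
  have hfree : ∀ k, P.FreeFlight (S k).1 (S (k + 1)).1 := fun k => by
    rw [hp]; exact hff _ (hgood k)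
  have hdir : ∀ k, dir (S k).1 (S (k + 1)).1 = (S k).2 := fun k => by
    rw [hp]; exact dir_add_smul (hgood k).1 (hT _ (hgood k))
  refine ⟨fun k => I (S k), fun k => (S k).1, fun k => ⟨hfree k, ?_⟩, rfl, hdir 0⟩
  rw [bounce_iff (hfree k).1 (hfree (k + 1)).1]
  refine ⟨?_, ?_⟩
  · show (S (k + 1)).1 ∈ _
    rw [hp]; exact hio _ (hgood k)
  · show dir (S (k + 1)).1 (S (k + 2)).1 = _
    rw [hdir, hdir, hSs]

/-! ### Stability -/

/-- The starting point may be a vertex, so freedom of the first part of the shifted flight is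
assumed. The middle part stays interior by compactness, and shortly after time `t` the flight would
be on the outer side of the edge. -/
theorem exists_hit_stable {x u : ℂ} (hu : ‖u‖ = 1) {t : ℝ} (ht : 0 < t) {i : Fin n}
    (hff : P.FreeFlight x (x + t • u)) (hi : x + t • u ∈ P.openEdge i) {ρ ε : ℝ} (hρ : 0 < ρ)
    (hε : 0 < ε) :
    ∃ δ > 0, ∀ x' ∈ Metric.ball x δ, (∀ s ∈ Set.Ioo 0 ρ, x' + s • u ∈ interior P.region) →
      ∀ (j : Fin n) (t' : ℝ), 0 < t' → P.FreeFlight x' (x' + t' • u) → x' + t' • u ∈ P.openEdge j →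
      j = i ∧ x' + t' • u ∈ Metric.ball (x + t • u) ε := by
  obtain ⟨ρ₁, hρ₁, hd⟩ := P.exists_ball_depth hi
  obtain ⟨ρ₂, hρ₂, ho⟩ := P.exists_ball_openEdge hi
  have hcr := cross_leftVec_neg ht hff hi
  set η := min (min ε t) (min ρ₁ ρ₂) / 4 with hη
  have hm : 0 < min (min ε t) (min ρ₁ ρ₂) := lt_min (lt_min hε ht) (lt_min hρ₁ hρ₂)
  have hη0 : 0 < η := by positivity
  have hηε : 2 * η < ε := by
    have := (min_le_left (min ε t) (min ρ₁ ρ₂)).trans (min_le_left _ _); linarith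
  have hηt : 2 * η < t := by
    have := (min_le_left (min ε t) (min ρ₁ ρ₂)).trans (min_le_right _ _); linarith
  have hη₁ : 2 * η < ρ₁ := by
    have := (min_le_right (min ε t) (min ρ₁ ρ₂)).trans (min_le_left _ _); linarith
  have hη₂ : 2 * η < ρ₂ := by
    have := (min_le_right (min ε t) (min ρ₁ ρ₂)).trans (min_le_right _ _); linarith
  have hcont : Continuous fun s : ℝ => x + s • u := by fun_prop
  obtain ⟨δ₁, hδ₁, hthick⟩ := (isCompact_Icc.image hcont :
    IsCompact ((fun s : ℝ => x + s • u) '' Set.Icc (ρ / 2) (t - η))).exists_thickening_subset_open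
    isOpen_interior (by
      rintro _ ⟨s, ⟨hs0, hs1⟩, rfl⟩
      have := hff.mem (t := s / t) (div_pos (by linarith) ht) ((div_lt_one ht).2 (by linarith))
      rwa [add_sub_cancel_left, smul_smul, div_mul_cancel₀ _ ht.ne'] at this)
  have hev : ∀ᶠ x' in 𝓝 x, P.depth i (x' + (t + η) • u) < 0 := by
    have hc : Continuous fun x' => P.depth i (x' + (t + η) • u) :=
      (P.continuous_depth i).comp (by fun_prop)
    refine hc.continuousAt.eventually_lt continuousAt_const ?_
    rw [add_smul, ← add_assoc, depth_add_smul, P.depth_eq_zero (P.openEdge_subset_edge _ hi),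
      zero_add]
    exact mul_neg_of_pos_of_neg hη0 hcr
  obtain ⟨δ₂, hδ₂, hev⟩ := Metric.eventually_nhds_iff_ball.1 hev
  refine ⟨min η (min δ₁ δ₂), by positivity, fun x' hx' hgerm j t' ht' hff' hj => ?_⟩
  rw [Metric.mem_ball, dist_eq_norm] at hx'
  have hx1 : ‖x' - x‖ < η := hx'.trans_le (min_le_left _ _)
  have hx2 : ‖x' - x‖ < δ₁ := hx'.trans_le ((min_le_right _ _).trans (min_le_left _ _))
  have hx3 : ‖x' - x‖ < δ₂ := hx'.trans_le ((min_le_right _ _).trans (min_le_right _ _))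
  have hdist : ∀ s, ‖x' + s • u - (x + t • u)‖ ≤ ‖x' - x‖ + |s - t| := by
    intro s
    rw [show x' + s • u - (x + t • u) = (x' - x) + (s - t) • u by rw [sub_smul]; ring]
    refine (norm_add_le _ _).trans ?_
    rw [norm_smul, hu, mul_one, Real.norm_eq_abs]
  have hnot := P.notMem_interior_of_mem_openEdge hj
  have ht1 : t - η < t' := by
    by_contra! hle
    apply hnot
    rcases lt_or_ge t' ρ with h1 | h1
    · exact hgerm _ ⟨ht', h1⟩
    · apply hthick
      rw [Metric.mem_thickening_iff]
      refine ⟨_, ⟨t', ⟨by linarith, hle⟩, rfl⟩, ?_⟩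
      rw [dist_eq_norm]
      simpa using hx2
  have hreg := P.edge_subset_region j (P.openEdge_subset_edge j hj)
  have ht2 : t' < t + η := by
    by_contra! hle
    have h1 := hev x' (by rwa [Metric.mem_ball, dist_eq_norm])
    have h2 := hdist (t + η)
    rw [add_sub_cancel_left, abs_of_pos hη0] at h2
    refine (hd (x' + (t + η) • u) (by rw [Metric.mem_ball, dist_eq_norm]; linarith)).2 h1 ?_
    rcases hle.eq_or_lt with h3 | h3
    · rw [h3]; exact hreg
    · have := hff'.mem (t := (t + η) / t') (by positivity) ((div_lt_one ht').2 h3)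
      rw [add_sub_cancel_left, smul_smul, div_mul_cancel₀ _ ht'.ne'] at this
      exact interior_subset this
  have hclose : ‖x' + t' • u - (x + t • u)‖ < 2 * η := by
    have h1 := hdist t'
    have h2 : |t' - t| < η := abs_lt.2 ⟨by linarith, by linarith⟩
    linarith
  have hmem : ∀ {ρ : ℝ}, 2 * η < ρ → x' + t' • u ∈ Metric.ball (x + t • u) ρ := fun h => by
    rw [Metric.mem_ball, dist_eq_norm]; linarith
  have hdz : P.depth i (x' + t' • u) = 0 := by
    obtain ⟨h1, h2⟩ := hd _ (hmem hη₁)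
    rcases lt_trichotomy (P.depth i (x' + t' • u)) 0 with h3 | h3 | h3
    · exact absurd hreg (h2 h3)
    · exact h3
    · exact absurd (h1 h3) hnot
  exact ⟨P.eq_of_mem_openEdge hj (P.openEdge_subset_edge _ (ho _ (hmem hη₂)
    (P.depth_eq_zero_iff.1 hdz))), hmem hηε⟩

theorem IsForward.tail {c : ℕ → Fin n} {y : ℕ → ℂ} (h : P.IsForward c y) :
    P.IsForward (fun k => c (k + 1)) (fun k => y (k + 1)) := fun k => h (k + 1)

theorem IsForward.dir_one {c : ℕ → Fin n} {y : ℕ → ℂ} (h : P.IsForward c y) :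
    dir (y 1) (y 2) = P.refl (c 0) (dir (y 0) (y 1)) :=
  ((bounce_iff (h 0).1.1 (h 1).1.1).1 (h 0).2).2

theorem eq_add_smul_dir (x y : ℂ) : y = x + ‖y - x‖ • dir x y := by
  rw [norm_smul_dir]; ring

/-- Trajectories that start nearby in the same direction have the same first hits. -/
theorem IsForward.exists_stable {c : ℕ → Fin n} {y : ℕ → ℂ} (h : P.IsForward c y) (N : ℕ) {ρ : ℝ}
    (hρ : 0 < ρ) : ∃ δ > 0, ∀ (c' : ℕ → Fin n) (y' : ℕ → ℂ), P.IsForward c' y' →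
      y' 0 ∈ Metric.ball (y 0) δ → dir (y' 0) (y' 1) = dir (y 0) (y 1) →
      (∀ s ∈ Set.Ioo 0 ρ, y' 0 + s • dir (y 0) (y 1) ∈ interior P.region) → ∀ k < N, c' k = c k := by
  induction N generalizing c y ρ with
  | zero => exact ⟨1, one_pos, fun _ _ _ _ _ _ k hk => absurd hk (Nat.not_lt_zero k)⟩
  | succ N ih =>
    set u := dir (y 0) (y 1) with hu
    have hun : ‖u‖ = 1 := norm_dir (h 0).1.1
    set t := ‖y 1 - y 0‖ with ht
    have ht0 : 0 < t := norm_pos_iff.2 (sub_ne_zero.2 (h 0).1.1.symm)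
    have hy1 : y 1 = y 0 + t • u := eq_add_smul_dir _ _
    have hff : P.FreeFlight (y 0) (y 0 + t • u) := hy1 ▸ (h 0).1
    have hi : y 0 + t • u ∈ P.openEdge (c 0) := hy1 ▸ (h 0).2.1
    have hcr := cross_leftVec_neg ht0 hff hi
    obtain ⟨ρ₁, hρ₁, hd⟩ := P.exists_ball_depth hi
    -- After a hit on an open edge, the initial freedom needed for the next step holds with `ρ₁ /
    -- 2`, by the local half disc.
    obtain ⟨δ₁, hδ₁, H⟩ := ih h.tail (half_pos hρ₁)
    obtain ⟨δ, hδ, hs⟩ := exists_hit_stable hun ht0 hff hi hρ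
      (ε := min δ₁ (ρ₁ / 2)) (lt_min hδ₁ (half_pos hρ₁))
    refine ⟨δ, hδ, fun c' y' h' hball hdir hgerm => ?_⟩
    have ht0' : 0 < ‖y' 1 - y' 0‖ := norm_pos_iff.2 (sub_ne_zero.2 (h' 0).1.1.symm)
    have hy1' : y' 1 = y' 0 + ‖y' 1 - y' 0‖ • u := by rw [← hdir]; exact eq_add_smul_dir _ _
    obtain ⟨hc0, hb⟩ := hs _ hball hgerm (c' 0) _ ht0' (hy1' ▸ (h' 0).1) (hy1' ▸ (h' 0).2.1)
    rw [← hy1', Metric.mem_ball] at hb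
    have hdir1 : dir (y' 1) (y' 2) = dir (y 1) (y 2) := by
      rw [h'.dir_one, h.dir_one, hc0, hdir]
    have key := H _ _ h'.tail (by
        rw [Metric.mem_ball]
        have := hb.trans_le (min_le_left _ _)
        rwa [← hy1] at this) hdir1 (by
      intro s hs
      show y' 1 + s • dir (y 1) (y 2) ∈ _
      have hn : ‖dir (y 1) (y 2)‖ = 1 := norm_dir (h 1).1.1
      refine (hd _ ?_).1 ?_
      · rw [Metric.mem_ball]
        have h1 : dist (y' 1 + s • dir (y 1) (y 2)) (y' 1) = s := by
          rw [dist_eq_norm, add_sub_cancel_left, norm_smul, hn, mul_one,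
            Real.norm_of_nonneg hs.1.le]
        have h2 := dist_triangle (y' 1 + s • dir (y 1) (y 2)) (y' 1) (y 0 + t • u)
        have h3 := hb.trans_le (min_le_right _ _)
        have := hs.2
        linarith
      · have h1 : y' 1 ∈ P.edge (c 0) := hc0 ▸ P.openEdge_subset_edge _ (h' 0).2.1
        rw [depth_add_smul, P.depth_eq_zero h1, h.dir_one, cross_leftVec_refl, zero_add]
        exact mul_pos hs.1 (by linarith))
    rintro (_ | k) hk
    · exact hc0
    · exact key k (by omega)

end PolygonalTable

namespace PolygonalTable

open Filter Topology

variable {n : ℕ} {P : PolygonalTable n}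

/-! ### Gluing half-trajectories -/

theorem exists_trajectory_of_halves {c d : ℕ → Fin n} {y z : ℕ → ℂ} {A : Fin n}
    (hy : P.IsForward c y) (hz : P.IsForward d z) (h0 : z 0 = y 0)
    (hb : P.Bounce A (z 1) (y 0) (y 1)) :
    ∃ e x, P.IsTrajectory e x ∧ e 0 = A ∧ (∀ k : ℕ, e (k + 1) = c k) ∧
      ∀ k : ℕ, e (-1 - k) = d k := by
  let x : ℤ → ℂ
    | Int.ofNat k => y k
    | Int.negSucc k => z (k + 1)
  let e : ℤ → Fin n
    | Int.ofNat 0 => A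
    | Int.ofNat (k + 1) => c k
    | Int.negSucc k => d k
  have hxn : ∀ k : ℕ, x (-(k : ℤ)) = z k := by
    rintro (_ | k)
    · exact h0.symm
    · rfl
  refine ⟨e, x, ?_, rfl, fun k => rfl, fun k => ?_⟩
  · rintro ((_ | k) | k)
    · exact ⟨(hy 0).1, hb⟩
    · refine ⟨(hy (k + 1)).1, ?_⟩
      have h1 : x (Int.ofNat (k + 1) - 1) = y k := by
        rw [show Int.ofNat (k + 1) - 1 = Int.ofNat k by simp]
      rw [h1]; exact (hy k).2
    · have h1 : x (Int.negSucc k + 1) = z k := by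
        rw [show Int.negSucc k + 1 = -(k : ℤ) by rw [Int.negSucc_eq]; ring, hxn]
      have h2 : x (Int.negSucc k - 1) = z (k + 2) := by
        rw [show Int.negSucc k - 1 = -((k + 2 : ℕ) : ℤ) by rw [Int.negSucc_eq]; push_cast; ring, hxn]
      rw [h1, h2]
      exact ⟨(hz k).1.symm, (hz k).2.symm (hz k).1.1 (hz (k + 1)).1.1⟩
  · rw [show -1 - (k : ℤ) = Int.negSucc k by rw [Int.negSucc_eq]; ring]

theorem FreeFlight.join {x u : ℂ} {s t : ℝ} (hx : x ∈ interior P.region) (hs : 0 < s) (ht : 0 < t)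
    (h₁ : P.FreeFlight x (x + s • u)) (h₂ : P.FreeFlight x (x + t • -u)) :
    P.FreeFlight (x + s • u) (x + t • -u) := by
  have hu : u ≠ 0 := by rintro rfl; exact h₁.1 (by simp)
  refine freeFlight_of_forall (fun he => ?_) fun τ h0 h1 => ?_
  · have : (s + t) • u = 0 := by
      rw [smul_neg] at he
      rw [add_smul]; linear_combination he
    exact hu ((smul_eq_zero.1 this).resolve_left (by positivity))
  · have e : x + s • u + τ • (x + t • -u - (x + s • u)) = x + (s - τ * (s + t)) • u := by
      simp only [smul_neg, smul_sub, smul_add, sub_smul, mul_smul, add_smul]; ring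
    rw [e]
    rcases lt_trichotomy (s - τ * (s + t)) 0 with h | h | h
    · have := h₂.mem (t := -(s - τ * (s + t)) / t) (div_pos (by linarith) ht)
        ((div_lt_one ht).2 (by nlinarith))
      rwa [add_sub_cancel_left, smul_smul, div_mul_cancel₀ _ ht.ne', smul_neg, neg_smul,
        neg_neg] at this
    · rwa [h, zero_smul, add_zero]
    · have := h₁.mem (t := (s - τ * (s + t)) / s) (div_pos h hs)
        ((div_lt_one hs).2 (by nlinarith [mul_pos h0 (add_pos hs ht)]))
      rwa [add_sub_cancel_left, smul_smul, div_mul_cancel₀ _ hs.ne'] at this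

theorem exists_trajectory_of_opposite {c d : ℕ → Fin n} {y z : ℕ → ℂ}
    (hy : P.IsForward c y) (hz : P.IsForward d z) (h0 : z 0 = y 0) (hin : y 0 ∈ interior P.region)
    (hdir : dir (z 0) (z 1) = -dir (y 0) (y 1)) :
    ∃ e x, P.IsTrajectory e x ∧ (∀ k : ℕ, e k = c k) ∧ ∀ k : ℕ, e (-1 - k) = d k := by
  set u := dir (y 0) (y 1) with hu
  have hun : ‖u‖ = 1 := norm_dir (hy 0).1.1
  set s := ‖y 1 - y 0‖
  set t := ‖z 1 - z 0‖
  have hs0 : 0 < s := norm_pos_iff.2 (sub_ne_zero.2 (hy 0).1.1.symm)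
  have ht0 : 0 < t := norm_pos_iff.2 (sub_ne_zero.2 (hz 0).1.1.symm)
  have hy1 : y 1 = y 0 + s • u := eq_add_smul_dir _ _
  have hz1 : z 1 = y 0 + t • -u := by rw [← hdir, ← h0]; exact eq_add_smul_dir _ _
  have hfree : P.FreeFlight (y 1) (z 1) := by
    rw [hy1, hz1]
    refine FreeFlight.join hin hs0 ht0 (hy1 ▸ (hy 0).1) (hz1 ▸ h0 ▸ (hz 0).1)
  have hdir' : dir (y 1) (z 1) = -u := by
    have : z 1 = y 1 + (s + t) • -u := by
      rw [hz1, hy1, add_smul, smul_neg, smul_neg]; ring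
    rw [this]
    exact dir_add_smul (by rw [norm_neg, hun]) (by positivity)
  -- The common base point is interior and not a hit, so the two first flights merge into one that
  -- starts at `y 1`.
  let z' : ℕ → ℂ
    | 0 => y 1
    | k + 1 => z (k + 1)
  have hz' : P.IsForward d z' := by
    rintro (_ | k)
    · refine ⟨hfree, (bounce_iff hfree.1 (hz 1).1.1).2 ⟨(hz 0).2.1, ?_⟩⟩
      show dir (z 1) (z 2) = P.refl (d 0) (dir (y 1) (z 1))
      rw [hz.dir_one, hdir', hdir]
    · exact hz (k + 1)
  obtain ⟨e, x, hx, h1, h2, h3⟩ := exists_trajectory_of_halves hy.tail hz' rfl (A := c 0) (by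
    refine (bounce_iff hfree.1.symm (hy 1).1.1).2 ⟨(hy 0).2.1, ?_⟩
    show dir (y 1) (y 2) = P.refl (c 0) (dir (z 1) (y 1))
    rw [hy.dir_one, dir_swap (y 1) (z 1), hdir', neg_neg])
  refine ⟨e, x, hx, ?_, h3⟩
  rintro (_ | k)
  · exact h1
  · exact_mod_cast h2 k

/-! ### Generic base points -/

/-- Taking `cross u` eliminates `s`, so each of the countably many images of vertices determines at
most one `t`. -/
theorem countable_singular {v w u : ℂ} (h : cross u w ≠ 0) :
    {t : ℝ | ∃ (l : List (Fin n)) (k : Fin n) (s : ℝ),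
      P.unfold l (P.vertices k) = v + t • w + s • u}.Countable := by
  refine (Set.countable_range fun q : List (Fin n) × Fin n =>
    cross u (P.unfold q.1 (P.vertices q.2) - v) / cross u w).mono ?_
  rintro t ⟨l, k, s, hs⟩
  refine ⟨(l, k), ?_⟩
  simp only
  rw [hs, show v + t • w + s • u - v = t • w + s • u by ring, cross_add_right, cross_smul_right,
    cross_smul_right, cross_self, mul_zero, add_zero, mul_div_cancel_right₀ _ h]

/-- Two rays from `v` are followed for a long time by trajectories with a common base point. -/
theorem exists_common_base {v w : ℂ} {c₁ c₂ : ℕ → Fin n} {y₁ y₂ : ℕ → ℂ} (h₁ : P.IsForward c₁ y₁)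
    (h₂ : P.IsForward c₂ y₂) (hv₁ : y₁ 0 = v) (hv₂ : y₂ 0 = v) {u₁ u₂ : ℂ}
    (hu₁ : dir (y₁ 0) (y₁ 1) = u₁) (hu₂ : dir (y₂ 0) (y₂ 1) = u₂)
    (hw₁ : cross u₁ w ≠ 0) (hw₂ : cross u₂ w ≠ 0) {ρ : ℝ} (hρ : 0 < ρ)
    (hin₁ : ∀ t ∈ Set.Ioo 0 ρ, ∀ s ∈ Set.Ioo 0 ρ, v + t • w + s • u₁ ∈ interior P.region)
    (hin₂ : ∀ t ∈ Set.Ioo 0 ρ, ∀ s ∈ Set.Ioo 0 ρ, v + t • w + s • u₂ ∈ interior P.region) (N : ℕ) :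
    ∃ t ∈ Set.Ioo 0 ρ, ∃ c₁' c₂' y₁' y₂', P.IsForward c₁' y₁' ∧ P.IsForward c₂' y₂' ∧
      y₁' 0 = v + t • w ∧ y₂' 0 = v + t • w ∧ dir (y₁' 0) (y₁' 1) = u₁ ∧
      dir (y₂' 0) (y₂' 1) = u₂ ∧ (∀ k < N, c₁' k = c₁ k) ∧ ∀ k < N, c₂' k = c₂ k := by
  obtain ⟨δ₁, hδ₁, H₁⟩ := h₁.exists_stable N hρ
  obtain ⟨δ₂, hδ₂, H₂⟩ := h₂.exists_stable N hρ
  have hw : 0 < ‖w‖ := norm_pos_iff.2 fun h => hw₁ (by rw [h, cross_zero_right])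
  have hb : 0 < min ρ (min (δ₁ / ‖w‖) (δ₂ / ‖w‖)) := by positivity
  obtain ⟨t, htc, ht0, ht1⟩ := (((countable_singular (P := P) (v := v) hw₁).union
    (countable_singular (P := P) (v := v) hw₂)).dense_compl ℝ).exists_between hb
  have htρ : t < ρ := ht1.trans_le (min_le_left _ _)
  have ht₁ : t * ‖w‖ < δ₁ := (lt_div_iff₀ hw).1
    (ht1.trans_le ((min_le_right _ _).trans (min_le_left _ _)))
  have ht₂ : t * ‖w‖ < δ₂ := (lt_div_iff₀ hw).1
    (ht1.trans_le ((min_le_right _ _).trans (min_le_right _ _)))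
  rw [Set.mem_compl_iff, Set.mem_union, not_or] at htc
  have hnorm : ‖v + t • w - v‖ = t * ‖w‖ := by
    rw [add_sub_cancel_left, norm_smul, Real.norm_of_nonneg ht0.le]
  have n₁ : P.NonsingularFrom (v + t • w) u₁ := ⟨hu₁ ▸ norm_dir (h₁ 0).1.1,
    ⟨ρ, hρ, hin₁ t ⟨ht0, htρ⟩⟩, fun l k s _ he => htc.1 ⟨l, k, s, he⟩⟩
  have n₂ : P.NonsingularFrom (v + t • w) u₂ := ⟨hu₂ ▸ norm_dir (h₂ 0).1.1,
    ⟨ρ, hρ, hin₂ t ⟨ht0, htρ⟩⟩, fun l k s _ he => htc.2 ⟨l, k, s, he⟩⟩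
  obtain ⟨c₁', y₁', f₁, b₁, d₁⟩ := n₁.exists_isForward
  obtain ⟨c₂', y₂', f₂, b₂, d₂⟩ := n₂.exists_isForward
  refine ⟨t, ⟨ht0, htρ⟩, c₁', c₂', y₁', y₂', f₁, f₂, b₁, b₂, d₁, d₂, ?_, ?_⟩
  · refine H₁ _ _ f₁ ?_ (d₁.trans hu₁.symm) ?_
    · rw [b₁, hv₁, Metric.mem_ball, dist_eq_norm, hnorm]; exact ht₁
    · rw [b₁, hu₁]; exact hin₁ t ⟨ht0, htρ⟩
  · refine H₂ _ _ f₂ ?_ (d₂.trans hu₂.symm) ?_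
    · rw [b₂, hv₂, Metric.mem_ball, dist_eq_norm, hnorm]; exact ht₂
    · rw [b₂, hu₂]; exact hin₂ t ⟨ht0, htρ⟩

/-! ### Words of trajectories near a reflex right-angled corner -/

theorem norm_smul_add_smul {f g : ℂ} (hf : ‖f‖ = 1) (hg : ‖g‖ = 1) (hfg : dot f g = 0) {c s : ℝ}
    (h : c ^ 2 + s ^ 2 = 1) : ‖c • f + s • g‖ = 1 := by
  have h1 := norm_sq_eq_of_orthonormal hf hg hfg (c • f + s • g)
  have hgf : dot g f = 0 := by rw [dot_comm, hfg]
  rw [dot_add_right, dot_add_right, dot_smul_right, dot_smul_right, dot_smul_right, dot_smul_right,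
    dot_self, dot_self, hf, hg, hfg, hgf] at h1
  have h2 : ‖c • f + s • g‖ ^ 2 = 1 := by rw [h1]; linarith
  nlinarith [norm_nonneg (c • f + s • g)]

theorem Corner.refl_left {A B : Fin n} {v f g : ℂ} {a b r : ℝ}
    (h : P.Corner A B v f g a b r) (hfg : dot f g = 0) (c s : ℝ) :
    P.refl A (c • f + s • g) = c • f - s • g := by
  obtain ⟨l, hl, hl'⟩ := h.vec_left
  have hf0 : f ≠ 0 := by have := h.norm_left; rintro rfl; simp at this
  have e : ∀ z, dot f (P.refl A z) = dot f z ∧ cross f (P.refl A z) = -cross f z := by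
    intro z
    have h1 := P.dot_edgeVec_refl A z
    have h2 := P.cross_edgeVec_refl A z
    rw [hl', dot_smul_left, dot_smul_left] at h1
    rw [hl', cross_smul_left, cross_smul_left] at h2
    refine ⟨mul_left_cancel₀ hl h1, mul_left_cancel₀ hl (h2.trans (by ring))⟩
  apply ext_of_dot_cross hf0
  · rw [(e _).1, dot_add_right, dot_sub_right, dot_smul_right, dot_smul_right, hfg]; ring
  · rw [(e _).2, cross_add_right, cross_sub_right, cross_smul_right, cross_smul_right, cross_self]
    ring

theorem mem_ball_add_add {v w u : ℂ} {ρ s t : ℝ} (hw : ‖w‖ ≤ 2) (hu : ‖u‖ = 1)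
    (ht : t ∈ Set.Ioo 0 (ρ / 3)) (hs : s ∈ Set.Ioo 0 (ρ / 3)) :
    v + t • w + s • u ∈ Metric.ball v ρ := by
  rw [Metric.mem_ball, dist_eq_norm, show v + t • w + s • u - v = t • w + s • u by ring]
  refine (norm_add_le _ _).trans_lt ?_
  rw [norm_smul, norm_smul, hu, Real.norm_of_nonneg ht.1.le, Real.norm_of_nonneg hs.1.le]
  have := mul_le_mul_of_nonneg_left hw ht.1.le
  linarith [ht.2, hs.2]

/-- The ray directions are an outgoing direction and a reversed incoming direction of a bounce on
`A`. Moving the common base point from `v` along `A` turns the two rays into the halves of a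
nonsingular trajectory. -/
theorem Corner.bounce_words {A B : Fin n} {v f g : ℂ} {a b r ρ : ℝ}
    (h : P.Corner A B v f g a b r) (hfg : dot f g = 0) (hρ : 0 < ρ)
    (hin : ∀ z ∈ Metric.ball v ρ, dot f (z - v) < 0 ∨ dot g (z - v) < 0 → z ∈ interior P.region)
    {c s : ℝ} (hs : 0 < s) {α β : ℕ → Fin n} {y z : ℕ → ℂ} (hα : P.IsForward α y)
    (hβ : P.IsForward β z) (hy : y 0 = v) (hz : z 0 = v) (hdy : dir (y 0) (y 1) = c • f + (-s) • g)
    (hdz : dir (z 0) (z 1) = (-c) • f + (-s) • g) (N : ℕ) :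
    centralWord β [A] α N ∈ P.bounceLanguage ∧ centralWord α [A] β N ∈ P.bounceLanguage := by
  have hgf : dot g f = 0 := by rw [dot_comm, hfg]
  have hcr : cross f g ≠ 0 := fun h0 => by
    have := cross_sq_eq_one h.norm_left h.norm_right hfg
    rw [h0] at this; norm_num at this
  have hcr' : ∀ e : ℝ, cross (e • f + (-s) • g) f ≠ 0 := by
    intro e
    rw [cross_add_left, cross_smul_left, cross_smul_left, cross_self, cross_swap g f]
    intro h0
    exact mul_ne_zero hs.ne' hcr (by linarith)
  set η := min (ρ / 3) a with hη
  have hη0 : 0 < η := lt_min (by positivity) (h.pos.trans_le h.le_left)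
  have hmem : ∀ e : ℝ, ‖e • f + (-s) • g‖ = 1 → ∀ t ∈ Set.Ioo 0 η, ∀ τ ∈ Set.Ioo 0 η,
      v + t • f + τ • (e • f + (-s) • g) ∈ interior P.region := by
    intro e he t ht τ hτ
    refine hin _ (mem_ball_add_add (by rw [h.norm_left]; norm_num) he
      ⟨ht.1, ht.2.trans_le (min_le_left _ _)⟩ ⟨hτ.1, hτ.2.trans_le (min_le_left _ _)⟩) (Or.inr ?_)
    rw [show v + t • f + τ • (e • f + (-s) • g) - v = t • f + τ • (e • f + (-s) • g) by ring,
      dot_add_right, dot_smul_right, dot_smul_right, dot_add_right, dot_smul_right, dot_smul_right,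
      hgf, dot_self, h.norm_right]
    nlinarith [mul_pos hτ.1 hs]
  obtain ⟨t, ht, α', β', y', z', fy, fz, by0, bz0, dy, dz, eα, eβ⟩ :=
    exists_common_base hα hβ hy hz hdy hdz (hcr' c) (hcr' (-c)) hη0
      (hmem c (hdy ▸ norm_dir (hα 0).1.1)) (hmem (-c) (hdz ▸ norm_dir (hβ 0).1.1)) N
  have hA : v + t • f ∈ P.openEdge A :=
    (h.mem_open_left _).2 ⟨t, ht.1, ht.2.trans_le (min_le_right _ _), rfl⟩
  have word : ∀ {α β α' β' : ℕ → Fin n} {y z : ℕ → ℂ} {c : ℝ}, P.IsForward α' y →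
      P.IsForward β' z → y 0 = v + t • f → z 0 = v + t • f → dir (y 0) (y 1) = c • f + (-s) • g →
      dir (z 0) (z 1) = (-c) • f + (-s) • g → (∀ k < N, α' k = α k) → (∀ k < N, β' k = β k) →
      centralWord β [A] α N ∈ P.bounceLanguage := by
    intro α β α' β' y z c fy fz hy hz dy dz eα eβ
    obtain ⟨e, x, hx, h1, h2, h3⟩ := exists_trajectory_of_halves fy fz (hz.trans hy.symm) (A := A) (by
      rw [bounce_iff (by rw [hy, ← hz]; exact (fz 0).1.1.symm) (fy 0).1.1]
      refine ⟨hy ▸ hA, ?_⟩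
      rw [hy, ← hz, dir_swap (z 0) (z 1), dz, map_neg, h.refl_left hfg, hz, ← hy, dy, neg_smul,
        neg_smul]
      ring)
    refine mem_language_of_trajectory hx (fun i hi => (h3 i).trans (eβ i hi)) ?_ ?_
    · intro j hj
      have : j = 0 := by simpa using hj
      subst this
      simpa using h1
    · intro i hi
      rw [← eα i hi, ← h2 i]
      congr 1
      simp only [List.length_singleton]; push_cast; ring
  exact ⟨word fy fz by0 bz0 dy dz eα eβ,
    word fz fy bz0 by0 dz (by rw [dy, neg_neg]) eβ eα⟩

theorem Corner.straight_words {A B : Fin n} {v f g : ℂ} {a b r ρ : ℝ}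
    (h : P.Corner A B v f g a b r) (hfg : dot f g = 0) (hρ : 0 < ρ)
    (hin : ∀ z ∈ Metric.ball v ρ, dot f (z - v) < 0 ∨ dot g (z - v) < 0 → z ∈ interior P.region)
    {c s : ℝ} (hc : 0 < c) (hs : 0 < s) {α γ : ℕ → Fin n} {y z : ℕ → ℂ} (hα : P.IsForward α y)
    (hγ : P.IsForward γ z) (hy : y 0 = v) (hz : z 0 = v) (hdy : dir (y 0) (y 1) = c • f + (-s) • g)
    (hdz : dir (z 0) (z 1) = (-c) • f + s • g) (N : ℕ) :
    centralWord α [] γ N ∈ P.bounceLanguage := by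
  have hgf : dot g f = 0 := by rw [dot_comm, hfg]
  have hcr : cross f g ≠ 0 := fun h0 => by
    have := cross_sq_eq_one h.norm_left h.norm_right hfg
    rw [h0] at this; norm_num at this
  set u := c • f + (-s) • g with hu
  have hu' : (-c) • f + s • g = -u := by rw [hu, neg_smul, neg_smul]; ring
  rw [hu'] at hdz
  have hun : ‖u‖ = 1 := hdy ▸ norm_dir (hα 0).1.1
  -- The base point is moved away from the missing quadrant, so that the line passes the corner
  -- inside the table: one half keeps a negative `g`-coordinate, the other a negative
  -- `f`-coordinate.
  set w := -(f + g) with hw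
  have hwn : ‖w‖ ≤ 2 := by
    rw [hw, norm_neg]
    refine (norm_add_le _ _).trans ?_
    rw [h.norm_left, h.norm_right]; norm_num
  have hcw : cross u w ≠ 0 := by
    rw [hu, hw, cross_neg_right, cross_add_left, cross_smul_left, cross_smul_left, cross_add_right,
      cross_add_right, cross_self, cross_self, cross_swap g f]
    intro h0
    exact mul_ne_zero (add_pos hc hs).ne' hcr (by linarith)
  have dots : ∀ t τ : ℝ, dot f (v + t • w + τ • u - v) = -t + τ * c ∧
      dot g (v + t • w + τ • u - v) = -t - τ * s := by
    intro t τ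
    rw [show v + t • w + τ • u - v = t • w + τ • u by ring, hw, hu]
    simp only [dot_add_right, dot_smul_right, dot_neg_right, dot_self, h.norm_left, h.norm_right,
      hfg, hgf]
    constructor <;> ring
  have h₁ : ∀ t ∈ Set.Ioo 0 (ρ / 3), ∀ τ ∈ Set.Ioo 0 (ρ / 3),
      v + t • w + τ • u ∈ interior P.region := by
    intro t ht τ hτ
    refine hin _ (mem_ball_add_add hwn hun ht hτ) (Or.inr ?_)
    rw [(dots t τ).2]
    nlinarith [mul_pos hτ.1 hs, ht.1]
  have h₂ : ∀ t ∈ Set.Ioo 0 (ρ / 3), ∀ τ ∈ Set.Ioo 0 (ρ / 3),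
      v + t • w + τ • -u ∈ interior P.region := by
    intro t ht τ hτ
    refine hin _ (mem_ball_add_add hwn (by rw [norm_neg, hun]) ht hτ) (Or.inl ?_)
    rw [show τ • -u = (-τ) • u by rw [smul_neg, neg_smul], (dots t (-τ)).1]
    nlinarith [mul_pos hτ.1 hc, ht.1]
  obtain ⟨t, ht, γ', α', z', y', fz, fy, bz, by0, dz, dy, eγ, eα⟩ :=
    exists_common_base hγ hα hz hy hdz hdy
      (by rw [← neg_one_smul ℝ u, cross_smul_left]; exact mul_ne_zero (by norm_num) hcw)
      hcw (by positivity) h₂ h₁ N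
  have hx : v + t • w ∈ interior P.region := by
    have := dots t 0
    rw [zero_smul, add_zero, zero_mul, add_zero] at this
    refine hin _ ?_ (Or.inl (by rw [this.1]; linarith [ht.1]))
    rw [Metric.mem_ball, dist_eq_norm, add_sub_cancel_left, norm_smul,
      Real.norm_of_nonneg ht.1.le]
    have := mul_le_mul_of_nonneg_left hwn ht.1.le
    linarith [ht.2]
  obtain ⟨e, x, he, h1, h2⟩ := exists_trajectory_of_opposite fz fy (by0.trans bz.symm)
    (bz ▸ hx) (by rw [dz, dy, neg_neg])
  refine mem_language_of_trajectory he (fun i hi => (h2 i).trans (eα i hi))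
    (fun j hj => absurd hj (Nat.not_lt_zero j)) fun i hi => ?_
  rw [← eγ i hi, ← h1 i]
  simp

end PolygonalTable

namespace PolygonalTable

open Filter Topology

/-! ### Closures and limit sequences -/

theorem mem_closure_of_forall_finset {ι α : Type*} [TopologicalSpace α] {S : Set (ι → α)}
    {e : ι → α} (h : ∀ I : Finset ι, ∃ e' ∈ S, ∀ i ∈ I, e' i = e i) : e ∈ closure S := by
  rw [mem_closure_iff]
  intro o ho he
  obtain ⟨I, u, hu, hsub⟩ := isOpen_pi_iff.1 ho e he
  obtain ⟨e', he', heq⟩ := h I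
  exact ⟨e', hsub fun i hi => by rw [heq i hi]; exact (hu i hi).2, he'⟩

/-- The bi-infinite sequence with halves `h` and `t` around the letter `A`. -/
def twoSided {α : Type*} (h t : ℕ → α) (A : α) : ℤ → α
  | Int.ofNat 0 => A
  | Int.ofNat (k + 1) => t k
  | Int.negSucc k => h k

variable {n : ℕ} {P : PolygonalTable n}

theorem centralSeq_mem_closure {f g : ℕ → Fin n} {w : List (Fin n)}
    (h : ∀ N, centralWord f w g N ∈ P.bounceLanguage) :
    centralSeq f w g ∈ closure P.bounceSpectrum := by
  refine mem_closure_of_forall_finset fun I => ?_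
  obtain ⟨e, x, hx, hf, hw, hg⟩ := exists_trajectory_of_mem_language (h (I.sup Int.natAbs + 1))
  refine ⟨e, ⟨x, hx⟩, fun i hi => ?_⟩
  have hle : i.natAbs ≤ I.sup Int.natAbs := Finset.le_sup (f := Int.natAbs) hi
  rcases i with k | k
  · show e k = if h : k < w.length then w[k] else g (k - w.length)
    have hk : k ≤ I.sup Int.natAbs := hle
    split_ifs with h1
    · exact hw k h1
    · rw [← hg (k - w.length) (by omega)]
      congr 1; omega
  · have hk : k + 1 ≤ I.sup Int.natAbs := hle
    show e (Int.negSucc k) = f k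
    rw [← hf k (by omega)]
    congr 1
    rw [Int.negSucc_eq]; ring

/-- The forward trajectory is based at the hit before `A`, so that `A` counts as its first hit. -/
theorem prefixed_mem_closure {f g : ℕ → Fin n} {A : Fin n}
    (h : ∀ N, centralWord f [A] g N ∈ P.bounceLanguage) :
    prefixed A g ∈ closure P.forwardBounceSpectrum := by
  refine mem_closure_of_forall_finset fun I => ?_
  obtain ⟨e, x, hx, -, hw, hg⟩ := exists_trajectory_of_mem_language (h (I.sup id + 1))
  have hA : e 0 = A := by simpa using hw 0 (by simp)
  have hb := (hx (-1)).2.1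
  refine ⟨fun k => e k, ⟨fun k => x (-1 + k), ?_, ?_, fun k => ?_⟩, fun i hi => ?_⟩
  · simpa using P.edge_subset_region _ (P.openEdge_subset_edge _ hb)
  · rintro ⟨k, hk⟩
    simp only [Nat.cast_zero, add_zero] at hk
    exact P.vertex_notMem_openEdge k _ (hk ▸ hb)
  · exact (hx.follows (-1) (c := fun k => e k) (N := k + 1) fun j _ => by
      congr 1; ring) k (Nat.lt_succ_self k)
  · have hle : i ≤ I.sup id := Finset.le_sup (f := id) hi
    rcases i with _ | k
    · exact hA
    · show e ((k + 1 : ℕ) : ℤ) = g k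
      rw [← hg k (by omega)]
      congr 1
      simp only [List.length_singleton]; push_cast; ring

/-! ### Generic directions -/

theorem exists_generic_slope {C : Set ℝ} (hC : C.Countable) :
    ∃ c s : ℝ, 0 < c ∧ 0 < s ∧ c ^ 2 + s ^ 2 = 1 ∧ s / c ∉ C := by
  obtain ⟨m, hm, hm0, -⟩ := (hC.dense_compl ℝ).exists_between one_pos
  have h1 : 0 < 1 + m ^ 2 := by positivity
  have h2 : 0 < √(1 + m ^ 2) := Real.sqrt_pos.2 h1
  refine ⟨1 / √(1 + m ^ 2), m / √(1 + m ^ 2), by positivity, by positivity, ?_, ?_⟩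
  · rw [div_pow, div_pow, Real.sq_sqrt h1.le]; field_simp
  · rwa [div_div_div_cancel_right₀ h2.ne', div_one]

/-- Infinite rays out of a reflex right-angled corner into three of the quadrants. -/
theorem Corner.exists_rays {A B : Fin n} {v f g : ℂ} {a b r ρ : ℝ}
    (h : P.Corner A B v f g a b r) (hfg : dot f g = 0) (hρ : 0 < ρ)
    (hin : ∀ z ∈ Metric.ball v ρ, dot f (z - v) < 0 ∨ dot g (z - v) < 0 → z ∈ interior P.region) :
    ∃ c s : ℝ, 0 < c ∧ 0 < s ∧ ∀ σ τ : ℝ, σ ^ 2 = 1 → τ ^ 2 = 1 → (σ < 0 ∨ τ < 0) →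
      ∃ α y, P.IsForward α y ∧ y 0 = v ∧ dir (y 0) (y 1) = (σ * c) • f + (τ * s) • g ∧
        α 0 ≠ A ∧ α 0 ≠ B := by
  have hgf : dot g f = 0 := by rw [dot_comm, hfg]
  -- Slopes are avoided in absolute value, so one choice is generic for all the sign patterns.
  obtain ⟨c, s, hc, hs, hcs, hC⟩ := exists_generic_slope (Set.countable_range
    fun q : List (Fin n) × Fin n => |dot g (P.unfold q.1 (P.vertices q.2) - v) /
      dot f (P.unfold q.1 (P.vertices q.2) - v)|)
  have habs : ∀ {e : ℝ}, e ^ 2 = 1 → |e| = 1 := fun {e} he => by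
    have h1 : |e| ^ 2 = 1 := by rw [sq_abs, he]
    nlinarith [abs_nonneg e]
  refine ⟨c, s, hc, hs, fun σ τ hσ hτ hneg => ?_⟩
  set u := (σ * c) • f + (τ * s) • g with hu
  have hf : dot f u = σ * c := by
    rw [hu, dot_add_right, dot_smul_right, dot_smul_right, dot_self, h.norm_left, hfg]; ring
  have hg : dot g u = τ * s := by
    rw [hu, dot_add_right, dot_smul_right, dot_smul_right, dot_self, h.norm_right, hgf]; ring
  have hun : ‖u‖ = 1 := norm_smul_add_smul h.norm_left h.norm_right hfg (by
    rw [mul_pow, mul_pow, hσ, hτ, one_mul, one_mul, hcs])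
  have hns : P.NonsingularFrom v u := by
    refine ⟨hun, ⟨ρ, hρ, fun t ht => hin _ ?_ ?_⟩, fun l k t ht he => hC ⟨(l, k), ?_⟩⟩
    · rw [Metric.mem_ball, dist_eq_norm, add_sub_cancel_left, norm_smul, hun, mul_one,
        Real.norm_of_nonneg ht.1.le]
      exact ht.2
    · rw [add_sub_cancel_left, dot_smul_right, dot_smul_right, hf, hg]
      rcases hneg with h0 | h0
      · exact Or.inl (mul_neg_of_pos_of_neg ht.1 (mul_neg_of_neg_of_pos h0 hc))
      · exact Or.inr (mul_neg_of_pos_of_neg ht.1 (mul_neg_of_neg_of_pos h0 hs))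
    · simp only
      rw [he, add_sub_cancel_left, dot_smul_right, dot_smul_right, hf, hg, abs_div, abs_mul,
        abs_mul, abs_mul, abs_mul, habs hσ, habs hτ, abs_of_pos ht, abs_of_pos hc, abs_of_pos hs]
      field_simp
  obtain ⟨α, y, hα, hy, hd⟩ := hns.exists_isForward
  have hff := (hα 0).1.symm
  have hm := (hα 0).2.1
  -- Both edges contain `v`, and a flight cannot join two points of the same edge.
  have hvA : v ∈ P.edge A ∩ P.edge B := by rw [h.inter]; rfl
  exact ⟨α, y, hα, hy, hd, hff.ne_edge hm (hy ▸ hvA.1), hff.ne_edge hm (hy ▸ hvA.2)⟩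

/-- The sequences of limits of trajectories near a corner with angle `3π/2`. -/
theorem exists_sequences {A B : Fin n} (hAB : P.Adjacent A B)
    (hangle : P.HasInteriorAngle A B (3 * π / 2)) :
    ∃ α β γ : ℕ → Fin n, ((α 0 ≠ A ∧ α 0 ≠ B) ∧ (β 0 ≠ A ∧ β 0 ≠ B) ∧ γ 0 ≠ A ∧ γ 0 ≠ B) ∧
      ∀ N, centralWord α [] γ N ∈ P.bounceLanguage ∧
        (centralWord β [A] α N ∈ P.bounceLanguage ∧ centralWord α [A] β N ∈ P.bounceLanguage) ∧
        (centralWord γ [B] β N ∈ P.bounceLanguage ∧ centralWord β [B] γ N ∈ P.bounceLanguage) := by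
  obtain ⟨v, f, g, a, b, r, h⟩ := hAB.exists_corner
  obtain ⟨hfg, ρ, hρ, hin⟩ := h.of_hasInteriorAngle hangle
  have hgf : dot g f = 0 := by rw [dot_comm, hfg]
  obtain ⟨c, s, hc, hs, H⟩ := h.exists_rays hfg hρ hin
  obtain ⟨α, x, fα, hx, dα, hα⟩ := H 1 (-1) (by norm_num) (by norm_num) (by norm_num)
  obtain ⟨β, y, fβ, hy, dβ, hβ⟩ := H (-1) (-1) (by norm_num) (by norm_num) (by norm_num)
  obtain ⟨γ, z, fγ, hz, dγ, hγ⟩ := H (-1) 1 (by norm_num) (by norm_num) (by norm_num)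
  rw [one_mul, neg_one_mul] at dα dγ
  rw [neg_one_mul, neg_one_mul] at dβ
  refine ⟨α, β, γ, ⟨hα, hβ, hγ⟩, fun N => ⟨h.straight_words hfg hρ hin hc hs fα fγ hx hz dα dγ N,
    h.bounce_words hfg hρ hin hs fα fβ hx hy dα dβ N, ?_⟩⟩
  -- The bounces on `B` are those on `A` with the roles of `f` and `g`, and of `c` and `s`,
  -- exchanged.
  exact (h.symm.bounce_words hgf hρ (fun z hz h' => hin z hz h'.symm) hc fγ fβ hz hy
    (dγ.trans (add_comm _ _)) (dβ.trans (add_comm _ _)) N).symm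

end PolygonalTable

/-! ### The characterisation of the angle -/

theorem mainTheorem11 {n : ℕ} (P : PolygonalTable n) (A B : Fin n)
    (hAB : P.Adjacent A B) (hAB_ne_straight : ¬ P.HasInteriorAngle A B π) :
    P.HasInteriorAngle A B (3 * π / 2) ↔
      ∃ E₁ E₂ E₃ : ℤ → Fin n,
        P.IsGrazingSequence A B E₁ [] ∧
        P.IsGrazingSequence A B E₂ [A] ∧
        P.IsGrazingSequence A B E₃ [B] ∧
        ∀ N : ℕ,
          centralWord (headSeq E₁) [] (tailSeq E₁) N ∈ P.bounceLanguage ∧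
          centralWord (tailSeq E₁) [B] (headSeq E₂) N ∈ P.bounceLanguage ∧
          centralWord (headSeq E₂) [A] (tailSeq E₂) N ∈ P.bounceLanguage ∧
          centralWord (tailSeq E₂) [] (headSeq E₃) N ∈ P.bounceLanguage ∧
          centralWord (headSeq E₃) [B] (tailSeq E₃) N ∈ P.bounceLanguage ∧
          centralWord (tailSeq E₃) [A] (headSeq E₁) N ∈ P.bounceLanguage := by
  constructor
  · intro hangle
    obtain ⟨α, β, γ, ⟨hα, hβ, hγ⟩, hw⟩ := PolygonalTable.exists_sequences hAB hangle
    have hdis : ∀ {h t : ℕ → Fin n}, h 0 ≠ A ∧ h 0 ≠ B → t 0 ≠ A ∧ t 0 ≠ B →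
        Disjoint ({h 0, t 0} : Set (Fin n)) {A, B} := by
      intro h t hh ht
      simp [hh.1.symm, hh.2.symm, ht.1.symm, ht.2.symm]
    have pAα := PolygonalTable.prefixed_mem_closure fun N => (hw N).2.1.1
    have pAβ := PolygonalTable.prefixed_mem_closure fun N => (hw N).2.1.2
    have pBβ := PolygonalTable.prefixed_mem_closure fun N => (hw N).2.2.1
    have pBγ := PolygonalTable.prefixed_mem_closure fun N => (hw N).2.2.2
    -- The sequences are (α, γ), (β, α), (γ, β); the letter at index `0` is arbitrary.
    refine ⟨PolygonalTable.twoSided α γ A, PolygonalTable.twoSided β α A,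
      PolygonalTable.twoSided γ β A, Or.inl ⟨?_, hdis hα hγ, pAα, pBγ⟩,
      Or.inr ⟨?_, Set.pair_comm A B ▸ hdis hβ hα, pBβ, pAα⟩,
      Or.inr ⟨?_, Set.pair_comm A B ▸ hdis hγ hβ, pBγ, pAβ⟩, fun N => ?_⟩
    · exact PolygonalTable.centralSeq_mem_closure fun N => (hw N).1
    · exact PolygonalTable.centralSeq_mem_closure fun N => (hw N).2.1.1
    · exact PolygonalTable.centralSeq_mem_closure fun N => (hw N).2.2.1
    · obtain ⟨h1, ⟨h2, -⟩, h3, -⟩ := hw N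
      -- The tail and head that meet in words two, four and six repeat the pairs (γ, β), (α, γ), (β,
      -- α), so only three distinct words occur.
      exact ⟨h1, h3, h2, h1, h3, h2⟩
  · rintro ⟨E₁, E₂, E₃, h₁, h₂, -, hw⟩
    have key : ∀ {E : ℤ → Fin n} {w : List (Fin n)}, P.IsGrazingSequence A B E w →
        tailSeq E 0 ≠ A ∧ tailSeq E 0 ≠ B := by
      rintro E w (⟨-, hd, -⟩ | ⟨-, hd, -⟩)
      · have := Set.disjoint_left.1 hd (show E 1 ∈ ({E (-1), E 1} : Set (Fin n)) by simp)
        exact ⟨fun h => this (by simp [← h, tailSeq]), fun h => this (by simp [← h, tailSeq])⟩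
      · have := Set.disjoint_left.1 hd (show E 1 ∈ ({E (-1), E 1} : Set (Fin n)) by simp)
        exact ⟨fun h => this (by simp [← h, tailSeq]), fun h => this (by simp [← h, tailSeq])⟩
    exact PolygonalTable.hasInteriorAngle_of_words hAB hAB_ne_straight (key h₁) (key h₂)
      (fun N => (hw N).1) (fun N => (hw N).2.1) (fun N => (hw N).2.2.1) (fun N => (hw N).2.2.2.1)
      (fun N => (hw N).2.2.2.2.1) (fun N => (hw N).2.2.2.2.2)
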